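/- Let $M$ be a smooth ($C^\infty$, Hausdorff) real $n$-manifold, $V\to M$ a smooth real vector bundle of rank $n$, and $\nabla$ a flat smooth connection on $V$, with dual connection $\nabla^\vee$ on $V^\vee$. Write $X=\mathrm{tot}(V)\xrightarrow{\pi}M$ and $\widehat X=\mathrm{tot}(V^\vee)\xrightarrow{\widehat\pi}M$. *Conventions.* For a vector bundle $W$, put $\langle v+f,w+g\rangle=-\tfrac12(f(w)+g(v))$ on $W\oplus W^\vee$. A generalized almost complex structure on $W$ is a smooth $\langle\,,\rangle$-orthogonal endomorphism $\mathcal J$ of $W\oplus W^\vee$ with $\mathcal J^2=-1$; on a manifold one takes $W$ to be the tangent bundle. It is integrable if the sheaf of smooth sections of its $+i$ eigenbundle in $(T\oplus T^\vee)\otimes\mathbb C$ is closed under the Courant bracket $$[Y+\xi,Z+\eta]=[Y,Z]+\mathcal L_Y\eta-\mathcal L_Z\xi+\tfrac12 d(\iota_Z\xi-\iota_Y\eta).$$ A generalized Kähler structure is a pair $(\mathcal J,\mathcal J')$ of commuting, integrable generalized almost complex structures such that $G=-\mathcal J\mathcal J'$ is positive definite, i.e. $\sigma\langle Gu,u\rangle>0$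 for all $u\neq0$. Here $\sigma\in\{1,-1\}$ is a fixed sign convention for the pairing; everything below holds for both choices. *Semi-flat structures.* Let $D:T_X\to\pi^*V$ be the vertical projection defined by $\nabla$, i.e. $D=(\pi^*\nabla)(S)$ with $S$ the tautological section of $\pi^*V$. The isomorphism $A=(D,d\pi):T_X\to\pi^*V\oplus\pi^*T_M$ induces $$F=A\oplus(A^{-1})^\vee:\ T_X\oplus T_X^\vee\to\pi^*(V\oplus T_M\oplus V^\vee\oplus T_M^\vee).$$ A generalized almost complex structure $\underline{\mathcal J}$ on $V\oplus T_M$ is adapted if $\underline{\mathcal J}(V\oplus V^\vee)=T_M\oplus T_M^\vee$. A $\nabla$-semi-flat structure on $X$ is a generalized almost complex structure of the form $F^{-1}(\pi^*\underline{\mathcal J})F$ with $\underline{\mathcal J}$ adapted; a $\nabla$-semi-flat generalized Kähler structure is a generalized Kähler structure $(\mathcal J,\mathcal J')$ on $X$ with $\mathcal J$ and $\mathcal J'$ both $\nabla$-semi-flat. The same definitions apply to $(V^\vee,\nabla^\vee)$ and $\widehat X$, with $\widehat F$ in place of $F$. For an endomorphism $\underline{\mathcal J}$ of $V\oplus T_M\oplus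 V^\vee\oplus T_M^\vee$ let $\check{\underline{\mathcal J}}$ be its conjugate by the transposition of the summands $V$ and $V^\vee$, an endomorphism of $V^\vee\oplus T_M\oplus V\oplus T_M^\vee$ (where $V^{\vee\vee}=V$). **Statement.** If $\underline{\mathcal J}$ is adapted, so is $\check{\underline{\mathcal J}}$, and $$\mathcal J=F^{-1}(\pi^*\underline{\mathcal J})F\ \longmapsto\ \widehat{\mathcal J}=\widehat F^{-1}(\widehat\pi^*\check{\underline{\mathcal J}})\widehat F$$ is a well-defined bijection from the $\nabla$-semi-flat generalized almost complex structures on $X$ to the $\nabla^\vee$-semi-flat generalized almost complex structures on $\widehat X$. For all $\nabla$-semi-flat $\mathcal J,\mathcal J'$ on $X$: 1. $\mathcal J$ is integrable if and only if $\widehat{\mathcal J}$ is integrable; 2. $\mathcal J$ and $\mathcal J'$ commute if and only if $\widehat{\mathcal J}$ and $\widehat{\mathcal J}'$ commute; 3. $-\mathcal J\mathcal J'$ is positive definite if and only if $-\widehat{\mathcal J}\widehat{\mathcal J}'$ is. Consequently $(\mathcal J,\mathcal J')\mapsto(\widehat{\mathcal J},\widehat{\mathcal J}')$ is a bijection from the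 $\nabla$-semi-flat generalized Kähler structures on $X$ to the $\nabla^\vee$-semi-flat generalized Kähler structures on $\widehat X$. -/

import Mathlib

open Bundle
open scoped Manifold ContDiff Topology

set_option linter.unusedSectionVars false

noncomputable section

namespace GenGeom

/-! ### The bundle `W ⊕ W^∨` and generalized almost complex structures on a vector bundle `W` -/

section Linear

/-- The fibre `w ⊕ w^∨`, for a finite dimensional real topological vector space `w`. -/
abbrev Gen (w : Type*) [AddCommGroup w] [Module ℝ w] [TopologicalSpace w] : Type _ :=
  w × (w →L[ℝ] ℝ)

variable {w : Type*} [AddCommGroup w] [Module ℝ w] [TopologicalSpace w]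
  [IsTopologicalAddGroup w] [ContinuousSMul ℝ w]

/-- The pairing `⟨v + f, w + g⟩ = -(1/2) (f(w) + g(v))` on `w ⊕ w^∨`. -/
def pairing (a b : Gen w) : ℝ := -(1 / 2) * (a.2 b.1 + b.2 a.1)

end Linear

section Bundles

variable {EB : Type*} [NormedAddCommGroup EB] [NormedSpace ℝ EB]
  {HB : Type*} [TopologicalSpace HB] (I : ModelWithCorners ℝ EB HB)
  {B : Type*} [TopologicalSpace B] [ChartedSpace HB B]
  (G : Type*) [NormedAddCommGroup G] [NormedSpace ℝ G]
  {W : B → Type*} [TopologicalSpace (TotalSpace G W)]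
  [∀ x, AddCommGroup (W x)] [∀ x, Module ℝ (W x)] [∀ x, TopologicalSpace (W x)]
  [∀ x, IsTopologicalAddGroup (W x)] [∀ x, ContinuousSMul ℝ (W x)]
  [FiberBundle G W] [VectorBundle ℝ G W]

/-- `s` is a smooth section of `W ⊕ W^∨` over `U`: both of its components are smooth. -/
def SmoothSectionOn (s : ∀ x, Gen (W x)) (U : Set B) : Prop :=
  ContMDiffOn I (I.prod 𝓘(ℝ, G)) ∞ (fun x => TotalSpace.mk' G x (s x).1) U ∧
  ContMDiffOn I (I.prod 𝓘(ℝ, G →L[ℝ] ℝ)) ∞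
    (fun x => (TotalSpace.mk' (G →L[ℝ] ℝ) x (s x).2 :
      TotalSpace (G →L[ℝ] ℝ) (fun x => W x →L[ℝ] ℝ))) U

/-- A generalized almost complex structure on the vector bundle `W` (with model fibre `G`):
a smooth bundle endomorphism of `W ⊕ W^∨` that is orthogonal for the pairing and squares
to `-1`. -/
structure IsGenAlmostComplex (J : ∀ x, Gen (W x) →ₗ[ℝ] Gen (W x)) : Prop where
  sq : ∀ x u, J x (J x u) = -u
  orth : ∀ x u v, pairing (J x u) (J x v) = pairing u v
  smooth : ∀ U : Set B, IsOpen U → ∀ s : ∀ x, Gen (W x),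
    SmoothSectionOn I G s U → SmoothSectionOn I G (fun x => J x (s x)) U

end Bundles

/-! ### The Courant bracket and integrability on a manifold `B` -/

section Courant

variable {EB : Type*} [NormedAddCommGroup EB] [NormedSpace ℝ EB]
  {HB : Type*} [TopologicalSpace HB] (I : ModelWithCorners ℝ EB HB)
  {B : Type*} [TopologicalSpace B] [ChartedSpace HB B]

/-- The fibre at `x` of `T_B ⊕ T_B^∨`. -/
abbrev GenTangent (x : B) : Type _ := Gen (TangentSpace I x)

/-- The one-form `ξ` in the preferred chart at `x₀`, as a one-form on the model space. -/
def oneFormInChart (ξ : ∀ x : B, TangentSpace I x →L[ℝ] ℝ) (x₀ : B) (y : EB) : EB →L[ℝ] ℝ :=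
  (ξ ((extChartAt I x₀).symm y)).comp
    (mfderivWithin 𝓘(ℝ, EB) I (extChartAt I x₀).symm (Set.range I) y)

/-- The exterior derivative of a one-form at `x₀`, contracted with `u`: the one-form
`v ↦ dξ (u, v)`, computed in the preferred chart at `x₀` from
`dω (a, b) = (D_a ω) b - (D_b ω) a`. -/
def contractExtDeriv (ξ : ∀ x : B, TangentSpace I x →L[ℝ] ℝ) (x₀ : B) (u : TangentSpace I x₀) :
    TangentSpace I x₀ →L[ℝ] ℝ :=
  let Dω : EB →L[ℝ] EB →L[ℝ] ℝ :=
    fderivWithin ℝ (oneFormInChart I ξ x₀) (Set.range I) (extChartAt I x₀ x₀)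
  let dφ : TangentSpace I x₀ →L[ℝ] EB := mfderiv I 𝓘(ℝ, EB) (extChartAt I x₀) x₀
  (Dω (dφ u) - Dω.flip (dφ u)).comp dφ

/-- The Lie derivative `L_X η = ι_X dη + d (ι_X η)` of a one-form. -/
def lieDerivOneForm (X : ∀ x : B, TangentSpace I x) (η : ∀ x : B, TangentSpace I x →L[ℝ] ℝ)
    (x : B) : TangentSpace I x →L[ℝ] ℝ :=
  contractExtDeriv I η x (X x) + mvfderiv I (fun y => η y (X y)) x

/-- The Courant bracket of two sections of `T_B ⊕ T_B^∨`:
`[X + ξ, Y + η] = [X, Y] + L_X η - L_Y ξ + (1/2) d (ι_Y ξ - ι_X η)`. -/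
def courant (s t : ∀ x : B, GenTangent I x) (x : B) : GenTangent I x :=
  (VectorField.mlieBracket I (fun y => (s y).1) (fun y => (t y).1) x,
    lieDerivOneForm I (fun y => (s y).1) (fun y => (t y).2) x
      - lieDerivOneForm I (fun y => (t y).1) (fun y => (s y).2) x
      + (1 / 2 : ℝ) • mvfderiv I (fun y => (s y).2 (t y).1 - (t y).2 (s y).1) x)

/-- The fibre at `x` of `(T_B ⊕ T_B^∨) ⊗ ℂ`; the pair `(a, b)` stands for `a + i b`. -/
abbrev GenTangentC (x : B) : Type _ := GenTangent I x × GenTangent I x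

/-- The complex bilinear extension of the Courant bracket,
`[a + i b, c + i d] = [a, c] - [b, d] + i ([a, d] + [b, c])`. -/
def courantC (s t : ∀ x : B, GenTangentC I x) (x : B) : GenTangentC I x :=
  (courant I (fun y => (s y).1) (fun y => (t y).1) x
      - courant I (fun y => (s y).2) (fun y => (t y).2) x,
    courant I (fun y => (s y).1) (fun y => (t y).2) x
      + courant I (fun y => (s y).2) (fun y => (t y).1) x)

/-- The `+i` eigenspace `E_x` of `J` in the complexified fibre: `J (a + i b) = i (a + i b)`, that
is `J a = -b` and `J b = a`. -/
def plusEigenspace (J : ∀ x : B, GenTangent I x →ₗ[ℝ] GenTangent I x) (x : B) :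
    Set (GenTangentC I x) :=
  {z | J x z.1 = -z.2 ∧ J x z.2 = z.1}

/-- `J` is integrable: the sheaf of smooth sections of its `+i` eigenbundle is closed under the
Courant bracket. -/
def Integrable [IsManifold I 1 B] (J : ∀ x : B, GenTangent I x →ₗ[ℝ] GenTangent I x) : Prop :=
  ∀ U : Set B, IsOpen U → ∀ s t : ∀ x : B, GenTangentC I x,
    SmoothSectionOn I EB (fun x => (s x).1) U → SmoothSectionOn I EB (fun x => (s x).2) U →
    SmoothSectionOn I EB (fun x => (t x).1) U → SmoothSectionOn I EB (fun x => (t x).2) U →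
    (∀ x ∈ U, s x ∈ plusEigenspace I J x) → (∀ x ∈ U, t x ∈ plusEigenspace I J x) →
    ∀ x ∈ U, courantC I s t x ∈ plusEigenspace I J x

/-- The two structures commute. -/
def Commutes (J J' : ∀ x : B, GenTangent I x →ₗ[ℝ] GenTangent I x) : Prop :=
  ∀ x u, J x (J' x u) = J' x (J x u)

/-- `G = -J J'` is positive definite for the pairing `σ ⟨ , ⟩`. Here `σ = 1` and `σ = -1` are the
two sign conventions for the standard pairing of `T_B ⊕ T_B^∨`. -/
def PositiveProduct (σ : ℤˣ) (J J' : ∀ x : B, GenTangent I x →ₗ[ℝ] GenTangent I x) : Prop :=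
  ∀ x u, u ≠ 0 → 0 < ((σ : ℤ) : ℝ) * pairing (-(J x (J' x u))) u

/-- `(J, J')` is a generalized Kähler structure on `B`: a commuting pair of integrable generalized
almost complex structures such that `-J J'` is positive definite. -/
structure IsGenKahler [IsManifold I 1 B] (σ : ℤˣ)
    (J J' : ∀ x : B, GenTangent I x →ₗ[ℝ] GenTangent I x) : Prop where
  left : IsGenAlmostComplex I EB J
  right : IsGenAlmostComplex I EB J'
  commutes : Commutes I J J'
  positive : PositiveProduct I σ J J'
  integrable_left : Integrable I J
  integrable_right : Integrable I J'

end Courant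

/-! ### Connections -/

section Connection

variable {E : Type*} [NormedAddCommGroup E] [NormedSpace ℝ E] [FiniteDimensional ℝ E]
  {F : Type*} [NormedAddCommGroup F] [NormedSpace ℝ F] [FiniteDimensional ℝ F]
  {M : Type*} [TopologicalSpace M] [ChartedSpace E M] [IsManifold 𝓘(ℝ, E) ∞ M]
  {V : M → Type*} [TopologicalSpace (TotalSpace F V)]
  [∀ x, AddCommGroup (V x)] [∀ x, Module ℝ (V x)] [∀ x, TopologicalSpace (V x)]
  [∀ x, IsTopologicalAddGroup (V x)] [∀ x, ContinuousSMul ℝ (V x)]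
  [FiberBundle F V] [VectorBundle ℝ F V] [ContMDiffVectorBundle ∞ F V 𝓘(ℝ, E)]

/-- The connection is flat: `∇_X ∇_Y σ - ∇_Y ∇_X σ - ∇_[X, Y] σ = 0` for all smooth vector
fields `X`, `Y` and smooth sections `σ` over an open set. -/
def IsFlat (cov : CovariantDerivative 𝓘(ℝ, E) F V) : Prop :=
  ∀ U : Set M, IsOpen U →
  ∀ (X Y : ∀ x : M, TangentSpace 𝓘(ℝ, E) x) (σ : ∀ x, V x),
    ContMDiffOn 𝓘(ℝ, E) (𝓘(ℝ, E).prod 𝓘(ℝ, E)) ∞ (fun x => TotalSpace.mk' E x (X x)) U →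
    ContMDiffOn 𝓘(ℝ, E) (𝓘(ℝ, E).prod 𝓘(ℝ, E)) ∞ (fun x => TotalSpace.mk' E x (Y x)) U →
    ContMDiffOn 𝓘(ℝ, E) (𝓘(ℝ, E).prod 𝓘(ℝ, F)) ∞ (fun x => TotalSpace.mk' F x (σ x)) U →
    ∀ x ∈ U,
      cov (fun y => cov σ y (Y y)) x (X x) - cov (fun y => cov σ y (X y)) x (Y x)
        - cov σ x (VectorField.mlieBracket 𝓘(ℝ, E) X Y x) = 0

/-- The dual bundle `V^∨`. -/
abbrev DualBundle {M : Type*} (V : M → Type*) [∀ x, AddCommGroup (V x)] [∀ x, Module ℝ (V x)]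
    [∀ x, TopologicalSpace (V x)] : M → Type _ := fun x => V x →L[ℝ] ℝ

theorem mdiffAt_dual_apply {f : ∀ x, DualBundle V x} {σ : ∀ x, V x} {x : M}
    (hf : MDifferentiableAt 𝓘(ℝ, E) (𝓘(ℝ, E).prod 𝓘(ℝ, F →L[ℝ] ℝ))
      (fun y => (TotalSpace.mk' (F →L[ℝ] ℝ) y (f y) :
        TotalSpace (F →L[ℝ] ℝ) (DualBundle V))) x)
    (hσ : MDifferentiableAt 𝓘(ℝ, E) (𝓘(ℝ, E).prod 𝓘(ℝ, F))
      (fun y => TotalSpace.mk' F y (σ y)) x) :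
    MDifferentiableAt 𝓘(ℝ, E) 𝓘(ℝ, ℝ) (fun y => f y (σ y)) x := by
  have h := MDifferentiableAt.clm_bundle_apply (E₂ := Bundle.Trivial M ℝ) (b := fun y => y)
    (ϕ := f) hf hσ
  exact ((mdifferentiableAt_totalSpace ..).1 h).2

/-- The one-form `u ↦ u (f (σ)) - f (∇_u σ)` at `x`. -/
def dualConnAux (cov : CovariantDerivative 𝓘(ℝ, E) F V) (f : ∀ x, DualBundle V x) (x : M)
    (σ : ∀ x, V x) : TangentSpace 𝓘(ℝ, E) x →L[ℝ] ℝ :=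
  mvfderiv 𝓘(ℝ, E) (fun y => f y (σ y)) x - (f x).comp (cov σ x)

theorem tensorialAt_dualConnAux (cov : CovariantDerivative 𝓘(ℝ, E) F V)
    {f : ∀ x, DualBundle V x} {x : M}
    (hf : MDifferentiableAt 𝓘(ℝ, E) (𝓘(ℝ, E).prod 𝓘(ℝ, F →L[ℝ] ℝ))
      (fun y => (TotalSpace.mk' (F →L[ℝ] ℝ) y (f y) :
        TotalSpace (F →L[ℝ] ℝ) (DualBundle V))) x) :
    TensorialAt 𝓘(ℝ, E) F (dualConnAux cov f x) x where
  smul {g σ} hg hσ := by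
    have h := mdiffAt_dual_apply hf hσ
    have e : (fun y => f y ((g • σ) y)) = fun y => g y * f y (σ y) := by
      ext y; simp
    ext u
    simp only [dualConnAux, e]
    rw [mvfderiv_fun_mul hg h, cov.isCovariantDerivativeOn.leibniz hσ hg]
    simp
    ring
  add {σ τ} hσ hτ := by
    have h := mdiffAt_dual_apply hf hσ
    have h' := mdiffAt_dual_apply hf hτ
    have e : (fun y => f y ((σ + τ) y)) = fun y => f y (σ y) + f y (τ y) := by
      ext y; simp
    ext u
    simp only [dualConnAux, e]
    rw [mvfderiv_fun_add h h', cov.isCovariantDerivativeOn.add hσ hτ]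
    simp
    ring

open scoped Classical in
/-- The value of the dual connection: `(∇^∨_u f) (v) = u (f (σ)) - f (∇_u σ)`, where `σ` is any
section of `V` differentiable at `x` with `σ x = v` (here the extension of `v` that is constant in
the preferred trivialization; by tensoriality the choice is irrelevant). If `f` is not
differentiable at `x`, the value is zero. -/
def dualConnFun (cov : CovariantDerivative 𝓘(ℝ, E) F V) (f : ∀ x, DualBundle V x) (x : M) :
    TangentSpace 𝓘(ℝ, E) x →L[ℝ] DualBundle V x :=
  if hf : MDifferentiableAt 𝓘(ℝ, E) (𝓘(ℝ, E).prod 𝓘(ℝ, F →L[ℝ] ℝ))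
      (fun y => (TotalSpace.mk' (F →L[ℝ] ℝ) y (f y) :
        TotalSpace (F →L[ℝ] ℝ) (DualBundle V))) x then
    haveI : T2Space (V x) := FiberBundle.t2Space F V x
    haveI : FiniteDimensional ℝ (V x) := VectorBundle.finiteDimensional ℝ F V x
    haveI : FiniteDimensional ℝ (TangentSpace 𝓘(ℝ, E) x) := inferInstanceAs (FiniteDimensional ℝ E)
    haveI : T2Space (TangentSpace 𝓘(ℝ, E) x) := inferInstanceAs (T2Space E)
    LinearMap.toContinuousLinearMap
      { toFun u := LinearMap.toContinuousLinearMap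
          { toFun v := TensorialAt.mkHom (dualConnAux cov f x) x (tensorialAt_dualConnAux cov hf) v u
            map_add' := by intros; simp
            map_smul' := by intros; simp }
        map_add' := by intros; ext; simp
        map_smul' := by intros; ext; simp }
  else 0

theorem dualConnFun_apply (cov : CovariantDerivative 𝓘(ℝ, E) F V)
    {f : ∀ x, DualBundle V x} {σ : ∀ x, V x} {x : M}
    (hf : MDifferentiableAt 𝓘(ℝ, E) (𝓘(ℝ, E).prod 𝓘(ℝ, F →L[ℝ] ℝ))
      (fun y => (TotalSpace.mk' (F →L[ℝ] ℝ) y (f y) :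
        TotalSpace (F →L[ℝ] ℝ) (DualBundle V))) x)
    (hσ : MDifferentiableAt 𝓘(ℝ, E) (𝓘(ℝ, E).prod 𝓘(ℝ, F))
      (fun y => TotalSpace.mk' F y (σ y)) x) (u : TangentSpace 𝓘(ℝ, E) x) :
    dualConnFun cov f x u (σ x) =
      mvfderiv 𝓘(ℝ, E) (fun y => f y (σ y)) x u - f x (cov σ x u) := by
  have := TensorialAt.mkHom_apply (Φ := dualConnAux cov f x) (tensorialAt_dualConnAux cov hf) hσ
  simp only [dualConnFun, dif_pos hf]
  exact DFunLike.congr_fun this u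

/-- The dual connection `∇^∨` on `V^∨`. -/
def dualConn (cov : CovariantDerivative 𝓘(ℝ, E) F V) :
    CovariantDerivative 𝓘(ℝ, E) (F →L[ℝ] ℝ) (DualBundle V) where
  toFun := dualConnFun cov
  isCovariantDerivativeOnUniv :=
    { add := by
        intro f g x hf hg _
        ext u v
        have hσ := FiberBundle.mdifferentiableAt_extend 𝓘(ℝ, E) F v
        have hfg := mdifferentiableAt_add_section hf hg
        have h1 := dualConnFun_apply cov hfg hσ u
        have h2 := dualConnFun_apply cov hf hσ u
        have h3 := dualConnFun_apply cov hg hσ u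
        have e : (fun y => (f + g) y (FiberBundle.extend F v y)) =
            fun y => f y (FiberBundle.extend F v y) + g y (FiberBundle.extend F v y) := by
          ext y; simp
        rw [FiberBundle.extend_apply_self] at h1 h2 h3
        erw [h1]
        erw [e, mvfderiv_fun_add (mdiffAt_dual_apply hf hσ) (mdiffAt_dual_apply hg hσ)]
        simp only [add_apply, Pi.add_apply]
        rw [h2, h3]
        ring
      leibniz := by
        intro f g x hf hg _
        ext u v
        have hσ := FiberBundle.mdifferentiableAt_extend 𝓘(ℝ, E) F v
        have hfg := hg.smul_section hf
        have h1 := dualConnFun_apply cov hfg hσ u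
        have h2 := dualConnFun_apply cov hf hσ u
        have e : (fun y => (g • f) y (FiberBundle.extend F v y)) =
            fun y => g y * f y (FiberBundle.extend F v y) := by
          ext y; simp
        rw [FiberBundle.extend_apply_self] at h1 h2
        erw [h1]
        erw [e, mvfderiv_fun_mul hg (mdiffAt_dual_apply hf hσ)]
        simp
        rw [h2]
        ring }

/-! ### The splitting of the tangent sequence of `X = tot V` -/

/-- The vertical projection `D : T_X → π^* V` at the point `p` of `X = tot V`. In the frame `e_i`
with fibre coordinates `ξ_i` given by the preferred trivialization it is
`D = π^{-1} e_i ⊗ dξ_i + ξ_i π^* (∇ e_i)`. -/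
def vertProj (cov : CovariantDerivative 𝓘(ℝ, E) F V) (p : TotalSpace F V) :
    TangentSpace (𝓘(ℝ, E).prod 𝓘(ℝ, F)) p →L[ℝ] V p.proj :=
  let e := trivializationAt F V p.proj
  (e.symmL ℝ p.proj).comp
      (mvfderiv (𝓘(ℝ, E).prod 𝓘(ℝ, F)) (fun q : TotalSpace F V => (e q).2) p)
    + (cov (fun y => e.symm y (e p).2) p.proj).comp
      (mfderiv (𝓘(ℝ, E).prod 𝓘(ℝ, F)) 𝓘(ℝ, E) (fun q : TotalSpace F V => q.proj) p)

/-- The map `(D, dπ) : T_X → π^* V ⊕ π^* T_M` at `p`. -/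
def splitMap (cov : CovariantDerivative 𝓘(ℝ, E) F V) (p : TotalSpace F V) :
    TangentSpace (𝓘(ℝ, E).prod 𝓘(ℝ, F)) p →L[ℝ] V p.proj × TangentSpace 𝓘(ℝ, E) p.proj :=
  (vertProj cov p).prod
    (mfderiv (𝓘(ℝ, E).prod 𝓘(ℝ, F)) 𝓘(ℝ, E) (fun q : TotalSpace F V => q.proj) p)

theorem splitMap_bijective (cov : CovariantDerivative 𝓘(ℝ, E) F V) (p : TotalSpace F V) :
    Function.Bijective (splitMap cov p) := by
  have hn : (∞ : WithTop ℕ∞) ≠ 0 := by simp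
  have : FiniteDimensional ℝ (V p.proj) := VectorBundle.finiteDimensional ℝ F V p.proj
  have : FiniteDimensional ℝ (TangentSpace 𝓘(ℝ, E) p.proj) :=
    inferInstanceAs (FiniteDimensional ℝ E)
  have : FiniteDimensional ℝ (TangentSpace (𝓘(ℝ, E).prod 𝓘(ℝ, F)) p) :=
    inferInstanceAs (FiniteDimensional ℝ (E × F))
  set e := trivializationAt F V p.proj with he
  have hp : p.proj ∈ e.baseSet := FiberBundle.mem_baseSet_trivializationAt' p.proj
  have hps : p ∈ e.source := e.mem_source.2 hp
  have hmd : e.toOpenPartialHomeomorph.MDifferentiable (𝓘(ℝ, E).prod 𝓘(ℝ, F))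
      (𝓘(ℝ, E).prod 𝓘(ℝ, F)) :=
    ⟨(Bundle.Trivialization.contMDiffOn (n := ∞) (IB := 𝓘(ℝ, E)) e).mdifferentiableOn hn,
     (Bundle.Trivialization.contMDiffOn_symm (n := ∞) (IB := 𝓘(ℝ, E)) e).mdifferentiableOn hn⟩
  have hinj : Function.Injective (splitMap cov p) := by
    rw [injective_iff_map_eq_zero]
    intro v hv
    obtain ⟨hD, hπ⟩ := Prod.ext_iff.1 hv
    have hD' : vertProj cov p v = 0 := hD
    have hπ' : mfderiv (𝓘(ℝ, E).prod 𝓘(ℝ, F)) 𝓘(ℝ, E)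
      (fun q : TotalSpace F V => q.proj) p v = 0 := hπ
    have hed : MDifferentiableAt (𝓘(ℝ, E).prod 𝓘(ℝ, F)) (𝓘(ℝ, E).prod 𝓘(ℝ, F)) e p :=
      hmd.mdifferentiableAt hps
    have hξ : MDifferentiableAt (𝓘(ℝ, E).prod 𝓘(ℝ, F)) 𝓘(ℝ, F)
      (fun q : TotalSpace F V => (e q).2) p := hed.snd
    have hpd : MDifferentiableAt (𝓘(ℝ, E).prod 𝓘(ℝ, F)) 𝓘(ℝ, E)
      (fun q : TotalSpace F V => q.proj) p :=
      (contMDiffAt_proj (n := ∞) (IB := 𝓘(ℝ, E)) V).mdifferentiableAt hn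
    have hξ0 : mvfderiv (𝓘(ℝ, E).prod 𝓘(ℝ, F)) (fun q : TotalSpace F V => (e q).2) p v = 0 := by
      simp only [vertProj, ← he, add_apply, ContinuousLinearMap.comp_apply, hπ',
        map_zero, add_zero] at hD'
      have := congrArg (e.continuousLinearMapAt ℝ p.proj) hD'
      rwa [map_zero, e.continuousLinearMapAt_symmL hp] at this
    have hev : (e : TotalSpace F V → M × F) =ᶠ[𝓝 p] fun q => (q.proj, (e q).2) := by
      filter_upwards [e.open_source.mem_nhds hps] with q hq
      exact Prod.ext (e.coe_fst hq) rfl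
    apply hmd.mfderiv_injective hps
    rw [map_zero]
    have h1 := hev.mfderiv_eq (I := 𝓘(ℝ, E).prod 𝓘(ℝ, F)) (I' := 𝓘(ℝ, E).prod 𝓘(ℝ, F))
    rw [mfderiv_prodMk hpd hξ] at h1
    refine (DFunLike.congr_fun h1 v).trans ?_
    exact Prod.ext hπ' hξ0
  have hfin : Module.finrank ℝ (TangentSpace (𝓘(ℝ, E).prod 𝓘(ℝ, F)) p) =
      Module.finrank ℝ (V p.proj × TangentSpace 𝓘(ℝ, E) p.proj) := by
    have h1 : Module.finrank ℝ (V p.proj) = Module.finrank ℝ F :=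
      (VectorBundle.continuousLinearEquivAt ℝ F V p.proj).toLinearEquiv.finrank_eq
    have h2 : Module.finrank ℝ (TangentSpace (𝓘(ℝ, E).prod 𝓘(ℝ, F)) p) =
      Module.finrank ℝ (E × F) := rfl
    have h3 : Module.finrank ℝ (TangentSpace 𝓘(ℝ, E) p.proj) = Module.finrank ℝ E := rfl
    rw [Module.finrank_prod, h1, h2, h3, Module.finrank_prod, add_comm]
  exact ⟨hinj, (LinearMap.injective_iff_surjective_of_finrank_eq_finrank hfin
    (f := (splitMap cov p).toLinearMap)).1 hinj⟩

/-- The isomorphism `(D, dπ) : T_X → π^* V ⊕ π^* T_M` at `p`; its inverse is `(j, α)`, where `j` is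
the inclusion of the vertical tangent vectors and `α` the horizontal lift. -/
def splitEquiv (cov : CovariantDerivative 𝓘(ℝ, E) F V) (p : TotalSpace F V) :
    TangentSpace (𝓘(ℝ, E).prod 𝓘(ℝ, F)) p ≃L[ℝ] V p.proj × TangentSpace 𝓘(ℝ, E) p.proj :=
  haveI : T2Space (V p.proj) := FiberBundle.t2Space F V p.proj
  haveI : T2Space (TangentSpace 𝓘(ℝ, E) p.proj) := inferInstanceAs (T2Space E)
  haveI : T2Space (TangentSpace (𝓘(ℝ, E).prod 𝓘(ℝ, F)) p) := inferInstanceAs (T2Space (E × F))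
  haveI : FiniteDimensional ℝ (TangentSpace (𝓘(ℝ, E).prod 𝓘(ℝ, F)) p) :=
    inferInstanceAs (FiniteDimensional ℝ (E × F))
  (LinearEquiv.ofBijective (splitMap cov p).toLinearMap (splitMap_bijective cov p))
    |>.toContinuousLinearEquiv

/-- The isomorphism induced by a linear isomorphism `w ≃ w'` from `w ⊕ w^∨` to `w' ⊕ w'^∨`. -/
def genMap {w w' : Type*} [AddCommGroup w] [Module ℝ w] [TopologicalSpace w]
    [IsTopologicalAddGroup w] [ContinuousSMul ℝ w]
    [AddCommGroup w'] [Module ℝ w'] [TopologicalSpace w']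
    [IsTopologicalAddGroup w'] [ContinuousSMul ℝ w'] (A : w ≃L[ℝ] w') : Gen w ≃ₗ[ℝ] Gen w' where
  toFun u := (A u.1, u.2.comp (A.symm : w' →L[ℝ] w))
  invFun u := (A.symm u.1, u.2.comp (A : w →L[ℝ] w'))
  map_add' _ _ := by simp
  map_smul' _ _ := by simp
  left_inv u := by ext <;> simp
  right_inv u := by ext <;> simp

/-- The pull back to `X = tot V`, through `F = ((D, dπ), ((D, dπ)⁻¹)^∨)`, of an endomorphism `K` of
`V ⊕ T_M ⊕ V^∨ ⊕ T_M^∨`: `F⁻¹ (π^* K) F`. -/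
def lift (cov : CovariantDerivative 𝓘(ℝ, E) F V)
    (K : ∀ x : M, Gen (V x × TangentSpace 𝓘(ℝ, E) x) →ₗ[ℝ] Gen (V x × TangentSpace 𝓘(ℝ, E) x))
    (p : TotalSpace F V) :
    GenTangent (𝓘(ℝ, E).prod 𝓘(ℝ, F)) p →ₗ[ℝ] GenTangent (𝓘(ℝ, E).prod 𝓘(ℝ, F)) p :=
  (genMap (splitEquiv cov p)).symm.toLinearMap ∘ₗ K p.proj ∘ₗ
    (genMap (splitEquiv cov p)).toLinearMap

end Connection

/-! ### The transposition of `V` and `V^∨` -/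

section Swap

variable {v : Type*} [AddCommGroup v] [Module ℝ v] [TopologicalSpace v]
  [IsTopologicalAddGroup v] [ContinuousSMul ℝ v]
  {t : Type*} [AddCommGroup t] [Module ℝ t] [TopologicalSpace t]
  [IsTopologicalAddGroup t] [ContinuousSMul ℝ t]

/-- The canonical map `v → v^∨^∨`. -/
def evalDual (a : v) : (v →L[ℝ] ℝ) →L[ℝ] ℝ where
  toFun f := f a
  map_add' _ _ := rfl
  map_smul' _ _ := rfl
  cont := continuous_eval_const a

/-- The transposition `v ⊕ t ⊕ v^∨ ⊕ t^∨ → v^∨ ⊕ t ⊕ v^∨^∨ ⊕ t^∨`,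
`(a, b, f, g) ↦ (f, b, a, g)`; a functional on `v × t` is identified with the pair of its
restrictions `(f, g)`, and `a` is viewed in `v^∨^∨`. -/
def transposeMap : Gen (v × t) →ₗ[ℝ] Gen ((v →L[ℝ] ℝ) × t) where
  toFun u := ((u.2.comp (ContinuousLinearMap.inl ℝ v t), u.1.2),
    (evalDual u.1.1).coprod (u.2.comp (ContinuousLinearMap.inr ℝ v t)))
  map_add' a b := by
    ext x <;> simp [evalDual]
  map_smul' c a := by
    ext x <;> simp [evalDual]

theorem transposeMap_bijective [T2Space v] [FiniteDimensional ℝ v] :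
    Function.Bijective (transposeMap (v := v) (t := t)) := by
  constructor
  · rw [injective_iff_map_eq_zero]
    rintro ⟨⟨a, b⟩, φ⟩ h
    have h1 : φ.comp (ContinuousLinearMap.inl ℝ v t) = 0 := congrArg (fun z => z.1.1) h
    have h2 : b = 0 := congrArg (fun z => z.1.2) h
    have h3 : (evalDual a).coprod (φ.comp (ContinuousLinearMap.inr ℝ v t)) = 0 :=
      congrArg (fun z => z.2) h
    have ha : a = 0 := by
      rw [← Module.forall_dual_apply_eq_zero_iff ℝ]
      intro f
      have := DFunLike.congr_fun h3 (LinearMap.toContinuousLinearMap f, 0)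
      have h0 : φ ((0 : v), (0 : t)) = 0 := map_zero φ
      simpa [evalDual, h0] using this
    have hφ : φ = 0 := by
      ext x
      · simpa using DFunLike.congr_fun h1 x
      · simpa using DFunLike.congr_fun h3 (0, x)
    simp [ha, h2, hφ]
  · rintro ⟨⟨f, b⟩, ψ⟩
    let a : v := (Module.evalEquiv ℝ v).symm
      ((ψ.comp (ContinuousLinearMap.inl ℝ (v →L[ℝ] ℝ) t)).toLinearMap ∘ₗ
        (LinearMap.toContinuousLinearMap : (v →ₗ[ℝ] ℝ) ≃ₗ[ℝ] (v →L[ℝ] ℝ)).toLinearMap)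
    have ha : ∀ g : v →L[ℝ] ℝ, g a = ψ (g, 0) := by
      intro g
      have := Module.apply_evalEquiv_symm_apply (R := ℝ) (M := v) g.toLinearMap
        ((ψ.comp (ContinuousLinearMap.inl ℝ (v →L[ℝ] ℝ) t)).toLinearMap ∘ₗ
          (LinearMap.toContinuousLinearMap : (v →ₗ[ℝ] ℝ) ≃ₗ[ℝ] (v →L[ℝ] ℝ)).toLinearMap)
      exact this
    refine ⟨((a, b), f.coprod (ψ.comp (ContinuousLinearMap.inr ℝ (v →L[ℝ] ℝ) t))), ?_⟩
    refine Prod.ext (Prod.ext ?_ rfl) ?_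
    · ext x; simp [transposeMap]
    · ext x
      · simp [transposeMap, evalDual, ha]
      · simp [transposeMap]

/-- `transposeMap` as a linear isomorphism. -/
def transpose [T2Space v] [FiniteDimensional ℝ v] : Gen (v × t) ≃ₗ[ℝ] Gen ((v →L[ℝ] ℝ) × t) :=
  LinearEquiv.ofBijective transposeMap transposeMap_bijective

/-- The subspace `v ⊕ v^∨` of `v ⊕ t ⊕ v^∨ ⊕ t^∨`. -/
def leftPart : Submodule ℝ (Gen (v × t)) where
  carrier := {u | u.1.2 = 0 ∧ u.2.comp (ContinuousLinearMap.inr ℝ v t) = 0}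
  add_mem' := by
    rintro a b ⟨h1, h2⟩ ⟨h3, h4⟩
    exact ⟨by simp [h1, h3], by simp [ContinuousLinearMap.add_comp, h2, h4]⟩
  zero_mem' := ⟨rfl, by simp⟩
  smul_mem' := by
    rintro c a ⟨h1, h2⟩
    exact ⟨by simp [h1], by simp [ContinuousLinearMap.smul_comp, h2]⟩

/-- The subspace `t ⊕ t^∨` of `v ⊕ t ⊕ v^∨ ⊕ t^∨`. -/
def rightPart : Submodule ℝ (Gen (v × t)) where
  carrier := {u | u.1.1 = 0 ∧ u.2.comp (ContinuousLinearMap.inl ℝ v t) = 0}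
  add_mem' := by
    rintro a b ⟨h1, h2⟩ ⟨h3, h4⟩
    exact ⟨by simp [h1, h3], by simp [ContinuousLinearMap.add_comp, h2, h4]⟩
  zero_mem' := ⟨rfl, by simp⟩
  smul_mem' := by
    rintro c a ⟨h1, h2⟩
    exact ⟨by simp [h1], by simp [ContinuousLinearMap.smul_comp, h2]⟩

end Swap

/-! ### Semi-flat structures and the mirror correspondence -/

section SemiFlat

variable {E : Type*} [NormedAddCommGroup E] [NormedSpace ℝ E] [FiniteDimensional ℝ E]
  {F : Type*} [NormedAddCommGroup F] [NormedSpace ℝ F] [FiniteDimensional ℝ F]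
  {M : Type*} [TopologicalSpace M] [ChartedSpace E M] [IsManifold 𝓘(ℝ, E) ∞ M]
  {V : M → Type*} [TopologicalSpace (TotalSpace F V)]
  [∀ x, AddCommGroup (V x)] [∀ x, Module ℝ (V x)] [∀ x, TopologicalSpace (V x)]
  [∀ x, IsTopologicalAddGroup (V x)] [∀ x, ContinuousSMul ℝ (V x)]
  [FiberBundle F V] [VectorBundle ℝ F V] [ContMDiffVectorBundle ∞ F V 𝓘(ℝ, E)]

/-- `K` is an adapted generalized almost complex structure on `V ⊕ T_M`, that is
`K (V ⊕ V^∨) = T_M ⊕ T_M^∨`. -/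
structure IsAdapted (F : Type*) [NormedAddCommGroup F] [NormedSpace ℝ F]
    {V : M → Type*} [TopologicalSpace (TotalSpace F V)]
    [∀ x, AddCommGroup (V x)] [∀ x, Module ℝ (V x)] [∀ x, TopologicalSpace (V x)]
    [∀ x, IsTopologicalAddGroup (V x)] [∀ x, ContinuousSMul ℝ (V x)]
    [FiberBundle F V] [VectorBundle ℝ F V]
    (K : ∀ x : M, Gen (V x × TangentSpace 𝓘(ℝ, E) x) →ₗ[ℝ] Gen (V x × TangentSpace 𝓘(ℝ, E) x)) :
    Prop where
  isGenAlmostComplex :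
    IsGenAlmostComplex (W := V ×ᵇ (TangentSpace 𝓘(ℝ, E) : M → Type _)) 𝓘(ℝ, E) (F × E) K
  map_left : ∀ x, Submodule.map (K x) leftPart = rightPart

/-- The `∇`-semi-flat generalized almost complex structures on `X = tot V`: `∇` is flat and `J` is
the lift `F⁻¹ (π^* K) F` of an adapted generalized almost complex structure `K` on `V ⊕ T_M`. -/
structure IsSemiFlat (cov : CovariantDerivative 𝓘(ℝ, E) F V)
    (J : ∀ p : TotalSpace F V,
      GenTangent (𝓘(ℝ, E).prod 𝓘(ℝ, F)) p →ₗ[ℝ] GenTangent (𝓘(ℝ, E).prod 𝓘(ℝ, F)) p) : Prop where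
  flat : IsFlat cov
  isGenAlmostComplex : IsGenAlmostComplex (𝓘(ℝ, E).prod 𝓘(ℝ, F)) (E × F) J
  exists_lift : ∃ K, IsAdapted F K ∧ J = lift cov K

/-- The type of `∇`-semi-flat generalized almost complex structures on `tot V`. -/
def SemiFlat (cov : CovariantDerivative 𝓘(ℝ, E) F V) : Type _ := {J // IsSemiFlat cov J}

/-- The type of `∇`-semi-flat generalized Kähler structures on `tot V`: the generalized Kähler pairs
consisting of two `∇`-semi-flat structures. -/
def SemiFlatKahler (σ : ℤˣ) (cov : CovariantDerivative 𝓘(ℝ, E) F V) : Type _ :=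
  {P : SemiFlat cov × SemiFlat cov // IsGenKahler (𝓘(ℝ, E).prod 𝓘(ℝ, F)) σ P.1.1 P.2.1}

/-- The fibrewise dual of an endomorphism `K` of `V ⊕ T_M ⊕ V^∨ ⊕ T_M^∨`: its conjugate by the
transposition of `V` and `V^∨`, an endomorphism of `V^∨ ⊕ T_M ⊕ V ⊕ T_M^∨`. -/
def mirror (F : Type*) [NormedAddCommGroup F] [NormedSpace ℝ F] [FiniteDimensional ℝ F]
    {V : M → Type*} [TopologicalSpace (TotalSpace F V)]
    [∀ x, AddCommGroup (V x)] [∀ x, Module ℝ (V x)] [∀ x, TopologicalSpace (V x)]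
    [∀ x, IsTopologicalAddGroup (V x)] [∀ x, ContinuousSMul ℝ (V x)]
    [FiberBundle F V] [VectorBundle ℝ F V]
    (K : ∀ x : M, Gen (V x × TangentSpace 𝓘(ℝ, E) x) →ₗ[ℝ] Gen (V x × TangentSpace 𝓘(ℝ, E) x))
    (x : M) : Gen (DualBundle V x × TangentSpace 𝓘(ℝ, E) x) →ₗ[ℝ]
      Gen (DualBundle V x × TangentSpace 𝓘(ℝ, E) x) :=
  haveI : T2Space (V x) := FiberBundle.t2Space F V x
  haveI : FiniteDimensional ℝ (V x) := VectorBundle.finiteDimensional ℝ F V x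
  transpose.toLinearMap ∘ₗ K x ∘ₗ transpose.symm.toLinearMap

end SemiFlat

end GenGeom

end

/-! Work in a chart of M and a trivialization of V, and let A be the connection form of ∇. At the
point of X with fibre coordinate ξ, the isomorphism (D, dπ) becomes the shear (u, η) ↦ (η + A u ξ,
u). The lift of a structure with matrix k is therefore the conjugate of k by S = `genMap (shear A
ξ)`, and S preserves the pairing. Commutation and positivity are pointwise and invariant under such
conjugations, so they are conditions on the endomorphisms over M, and the transposition of V and V^∨
is an isometry for the pairing.

Integrability involves derivatives. Sections of the +i eigenbundle have the form s - i J s, and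
closure under the bracket means J([s, t] - [Js, Jt]) - [s, Jt] - [Js, t] = 0. Paired with a third
vector, the derivatives of s and t cancel, and what is left is `nij`, a trilinear form in the values
of the sections that depends on J only through its one-jet (`pairing_nijenhuis`, `integrable_iff`).
For a lift, the derivative of S contributes terms `shearPair`, which contain ξ and the derivative of
A. They enter `nij` only through cyclic sums, and flatness reduces each cyclic sum to `connCyc`,
where neither ξ nor the derivative of A occurs (`shearPair_cyc`). Integrability on X is thus the
vanishing of a form `nijBase` on M (`nij_shearConj`, `integrable_lift_iff`).

The form `nijBase` is built from k and its derivative, the pairing, the projection to T_M, and the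
action of ∇ ⊕ ∇^∨ on V ⊕ V^∨. The transposition respects all of these, because the form of ∇^∨ is
minus the transpose of A (`connForm_dualConn`, `connPair_transposeMap`); hence `nijBase_map`
identifies the forms for X and for its dual. The same transpose formula shows that ∇^∨ has smooth
connection form and is flat, so the criterion applies on both sides. -/

noncomputable section

namespace GenGeom

/-! ### Algebra of the pairing on w ⊕ w^∨. -/

section PairingAlgebra

variable {w : Type*} [AddCommGroup w] [Module ℝ w] [TopologicalSpace w]
  [IsTopologicalAddGroup w] [ContinuousSMul ℝ w]

theorem pairing_comm (a b : Gen w) : pairing a b = pairing b a := by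
  simp only [pairing]; ring

theorem pairing_add_left (a a' b : Gen w) : pairing (a + a') b = pairing a b + pairing a' b := by
  simp [pairing]; ring

theorem pairing_sub_left (a a' b : Gen w) : pairing (a - a') b = pairing a b - pairing a' b := by
  simp [pairing]; ring

theorem pairing_neg_left (a b : Gen w) : pairing (-a) b = -pairing a b := by
  simp [pairing]; ring

theorem pairing_neg_right (a b : Gen w) : pairing a (-b) = -pairing a b := by
  rw [pairing_comm, pairing_neg_left, pairing_comm]

/-- Continuous functionals separate points, so the elements (0, f) detect the vector part; the
elements (v, 0) detect the covector part. -/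
theorem pairing_nondegenerate [SeparatingDual ℝ w] {a : Gen w} (h : ∀ b, pairing a b = 0) :
    a = 0 := by
  refine Prod.ext ?_ ?_
  · by_contra hne
    obtain ⟨f, hf⟩ := SeparatingDual.exists_ne_zero (R := ℝ) hne
    have := h (0, f)
    simp [pairing] at this
    exact hf this
  · ext v
    have := h (v, 0)
    simpa [pairing] using this

/-- An orthogonal map with square `-1` is skew. -/
theorem pairing_skew {j : Gen w → Gen w} (hsq : ∀ u, j (j u) = -u)
    (horth : ∀ u v, pairing (j u) (j v) = pairing u v) (a b : Gen w) :
    pairing (j a) b = -pairing a (j b) := by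
  rw [← horth a (j b), hsq, pairing_neg_right, neg_neg]

theorem pairing_genMap {w' : Type*} [AddCommGroup w'] [Module ℝ w'] [TopologicalSpace w']
    [IsTopologicalAddGroup w'] [ContinuousSMul ℝ w'] (A : w ≃L[ℝ] w') (a b : Gen w) :
    pairing (genMap A a) (genMap A b) = pairing a b := by
  simp [pairing, genMap]

end PairingAlgebra

/-! ### The Courant bracket on one-jets and the Nijenhuis form. -/

section PairingCLM

variable {W : Type*} [NormedAddCommGroup W] [NormedSpace ℝ W]

scoped instance : NormedAddCommGroup (Gen W) := inferInstance
scoped instance : AddCommGroup (Gen W) := inferInstance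
scoped instance : AddCommGroup (Gen W →L[ℝ] Gen W) := inferInstance
scoped instance : NormedAddCommGroup (Gen W →L[ℝ] Gen W) := inferInstance
scoped instance : NormedSpace ℝ (Gen W →L[ℝ] Gen W) := inferInstance

/-- The pairing with a fixed element as a continuous linear functional. -/
def pairingLeft (c : Gen W) : Gen W →L[ℝ] ℝ :=
  (-(1 / 2 : ℝ)) • ((c.2.comp (ContinuousLinearMap.fst ℝ W (W →L[ℝ] ℝ)) : Gen W →L[ℝ] ℝ) +
    (ContinuousLinearMap.apply ℝ ℝ c.1).comp (ContinuousLinearMap.snd ℝ W (W →L[ℝ] ℝ)))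

@[simp]
theorem pairingLeft_apply (c a : Gen W) : pairingLeft c a = pairing a c := by
  change (-(1 / 2 : ℝ)) * (c.2 a.1 + a.2 c.1) = -(1 / 2) * (a.2 c.1 + c.2 a.1)
  ring

/-- The Courant bracket at a point of a vector space, as a function of the one-jets `(a, A)` and
`(b, B)` of the two sections. -/
def courantJet (a : Gen W) (A : W →L[ℝ] Gen W) (b : Gen W) (B : W →L[ℝ] Gen W) : Gen W :=
  B a.1 - A b.1 + (0, (pairingLeft a).comp B - (pairingLeft b).comp A)

/-- Expresses the bracket through derivatives and the pairing alone. A pure covector θ pairs with c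
to -(1/2) θ(c.1), which produces the halves in the last two terms. -/
theorem pairing_courantJet (a : Gen W) (A : W →L[ℝ] Gen W) (b : Gen W) (B : W →L[ℝ] Gen W)
    (c : Gen W) :
    pairing (courantJet a A b B) c = pairing (B a.1) c - pairing (A b.1) c
      + 1 / 2 * pairing (A c.1) b - 1 / 2 * pairing (B c.1) a := by
  have h : pairing ((0 : W), (pairingLeft a).comp B - (pairingLeft b).comp A) c =
      1 / 2 * pairing (A c.1) b - 1 / 2 * pairing (B c.1) a := by
    simp only [pairing, sub_apply, ContinuousLinearMap.comp_apply, pairingLeft_apply,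
      map_zero]
    ring
  rw [courantJet, pairing_add_left, pairing_sub_left, h]
  ring

/-- The Nijenhuis form of an endomorphism field with value `j` and derivative `Dj` at a point. -/
def nij (j : Gen W →L[ℝ] Gen W) (Dj : W →L[ℝ] Gen W →L[ℝ] Gen W) (a b c : Gen W) : ℝ :=
  (pairing (Dj (j a).1 (j b)) c - pairing (Dj a.1 b) c)
    + (pairing (Dj (j b).1 (j c)) a - pairing (Dj b.1 c) a)
    + (pairing (Dj (j c).1 (j a)) b - pairing (Dj c.1 a) b)

/-- The one-jet of `j s` in terms of the one-jet `(a, A)` of `s`. -/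
def applyJet (j : Gen W →L[ℝ] Gen W) (Dj : W →L[ℝ] Gen W →L[ℝ] Gen W) (a : Gen W)
    (A : W →L[ℝ] Gen W) : W →L[ℝ] Gen W := Dj.flip a + j.comp A

/-- Tensoriality of the Nijenhuis expression: since j is skew with square -1, every term containing
A or B cancels. The surviving terms contain Dj, which is skew and anticommutes with j because j is
orthogonal with square -1 near the point. -/
theorem pairing_nijenhuis {j : Gen W →L[ℝ] Gen W} {Dj : W →L[ℝ] Gen W →L[ℝ] Gen W}
    (hsq : ∀ u, j (j u) = -u) (horth : ∀ u v, pairing (j u) (j v) = pairing u v)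
    (hskew : ∀ v a b, pairing (Dj v a) b = -pairing a (Dj v b))
    (hanti : ∀ v a, Dj v (j a) = -j (Dj v a))
    (a : Gen W) (A : W →L[ℝ] Gen W) (b : Gen W) (B : W →L[ℝ] Gen W) (c : Gen W) :
    pairing (j (courantJet a A b B - courantJet (j a) (applyJet j Dj a A) (j b) (applyJet j Dj b B))
      - courantJet a A (j b) (applyJet j Dj b B) - courantJet (j a) (applyJet j Dj a A) b B) c
      = nij j Dj a b c := by
  have hs := pairing_skew (j := j) hsq horth
  have e1 : ∀ v x y, pairing (Dj v (j x)) y = pairing (Dj v x) (j y) := by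
    -- The sign from moving j past `Dj v` cancels the sign from moving j across the pairing.
    intro v x y
    rw [hanti, pairing_neg_left, hs, neg_neg]
  have e2 : ∀ v x y, pairing (Dj v x) y = -pairing (Dj v y) x := by
    intro v x y
    rw [hskew, pairing_comm]
  simp only [pairing_sub_left, hs, pairing_courantJet, applyJet, add_apply,
    ContinuousLinearMap.comp_apply, ContinuousLinearMap.flip_apply, pairing_add_left, nij, hsq,
    pairing_neg_right, e1]
  -- Skewness of `Dj` brings the terms of both sides to a common order of arguments.
  rw [e2 b.1 c a, e2 (j b).1 c (j a), e1 (j b).1 a c, e2 c.1 b a, e2 (j c).1 b (j a),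
    e1 (j c).1 a b]
  ring

theorem nijenhuis_eq_zero_iff {j : Gen W →L[ℝ] Gen W} {Dj : W →L[ℝ] Gen W →L[ℝ] Gen W}
    (hsq : ∀ u, j (j u) = -u) (horth : ∀ u v, pairing (j u) (j v) = pairing u v)
    (hskew : ∀ v a b, pairing (Dj v a) b = -pairing a (Dj v b))
    (hanti : ∀ v a, Dj v (j a) = -j (Dj v a))
    (a : Gen W) (A : W →L[ℝ] Gen W) (b : Gen W) (B : W →L[ℝ] Gen W) :
    j (courantJet a A b B - courantJet (j a) (applyJet j Dj a A) (j b) (applyJet j Dj b B))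
      - courantJet a A (j b) (applyJet j Dj b B) - courantJet (j a) (applyJet j Dj a A) b B = 0
      ↔ ∀ c, nij j Dj a b c = 0 := by
  simp only [← pairing_nijenhuis hsq horth hskew hanti a A b B]
  exact ⟨fun h c => by rw [h]; simp [pairing], fun h => pairing_nondegenerate h⟩

end PairingCLM

/-! ### The splitting (D, dπ) in coordinates, and the cyclic identity from flatness. -/

section Shear

variable {E : Type*} [NormedAddCommGroup E] [NormedSpace ℝ E]
  {F : Type*} [NormedAddCommGroup F] [NormedSpace ℝ F]

scoped instance : AddCommGroup (E →L[ℝ] F →L[ℝ] F) := inferInstance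
scoped instance : NormedAddCommGroup (E →L[ℝ] F →L[ℝ] F) := inferInstance
scoped instance : SeminormedAddCommGroup (E →L[ℝ] F →L[ℝ] F) := inferInstance
scoped instance : NormedSpace ℝ (E →L[ℝ] F →L[ℝ] F) := inferInstance
scoped instance : NormedAddCommGroup (F →L[ℝ] E →L[ℝ] F) := inferInstance

/-- The isomorphism `(u, η) ↦ (η + A u ξ, u)`: the splitting `(D, dπ)` of the tangent space in
coordinates, for the connection form `A`, at the point with fibre coordinate `ξ`. -/
def shear (A : E →L[ℝ] F →L[ℝ] F) (ξ : F) : (E × F) ≃L[ℝ] (F × E) where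
  toFun v := (v.2 + A v.1 ξ, v.1)
  invFun z := (z.2, z.1 - A z.2 ξ)
  map_add' _ _ := by ext <;> simp; abel
  map_smul' _ _ := by ext <;> simp
  left_inv _ := by ext <;> simp
  right_inv _ := by ext <;> simp
  continuous_toFun := by fun_prop
  continuous_invFun := by fun_prop

@[simp] theorem shear_apply (A : E →L[ℝ] F →L[ℝ] F) (ξ : F) (v : E × F) :
    shear A ξ v = (v.2 + A v.1 ξ, v.1) := rfl

@[simp] theorem shear_symm_apply (A : E →L[ℝ] F →L[ℝ] F) (ξ : F) (z : F × E) :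
    (shear A ξ).symm z = (z.2, z.1 - A z.2 ξ) := rfl

/-- The connection form acting on `F ⊕ E ⊕ F^∨ ⊕ E^∨`, paired with a third vector:
`ω_s (t, r) = f_r (A u_s α_t) - f_t (A u_s α_r)`. -/
def connPair (A : E →L[ℝ] F →L[ℝ] F) (s t r : Gen (F × E)) : ℝ :=
  r.2 (A s.1.2 t.1.1, 0) - t.2 (A s.1.2 r.1.1, 0)

/-- Half the cyclic sum of `connPair`. -/
def connCyc (A : E →L[ℝ] F →L[ℝ] F) (a b c : Gen (F × E)) : ℝ :=
  1 / 2 * (connPair A a b c + connPair A b c a + connPair A c a b)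

/-- The form on the base whose vanishing is the integrability of the lift of an endomorphism field
with value `k` and derivative `Dk` at a point, for a flat connection with connection form `A`. -/
def nijBase (k : Gen (F × E) →L[ℝ] Gen (F × E)) (Dk : E →L[ℝ] Gen (F × E) →L[ℝ] Gen (F × E))
    (A : E →L[ℝ] F →L[ℝ] F) (a b c : Gen (F × E)) : ℝ :=
  (pairing (Dk (k a).1.2 (k b)) c - pairing (Dk a.1.2 b) c)
    + (pairing (Dk (k b).1.2 (k c)) a - pairing (Dk b.1.2 c) a)
    + (pairing (Dk (k c).1.2 (k a)) b - pairing (Dk c.1.2 a) b)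
    - connCyc A (k a) (k b) (k c) + connCyc A (k a) b c + connCyc A a (k b) c
    + connCyc A a b (k c)

/-- The derivative of `w ↦ genMap (shear (A w.1) w.2)` at `w = (y, ξ)` in the direction
`shear⁻¹ a`, applied to `shear⁻¹ b` and paired with `c`. Here `DA` is the derivative of `A`. -/
def shearPair (A : E →L[ℝ] F →L[ℝ] F) (DA : E →L[ℝ] E →L[ℝ] F →L[ℝ] F) (ξ : F)
    (a b c : Gen (F × E)) : ℝ :=
  -(1 / 2) * (c.2 (DA a.1.2 b.1.2 ξ + A b.1.2 (a.1.1 - A a.1.2 ξ), 0)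
    - b.2 (DA a.1.2 c.1.2 ξ + A c.1.2 (a.1.1 - A a.1.2 ξ), 0))

/-- The infinitesimal form of the fact that `genMap (shear A ξ)` preserves the pairing. -/
theorem shearPair_skew (A : E →L[ℝ] F →L[ℝ] F) (DA : E →L[ℝ] E →L[ℝ] F →L[ℝ] F) (ξ : F)
    (a b c : Gen (F × E)) : shearPair A DA ξ a b c = -shearPair A DA ξ a c b := by
  simp only [shearPair]; ring

theorem shearPair_neg_mid (A : E →L[ℝ] F →L[ℝ] F) (DA : E →L[ℝ] E →L[ℝ] F →L[ℝ] F) (ξ : F)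
    (a b c : Gen (F × E)) : shearPair A DA ξ a (-b) c = -shearPair A DA ξ a b c := by
  have h : ∀ (f : (F × E) →L[ℝ] ℝ) (x y : F), f (x + y, 0) = f (x, 0) + f (y, 0) := by
    intro f x y; rw [← map_add]; simp
  have h' : ∀ (f : (F × E) →L[ℝ] ℝ) (x : F), f (-x, 0) = -f (x, 0) := by
    intro f x; rw [← map_neg]; simp
  simp only [shearPair, Prod.snd_neg, Prod.fst_neg, map_neg, neg_apply, h, h']; ring

/-- This is where flatness enters. In the cyclic sum the terms with DA are antisymmetrized in the
two base directions and combine with the quadratic terms in A to the curvature applied to ξ. Once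
that is zero, only the terms A u α with α a component in F remain, and the fibre coordinate has
disappeared. -/
theorem shearPair_cyc {A : E →L[ℝ] F →L[ℝ] F} {DA : E →L[ℝ] E →L[ℝ] F →L[ℝ] F}
    (hflat : ∀ u v x, DA u v x - DA v u x + A u (A v x) - A v (A u x) = 0) (ξ : F)
    (a b c : Gen (F × E)) :
    shearPair A DA ξ a b c + shearPair A DA ξ b c a + shearPair A DA ξ c a b
      = connCyc A a b c := by
  have h : ∀ (f : (F × E) →L[ℝ] ℝ) (x y : F), f (x + y, 0) = f (x, 0) + f (y, 0) := by
    intro f x y; rw [← map_add]; simp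
  have h' : ∀ (f : (F × E) →L[ℝ] ℝ) (x y : F), f (x - y, 0) = f (x, 0) - f (y, 0) := by
    intro f x y; rw [← map_sub]; simp
  -- Curvature evaluated on ξ and paired with a covector; one instance is needed for each of the
  -- three covectors.
  have key : ∀ (f : (F × E) →L[ℝ] ℝ) (u v : E),
      f (DA u v ξ, 0) - f (DA v u ξ, 0) + f (A u (A v ξ), 0) - f (A v (A u ξ), 0) = 0 := by
    intro f u v
    rw [← h', ← h, ← h', hflat]; exact map_zero f
  simp only [shearPair, connCyc, connPair, h, h', map_sub]
  linear_combination -(1 / 2) * (key c.2 a.1.2 b.1.2) -(1 / 2) * (key a.2 b.1.2 c.1.2)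
    -(1 / 2) * (key b.2 c.1.2 a.1.2)

/-- The conjugate by `genMap (shear A ξ)`. -/
def shearConj (A : E →L[ℝ] F →L[ℝ] F) (ξ : F) (k : Gen (F × E) →ₗ[ℝ] Gen (F × E)) :
    Gen (E × F) →ₗ[ℝ] Gen (E × F) :=
  (genMap (shear A ξ)).symm.toLinearMap ∘ₗ k ∘ₗ (genMap (shear A ξ)).toLinearMap

/-- Since S preserves the pairing, S⁻¹ k S can be studied as ⟨k S b, S c⟩, so the inverse of S never
has to be differentiated. -/
theorem pairing_shearConj (A : E →L[ℝ] F →L[ℝ] F) (ξ : F) (k : Gen (F × E) →ₗ[ℝ] Gen (F × E))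
    (b c : Gen (E × F)) : pairing (shearConj A ξ k b) c =
      pairing (k (genMap (shear A ξ) b)) (genMap (shear A ξ) c) := by
  rw [← pairing_genMap (shear A ξ)]
  simp [shearConj]

end Shear

/-! ### Differentiating the pairing and the algebraic identities of j. -/

section Calculus

variable {X : Type*} [NormedAddCommGroup X] [NormedSpace ℝ X]
  {W : Type*} [NormedAddCommGroup W] [NormedSpace ℝ W]

theorem hasFDerivAt_pairing {f g : X → Gen W} {f' g' : X →L[ℝ] Gen W} {x : X}
    (hf : HasFDerivAt f f' x) (hg : HasFDerivAt g g' x) :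
    HasFDerivAt (fun y => pairing (f y) (g y))
      ((pairingLeft (g x)).comp f' + (pairingLeft (f x)).comp g') x := by
  have h := ((hf.snd.clm_apply hg.fst).add (hg.snd.clm_apply hf.fst)).const_mul (-(1 / 2 : ℝ))
  refine h.congr_fderiv ?_
  ext v
  simp [pairing]
  ring

/-- The derivative of an endomorphism field with orthogonal values of square `-1` is skew. -/
theorem pairing_fderiv_skew {j : X → Gen W →L[ℝ] Gen W} {Dj : X →L[ℝ] Gen W →L[ℝ] Gen W} {x : X}
    (hj : HasFDerivAt j Dj x) (hskew : ∀ᶠ y in 𝓝 x, ∀ a b, pairing (j y a) b = -pairing a (j y b))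
    (v : X) (a b : Gen W) : pairing (Dj v a) b = -pairing a (Dj v b) := by
  have h1 := hasFDerivAt_pairing (hj.clm_apply (hasFDerivAt_const a x)) (hasFDerivAt_const b x)
  have h2 := (hasFDerivAt_pairing (hasFDerivAt_const a x)
    (hj.clm_apply (hasFDerivAt_const b x))).neg
  have h3 := h1.unique (h2.congr_of_eventuallyEq (hskew.mono fun y hy => hy a b))
  have := DFunLike.congr_fun h3 v
  simpa [pairing_comm] using this

/-- Differentiate j² = -1. -/
theorem fderiv_anticomm {j : X → Gen W →L[ℝ] Gen W} {Dj : X →L[ℝ] Gen W →L[ℝ] Gen W} {x : X}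
    (hj : HasFDerivAt j Dj x) (hsq : ∀ᶠ y in 𝓝 x, ∀ a, j y (j y a) = -a)
    (v : X) (a : Gen W) : Dj v (j x a) = -j x (Dj v a) := by
  have h1 := hj.clm_apply (hj.clm_apply (hasFDerivAt_const a x))
  have h3 := h1.unique ((hasFDerivAt_const (-a) x).congr_of_eventuallyEq
    (hsq.mono fun y hy => hy a))
  have := DFunLike.congr_fun h3 v
  simp at this
  exact eq_neg_of_add_eq_zero_right this

end Calculus

/-! ### The Nijenhuis form of a lift. -/

section ShearCalculus

variable {E : Type*} [NormedAddCommGroup E] [NormedSpace ℝ E]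
  {F : Type*} [NormedAddCommGroup F] [NormedSpace ℝ F]

/-- The linear part of `C ↦ genMap (shear A ξ) b`, where `C u = A u ξ`. -/
def shearLin (b : Gen (E × F)) : (E →L[ℝ] F) →L[ℝ] Gen (F × E) :=
  ContinuousLinearMap.prod
    (ContinuousLinearMap.prod (ContinuousLinearMap.apply ℝ F b.1.1) 0)
    (-((ContinuousLinearMap.compL ℝ (F × E) F ℝ (b.2.comp (ContinuousLinearMap.inr ℝ E F))).comp
      ((ContinuousLinearMap.compL ℝ (F × E) E F).flip (ContinuousLinearMap.snd ℝ F E))))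

theorem shearLin_apply (b : Gen (E × F)) (C : E →L[ℝ] F) :
    shearLin b C = ((C b.1.1, 0), -((b.2.comp (ContinuousLinearMap.inr ℝ E F)).comp
      (C.comp (ContinuousLinearMap.snd ℝ F E)))) := rfl

/-- Both the shear and its inverse are affine in the linear map u ↦ A u ξ, hence so is the map they
induce on vectors and covectors. -/
theorem genMap_shear (A : E →L[ℝ] F →L[ℝ] F) (ξ : F) (b : Gen (E × F)) :
    genMap (shear A ξ) b = shearLin b (A.flip ξ) +
      ((b.1.2, b.1.1), b.2.comp ((ContinuousLinearMap.snd ℝ F E).prod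
        (ContinuousLinearMap.fst ℝ F E))) := by
  refine Prod.ext (Prod.ext ?_ ?_) ?_
  · simp [genMap, shearLin_apply, add_comm]
  · simp [genMap, shearLin_apply]
  · ext z
    · simp only [genMap, shearLin_apply]
      simp
      exact map_zero b.2
    · have h : ∀ x : F, b.2 (z, -x) = -b.2 (0, x) + b.2 (z, 0) := by
        intro x; rw [← map_neg, ← map_add]; simp
      simp only [genMap, shearLin_apply]
      simp [h]

theorem hasFDerivAt_genMap_shear {A : E → E →L[ℝ] F →L[ℝ] F} {DA : E →L[ℝ] E →L[ℝ] F →L[ℝ] F}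
    {y : E} (hA : HasFDerivAt A DA y) (ξ : F) (b : Gen (E × F)) :
    HasFDerivAt (fun w : E × F => genMap (shear (A w.1) w.2) b)
      ((shearLin b).comp
        ((((ContinuousLinearMap.flipₗᵢ ℝ E F F).toContinuousLinearEquiv :
          (E →L[ℝ] F →L[ℝ] F) →L[ℝ] (F →L[ℝ] E →L[ℝ] F)).flip ξ).comp
          (DA.comp (ContinuousLinearMap.fst ℝ E F)) +
          (A y).flip.comp (ContinuousLinearMap.snd ℝ E F))) (y, ξ) := by
  simp only [genMap_shear]
  refine HasFDerivAt.add_const _ ?_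
  refine (shearLin b).hasFDerivAt.comp (y, ξ) ?_
  have h1 : HasFDerivAt (fun w : E × F => A w.1) (DA.comp (ContinuousLinearMap.fst ℝ E F)) (y, ξ) :=
    HasFDerivAt.comp (y, ξ) hA hasFDerivAt_fst
  have h0 := ((ContinuousLinearMap.flipₗᵢ ℝ E F F).toContinuousLinearEquiv :
    (E →L[ℝ] F →L[ℝ] F) →L[ℝ] (F →L[ℝ] E →L[ℝ] F)).hasFDerivAt (x := A y)
  have h2 := (HasFDerivAt.comp (y, ξ) h0 h1).congr_of_eventuallyEq
    (f₁ := fun w : E × F => (A w.1).flip) (Filter.Eventually.of_forall fun w => rfl)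
  have h3 := h2.clm_apply (hasFDerivAt_snd (𝕜 := ℝ) (p := (y, ξ)))
  refine h3.congr_fderiv ?_
  ext v <;> simp

/-- Rewrites the derivative of S in terms of the sheared arguments. The fibre component of a tangent
vector is recovered from its sheared image a as a.1.1 - A a.1.2 ξ, which accounts for that
difference in `shearPair`. -/
theorem pairing_shearLin (A : E →L[ℝ] F →L[ℝ] F) (DA : E →L[ℝ] E →L[ℝ] F →L[ℝ] F) (ξ : F)
    (a b : Gen (E × F)) (z : Gen (F × E)) :
    pairing (shearLin b ((DA a.1.1).flip ξ + A.flip a.1.2)) z =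
      shearPair A DA ξ (genMap (shear A ξ) a) (genMap (shear A ξ) b) z := by
  have h : ∀ x : F, b.2 (0, -x) = -b.2 (0, x) := by
    intro x; rw [← map_neg]; simp
  have h' : ∀ x x' : F, b.2 (0, x + x') = b.2 (0, x) + b.2 (0, x') := by
    intro x x'; rw [← map_add]; simp
  simp [pairing, shearLin_apply, shearPair, genMap, h']
  ring

/-- The product rule for ⟨k S b, S c⟩: one term from k, which varies only along the base, and one
from each copy of S. Skewness of k and of `shearPair` then puts the two S-terms into the displayed
form. -/
theorem pairing_fderiv_shearConj {A : E → E →L[ℝ] F →L[ℝ] F}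
    {DA : E →L[ℝ] E →L[ℝ] F →L[ℝ] F} {k : E → Gen (F × E) →L[ℝ] Gen (F × E)}
    {Dk : E →L[ℝ] Gen (F × E) →L[ℝ] Gen (F × E)}
    {j : E × F → Gen (E × F) →L[ℝ] Gen (E × F)}
    {Dj : (E × F) →L[ℝ] Gen (E × F) →L[ℝ] Gen (E × F)} {y : E} {ξ : F}
    (hA : HasFDerivAt A DA y) (hk : HasFDerivAt k Dk y) (hj : HasFDerivAt j Dj (y, ξ))
    (hjk : ∀ᶠ w in 𝓝 (y, ξ), ∀ b, j w b = shearConj (A w.1) w.2 (k w.1) b)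
    (hsq : ∀ u, k y (k y u) = -u) (horth : ∀ u v, pairing (k y u) (k y v) = pairing u v)
    (a b c : Gen (E × F)) :
    pairing (Dj a.1 b) c =
      pairing (Dk (genMap (shear (A y) ξ) a).1.2 (genMap (shear (A y) ξ) b))
        (genMap (shear (A y) ξ) c)
      - shearPair (A y) DA ξ (genMap (shear (A y) ξ) a) (genMap (shear (A y) ξ) b)
        (k y (genMap (shear (A y) ξ) c))
      - shearPair (A y) DA ξ (genMap (shear (A y) ξ) a) (k y (genMap (shear (A y) ξ) b))
        (genMap (shear (A y) ξ) c) := by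
  have hB := hasFDerivAt_genMap_shear hA ξ
  have hk' : HasFDerivAt (fun w : E × F => k w.1)
      (Dk.comp (ContinuousLinearMap.fst ℝ E F)) (y, ξ) :=
    HasFDerivAt.comp (y, ξ) hk hasFDerivAt_fst
  have h1 := hasFDerivAt_pairing (hk'.clm_apply (hB b)) (hB c)
  have h2 := hasFDerivAt_pairing (hj.clm_apply (hasFDerivAt_const b (y, ξ)))
    (hasFDerivAt_const c (y, ξ))
  have h3 := h2.unique (h1.congr_of_eventuallyEq (hjk.mono fun w hw => by
    change pairing (j w b) c = _
    rw [hw b, pairing_shearConj]; rfl))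
  have h4 := DFunLike.congr_fun h3 a.1
  have hs := pairing_skew (j := k y) hsq horth
  have h5 : pairing (Dj a.1 b) c =
      pairing (k y (shearLin b ((DA a.1.1).flip ξ + (A y).flip a.1.2)) +
        Dk a.1.1 (genMap (shear (A y) ξ) b)) (genMap (shear (A y) ξ) c)
      + pairing (shearLin c ((DA a.1.1).flip ξ + (A y).flip a.1.2))
        (k y (genMap (shear (A y) ξ) b)) := by
    simpa [pairing_add_left] using h4
  rw [h5, pairing_add_left, hs, pairing_shearLin, pairing_shearLin, 
    shearPair_skew _ _ _ _ (genMap (shear (A y) ξ) c)]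
  simp only [genMap, LinearEquiv.coe_mk, LinearMap.coe_mk, AddHom.coe_mk, shear_apply]
  ring

/-- Substituting the derivative of the lift into the three pairs of terms of `nij` groups the
`shearPair` contributions into four cyclic sums, with arguments (ka, kb, kc), (ka, b, c), (a, kb, c)
and (a, b, kc). Each is a `connCyc` by flatness, so the right side depends on ξ only through the
sheared arguments. -/
theorem nij_shearConj {A : E → E →L[ℝ] F →L[ℝ] F}
    {DA : E →L[ℝ] E →L[ℝ] F →L[ℝ] F} {k : E → Gen (F × E) →L[ℝ] Gen (F × E)}
    {Dk : E →L[ℝ] Gen (F × E) →L[ℝ] Gen (F × E)}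
    {j : E × F → Gen (E × F) →L[ℝ] Gen (E × F)}
    {Dj : (E × F) →L[ℝ] Gen (E × F) →L[ℝ] Gen (E × F)} {y : E} {ξ : F}
    (hA : HasFDerivAt A DA y) (hk : HasFDerivAt k Dk y) (hj : HasFDerivAt j Dj (y, ξ))
    (hjk : ∀ᶠ w in 𝓝 (y, ξ), ∀ b, j w b = shearConj (A w.1) w.2 (k w.1) b)
    (hsq : ∀ u, k y (k y u) = -u) (horth : ∀ u v, pairing (k y u) (k y v) = pairing u v)
    (hflat : ∀ u v x, DA u v x - DA v u x + A y u (A y v x) - A y v (A y u x) = 0)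
    (a b c : Gen (E × F)) :
    nij (j (y, ξ)) Dj a b c = nijBase (k y) Dk (A y) (genMap (shear (A y) ξ) a)
      (genMap (shear (A y) ξ) b) (genMap (shear (A y) ξ) c) := by
  have key := pairing_fderiv_shearConj hA hk hj hjk hsq horth
  have hBj : ∀ z, genMap (shear (A y) ξ) (j (y, ξ) z) = k y (genMap (shear (A y) ξ) z) := by
    intro z
    rw [hjk.self_of_nhds z]
    simp [shearConj]
  have cyc := shearPair_cyc hflat ξ
  -- The relation k² = -1 turns terms with k k b in the middle slot into terms with b, and so
  -- changes their sign.
  simp only [nij, key, nijBase, hBj, hsq, shearPair_neg_mid, ← cyc]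
  set a' := genMap (shear (A y) ξ) a
  set b' := genMap (shear (A y) ξ) b
  set c' := genMap (shear (A y) ξ) c
  ring

end ShearCalculus

/-! ### Invariance of the base form under transposition. -/

section Transpose

variable {E : Type*} [NormedAddCommGroup E] [NormedSpace ℝ E]
  {F : Type*} [NormedAddCommGroup F] [NormedSpace ℝ F]

/-- On the summand v ⊕ v^∨ the pairing is f(b) + g(a) up to a factor, which is symmetric in the
roles of vectors and covectors. -/
theorem pairing_transposeMap {v : Type*} [AddCommGroup v] [Module ℝ v] [TopologicalSpace v]
    [IsTopologicalAddGroup v] [ContinuousSMul ℝ v]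
    {t : Type*} [AddCommGroup t] [Module ℝ t] [TopologicalSpace t]
    [IsTopologicalAddGroup t] [ContinuousSMul ℝ t] (a b : Gen (v × t)) :
    pairing (transposeMap a) (transposeMap b) = pairing a b := by
  have h : ∀ (f : (v × t) →L[ℝ] ℝ) (z : v × t), f z = f (z.1, 0) + f (0, z.2) := by
    intro f z; rw [← map_add]; simp
  rw [pairing, pairing, h a.2 b.1, h b.2 a.1]
  simp [transposeMap, evalDual]
  ring

/-- Up to the factor -2, `connPair` pairs the third vector with the action of A and minus its
transpose on the F ⊕ F^∨ part of the second. With A' equal to minus the transpose of A, the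
transposition merely exchanges the two terms. -/
theorem connPair_transposeMap {A : E →L[ℝ] F →L[ℝ] F}
    {A' : E →L[ℝ] (F →L[ℝ] ℝ) →L[ℝ] (F →L[ℝ] ℝ)} (hA : ∀ u f x, A' u f x = -f (A u x))
    (a b c : Gen (F × E)) :
    connPair A' (transposeMap a) (transposeMap b) (transposeMap c) = connPair A a b c := by
  have h0 : ∀ f : (F × E) →L[ℝ] ℝ, f (0, 0) = 0 := fun f => map_zero f
  simp [connPair, transposeMap, evalDual, hA, h0]
  ring

/-- Every ingredient of `nijBase` is assumed to be preserved by T: the pairing, the E-component of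
vectors, `connPair`, and the action of k and its derivative. -/
theorem nijBase_map {F' : Type*} [NormedAddCommGroup F'] [NormedSpace ℝ F']
    {k : Gen (F × E) →L[ℝ] Gen (F × E)}
    {Dk : E →L[ℝ] Gen (F × E) →L[ℝ] Gen (F × E)} {A : E →L[ℝ] F →L[ℝ] F}
    {k' : Gen (F' × E) →L[ℝ] Gen (F' × E)}
    {Dk' : E →L[ℝ] Gen (F' × E) →L[ℝ] Gen (F' × E)} {A' : E →L[ℝ] F' →L[ℝ] F'}
    {T : Gen (F × E) → Gen (F' × E)} (hT : ∀ a b, pairing (T a) (T b) = pairing a b)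
    (hE : ∀ a, (T a).1.2 = a.1.2)
    (hA : ∀ a b c, connPair A' (T a) (T b) (T c) = connPair A a b c)
    (hk : ∀ z, k' (T z) = T (k z)) (hDk : ∀ u z, Dk' u (T z) = T (Dk u z))
    (a b c : Gen (F × E)) :
    nijBase k' Dk' A' (T a) (T b) (T c) = nijBase k Dk A a b c := by
  simp only [nijBase, connCyc, hk, hE, hDk, hT, hA]

end Transpose

/-! ### Generalized vectors and endomorphisms in a trivialization. -/

section Coordinates

variable {EB : Type*} [NormedAddCommGroup EB] [NormedSpace ℝ EB]
  {HB : Type*} [TopologicalSpace HB] (I : ModelWithCorners ℝ EB HB)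
  {B : Type*} [TopologicalSpace B] [ChartedSpace HB B]
  {G : Type*} [NormedAddCommGroup G] [NormedSpace ℝ G]
  {W : B → Type*} [TopologicalSpace (TotalSpace G W)]
  [∀ x, AddCommGroup (W x)] [∀ x, Module ℝ (W x)] [∀ x, TopologicalSpace (W x)]
  [∀ x, IsTopologicalAddGroup (W x)] [∀ x, ContinuousSMul ℝ (W x)]
  [FiberBundle G W] [VectorBundle ℝ G W]

/-- The coordinates of an element of `W_x ⊕ W_x^∨` in a trivialization of `W`. -/
def coordGen (e : Trivialization G (π G W)) [e.IsLinear ℝ] (x : B) : Gen (W x) →ₗ[ℝ] Gen G where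
  toFun u := (e.continuousLinearMapAt ℝ x u.1, u.2.comp (e.symmL ℝ x))
  map_add' _ _ := by simp
  map_smul' _ _ := by simp

/-- The inverse of `coordGen`. -/
def coordGenSymm (e : Trivialization G (π G W)) [e.IsLinear ℝ] (x : B) :
    Gen G →ₗ[ℝ] Gen (W x) where
  toFun v := (e.symmL ℝ x v.1, v.2.comp (e.continuousLinearMapAt ℝ x))
  map_add' _ _ := by simp
  map_smul' _ _ := by simp

variable {e : Trivialization G (π G W)} [e.IsLinear ℝ]

theorem coordGen_apply (x : B) (u : Gen (W x)) :
    coordGen e x u = (e.continuousLinearMapAt ℝ x u.1, u.2.comp (e.symmL ℝ x)) := rfl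

theorem coordGen_coordGenSymm {x : B} (hx : x ∈ e.baseSet) (v : Gen G) :
    coordGen e x (coordGenSymm e x v) = v := by
  refine Prod.ext ?_ ?_
  · exact e.continuousLinearMapAt_symmL hx v.1
  · ext z
    exact congrArg v.2 (e.continuousLinearMapAt_symmL hx z)

theorem coordGenSymm_coordGen {x : B} (hx : x ∈ e.baseSet) (u : Gen (W x)) :
    coordGenSymm e x (coordGen e x u) = u := by
  refine Prod.ext ?_ ?_
  · exact e.symmL_continuousLinearMapAt hx u.1
  · ext z
    exact congrArg u.2 (e.symmL_continuousLinearMapAt hx z)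

theorem coordGen_injective {x : B} (hx : x ∈ e.baseSet) :
    Function.Injective (coordGen e x) :=
  Function.LeftInverse.injective (coordGenSymm_coordGen hx)

theorem pairing_coordGen {x : B} (hx : x ∈ e.baseSet) (u v : Gen (W x)) :
    pairing (coordGen e x u) (coordGen e x v) = pairing u v := by
  simp only [pairing, coordGen_apply, ContinuousLinearMap.comp_apply,
    e.symmL_continuousLinearMapAt hx]

/-- An endomorphism of `W ⊕ W^∨` in a trivialization. -/
def coordEnd [FiniteDimensional ℝ G] (e : Trivialization G (π G W)) [e.IsLinear ℝ]
    (J : ∀ x, Gen (W x) →ₗ[ℝ] Gen (W x)) (x : B) : Gen G →L[ℝ] Gen G :=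
  LinearMap.toContinuousLinearMap (coordGen e x ∘ₗ J x ∘ₗ coordGenSymm e x)

variable [FiniteDimensional ℝ G] {J : ∀ x, Gen (W x) →ₗ[ℝ] Gen (W x)}

theorem coordEnd_apply (x : B) (v : Gen G) :
    coordEnd e J x v = coordGen e x (J x (coordGenSymm e x v)) := rfl

theorem coordEnd_coordGen {x : B} (hx : x ∈ e.baseSet) (u : Gen (W x)) :
    coordEnd e J x (coordGen e x u) = coordGen e x (J x u) := by
  rw [coordEnd_apply, coordGenSymm_coordGen hx]

theorem coordEnd_sq (hsq : ∀ x u, J x (J x u) = -u) {x : B} (hx : x ∈ e.baseSet) (v : Gen G) :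
    coordEnd e J x (coordEnd e J x v) = -v := by
  rw [coordEnd_apply x v, coordEnd_coordGen hx, hsq, map_neg, coordGen_coordGenSymm hx]

theorem coordEnd_orth (horth : ∀ x u v, pairing (J x u) (J x v) = pairing u v) {x : B}
    (hx : x ∈ e.baseSet) (v v' : Gen G) :
    pairing (coordEnd e J x v) (coordEnd e J x v') = pairing v v' := by
  rw [coordEnd_apply, coordEnd_apply, pairing_coordGen hx, horth, ← pairing_coordGen hx,
    coordGen_coordGenSymm hx, coordGen_coordGenSymm hx]

theorem contMDiffAt_section_iff_coord (s : ∀ x, W x) (x₀ : B) :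
    ContMDiffAt I (I.prod 𝓘(ℝ, G)) ∞ (fun x => TotalSpace.mk' G x (s x)) x₀ ↔
      ContMDiffAt I 𝓘(ℝ, G) ∞
        (fun x => (trivializationAt G W x₀).continuousLinearMapAt ℝ x (s x)) x₀ := by
  rw [contMDiffAt_section]
  refine Filter.EventuallyEq.contMDiffAt_iff ?_
  filter_upwards [(trivializationAt G W x₀).open_baseSet.mem_nhds
    (mem_baseSet_trivializationAt G W x₀)] with x hx
  simp [Trivialization.continuousLinearMapAt_apply, Trivialization.coe_linearMapAt_of_mem _ hx]

theorem contMDiffAt_dual_section_iff_coord (s : ∀ x, W x →L[ℝ] ℝ) (x₀ : B) :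
    ContMDiffAt I (I.prod 𝓘(ℝ, G →L[ℝ] ℝ)) ∞
        (fun x => (TotalSpace.mk' (G →L[ℝ] ℝ) x (s x) :
          TotalSpace (G →L[ℝ] ℝ) (fun x => W x →L[ℝ] ℝ))) x₀ ↔
      ContMDiffAt I 𝓘(ℝ, G →L[ℝ] ℝ) ∞
        (fun x => (s x).comp ((trivializationAt G W x₀).symmL ℝ x)) x₀ := by
  rw [contMDiffAt_section]
  refine Filter.EventuallyEq.contMDiffAt_iff ?_
  filter_upwards with x
  rw [hom_trivializationAt_apply]
  ext v
  simp [ContinuousLinearMap.inCoordinates]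

theorem smoothSectionOn_iff {s : ∀ x, Gen (W x)} {U : Set B} (hU : IsOpen U) :
    SmoothSectionOn I G s U ↔ ∀ x₀ ∈ U, ContMDiffAt I 𝓘(ℝ, Gen G) ∞
      (fun x => coordGen (trivializationAt G W x₀) x (s x)) x₀ := by
  constructor
  · rintro ⟨h1, h2⟩ x₀ hx₀
    have h1' := (contMDiffAt_section_iff_coord I _ x₀).1 (h1.contMDiffAt (hU.mem_nhds hx₀))
    have h2' := (contMDiffAt_dual_section_iff_coord I _ x₀).1 (h2.contMDiffAt (hU.mem_nhds hx₀))
    exact h1'.prodMk_space h2'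
  · intro h
    refine ⟨fun x₀ hx₀ => ContMDiffAt.contMDiffWithinAt ?_,
      fun x₀ hx₀ => ContMDiffAt.contMDiffWithinAt ?_⟩
    · rw [contMDiffAt_section_iff_coord]
      exact (contDiff_fst (𝕜 := ℝ) (E := G) (F := G →L[ℝ] ℝ)).contMDiff.contMDiffAt.comp
        x₀ (h x₀ hx₀)
    · rw [contMDiffAt_dual_section_iff_coord]
      exact (contDiff_snd (𝕜 := ℝ) (E := G) (F := G →L[ℝ] ℝ)).contMDiff.contMDiffAt.comp
        x₀ (h x₀ hx₀)

end Coordinates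

/-! ### Smooth endomorphisms are those with smooth matrices. -/

section SmoothEndomorphism

variable {EB : Type*} [NormedAddCommGroup EB] [NormedSpace ℝ EB]
  {HB : Type*} [TopologicalSpace HB] {I : ModelWithCorners ℝ EB HB}
  {B : Type*} [TopologicalSpace B] [ChartedSpace HB B]

/-- In finite dimension an operator is a continuous linear function of its values on a basis, so
pointwise smoothness gives smoothness in operator norm. -/
theorem contMDiffAt_clm_of_apply {P Q : Type*} [NormedAddCommGroup P] [NormedSpace ℝ P]
    [FiniteDimensional ℝ P] [NormedAddCommGroup Q] [NormedSpace ℝ Q]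
    {f : B → P →L[ℝ] Q} {x : B} {n : WithTop ℕ∞}
    (h : ∀ v, ContMDiffAt I 𝓘(ℝ, Q) n (fun y => f y v) x) :
    ContMDiffAt I 𝓘(ℝ, P →L[ℝ] Q) n f x := by
  let b := Module.finBasis ℝ P
  let Ψ : (Fin (Module.finrank ℝ P) → Q) →L[ℝ] P →L[ℝ] Q :=
    ∑ i, (ContinuousLinearMap.smulRightL ℝ P Q (LinearMap.toContinuousLinearMap (b.coord i))).comp
      (ContinuousLinearMap.proj i)
  have hΨ : ∀ g : P →L[ℝ] Q, Ψ (fun i => g (b i)) = g := by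
    intro g
    ext v
    conv_rhs => rw [← b.sum_repr v, map_sum]
    simp [Ψ]
  have h1 : ContMDiffAt I 𝓘(ℝ, Fin (Module.finrank ℝ P) → Q) n (fun y i => f y (b i)) x :=
    contMDiffAt_pi_space.2 fun i => h (b i)
  have h2 := Ψ.contMDiff.contMDiffAt.comp x h1
  refine h2.congr_of_eventuallyEq (Filter.Eventually.of_forall fun y => ?_)
  exact (hΨ (f y)).symm

variable {G : Type*} [NormedAddCommGroup G] [NormedSpace ℝ G] [FiniteDimensional ℝ G]
  {W : B → Type*} [TopologicalSpace (TotalSpace G W)]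
  [∀ x, AddCommGroup (W x)] [∀ x, Module ℝ (W x)] [∀ x, TopologicalSpace (W x)]
  [∀ x, IsTopologicalAddGroup (W x)] [∀ x, ContinuousSMul ℝ (W x)]
  [FiberBundle G W] [VectorBundle ℝ G W] {J : ∀ x, Gen (W x) →ₗ[ℝ] Gen (W x)}

theorem smooth_of_contMDiffAt_coordEnd
    (h : ∀ x₀, ContMDiffAt I 𝓘(ℝ, Gen G →L[ℝ] Gen G) ∞
      (coordEnd (trivializationAt G W x₀) J) x₀)
    (U : Set B) (hU : IsOpen U) (s : ∀ x, Gen (W x)) (hs : SmoothSectionOn I G s U) :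
    SmoothSectionOn I G (fun x => J x (s x)) U := by
  rw [smoothSectionOn_iff I hU] at hs ⊢
  intro x₀ hx₀
  refine ((h x₀).clm_apply (hs x₀ hx₀)).congr_of_eventuallyEq ?_
  filter_upwards [(trivializationAt G W x₀).open_baseSet.mem_nhds
    (mem_baseSet_trivializationAt G W x₀)] with x hx
  exact (coordEnd_coordGen hx (s x)).symm

variable [ContMDiffVectorBundle ∞ G W I]

theorem smoothSectionOn_coordGenSymm (x₀ : B) (v : Gen G) :
    SmoothSectionOn I G (fun x => coordGenSymm (trivializationAt G W x₀) x v)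
      (trivializationAt G W x₀).baseSet := by
  set e := trivializationAt G W x₀ with he
  constructor
  · rw [e.contMDiffOn_section_baseSet_iff]
    refine contMDiffOn_const (c := v.1) |>.congr fun x hx => ?_
    have := e.continuousLinearMapAt_symmL (R := ℝ) hx v.1
    rw [Trivialization.continuousLinearMapAt_apply, Trivialization.coe_linearMapAt_of_mem _ hx]
      at this
    exact this
  · have hb : (trivializationAt (G →L[ℝ] ℝ) (fun x => W x →L[ℝ] ℝ) x₀).baseSet = e.baseSet := by
      rw [hom_trivializationAt_baseSet]
      exact Set.inter_univ _
    rw [← hb, Trivialization.contMDiffOn_section_baseSet_iff]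
    refine contMDiffOn_const (c := v.2) |>.congr fun x hx => ?_
    rw [hb] at hx
    rw [hom_trivializationAt_apply]
    ext z
    simp only [ContinuousLinearMap.inCoordinates, ContinuousLinearMap.comp_apply,
      Trivial.fiberBundle_trivializationAt', Trivial.continuousLinearMapAt_trivialization]
    exact congrArg v.2 (e.continuousLinearMapAt_symmL (R := ℝ) hx z)

/-- Apply the hypothesis to the local sections with constant coordinates on the base set of the
trivialization; their images are the columns of the matrix. -/
theorem contMDiffAt_coordEnd (hJ : ∀ U : Set B, IsOpen U → ∀ s : ∀ x, Gen (W x),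
      SmoothSectionOn I G s U → SmoothSectionOn I G (fun x => J x (s x)) U) (x₀ : B) :
    ContMDiffAt I 𝓘(ℝ, Gen G →L[ℝ] Gen G) ∞ (coordEnd (trivializationAt G W x₀) J) x₀ := by
  refine contMDiffAt_clm_of_apply fun v => ?_
  have h := hJ _ (trivializationAt G W x₀).open_baseSet _
    (smoothSectionOn_coordGenSymm (I := I) x₀ v)
  exact (smoothSectionOn_iff I (trivializationAt G W x₀).open_baseSet).1 h x₀
    (mem_baseSet_trivializationAt G W x₀)

end SmoothEndomorphism

/-! ### The Courant bracket in the preferred chart. -/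

section CourantCoordinates

variable {EB : Type*} [NormedAddCommGroup EB] [NormedSpace ℝ EB]
  {HB : Type*} [TopologicalSpace HB] {I : ModelWithCorners ℝ EB HB} [I.Boundaryless]
  {B : Type*} [TopologicalSpace B] [ChartedSpace HB B]

theorem differentiableAt_comp_extChartAt_symm {Q : Type*} [NormedAddCommGroup Q] [NormedSpace ℝ Q]
    {f : B → Q} {p : B} (hf : MDifferentiableAt I 𝓘(ℝ, Q) f p) :
    DifferentiableAt ℝ (fun y => f ((extChartAt I p).symm y)) (extChartAt I p p) := by
  have h := ((mdifferentiableAt_iff (f := f) (x := p)).1 hf).2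
  rw [I.range_eq_univ, differentiableWithinAt_univ] at h
  exact h

variable [IsManifold I 1 B]

theorem symmL_tangent {p : B} {y : EB} (hy : y ∈ (extChartAt I p).target) :
    (trivializationAt EB (TangentSpace I) p).symmL ℝ ((extChartAt I p).symm y) =
      mfderivWithin 𝓘(ℝ, EB) I (extChartAt I p).symm (Set.range I) y := by
  have h := (extChartAt I p).map_target hy
  rw [extChartAt_source] at h
  rw [TangentBundle.symmL_trivializationAt h, (extChartAt I p).right_inv hy]

theorem mem_tangent_baseSet {p : B} {y : EB} (hy : y ∈ (extChartAt I p).target) :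
    (extChartAt I p).symm y ∈ (trivializationAt EB (TangentSpace I) p).baseSet := by
  have h := (extChartAt I p).map_target hy
  rwa [extChartAt_source] at h

theorem inverse_symmL {b : B} (e : Trivialization EB (π EB (TangentSpace I : B → Type _)))
    [MemTrivializationAtlas e] (hb : b ∈ e.baseSet) :
    (e.symmL ℝ b).inverse = e.continuousLinearMapAt ℝ b := by
  refine ContinuousLinearMap.inverse_eq ?_ ?_
  · ext v
    exact e.symmL_continuousLinearMapAt hb v
  · ext v
    exact e.continuousLinearMapAt_symmL hb v

/-- The chain rule for g = ĝ ∘ chart, combined with the fact that the tangent trivialization at p is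
the differential of the chart at p. The point x need not be the centre. -/
theorem mvfderiv_symmL {Q : Type*} [NormedAddCommGroup Q] [NormedSpace ℝ Q] {g : B → Q} {p x : B}
    (hx : x ∈ (chartAt HB p).source) {ĝ : EB → Q}
    (hg : ∀ᶠ y in 𝓝 (extChartAt I p x), g ((extChartAt I p).symm y) = ĝ y)
    (hd : DifferentiableAt ℝ ĝ (extChartAt I p x)) (v : EB) :
    MDifferentiableAt I 𝓘(ℝ, Q) g x ∧
    mvfderiv I g x ((trivializationAt EB (TangentSpace I) p).symmL ℝ x v) =
      fderiv ℝ ĝ (extChartAt I p x) v := by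
  have h1 : g =ᶠ[𝓝 x] ĝ ∘ extChartAt I p := by
    have hs : x ∈ (extChartAt I p).source := by rwa [extChartAt_source]
    filter_upwards [(continuousAt_extChartAt' (I := I) hs).eventually hg,
      extChartAt_source_mem_nhds' (I := I) hs] with z hz hz'
    rw [Function.comp_apply, ← hz, (extChartAt I p).left_inv hz']
  have h2 : HasMFDerivAt I 𝓘(ℝ, Q) (ĝ ∘ extChartAt I p) x
      ((fderiv ℝ ĝ (extChartAt I p x)).comp (mfderiv I 𝓘(ℝ, EB) (extChartAt I p) x)) :=
    HasMFDerivAt.comp x hd.hasFDerivAt.hasMFDerivAt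
      (mdifferentiableAt_extChartAt hx).hasMFDerivAt
  have h3 := (h2.congr_of_eventuallyEq h1).mfderiv
  have h4 := TangentBundle.continuousLinearMapAt_trivializationAt (I := I) hx
  have h5 : mvfderiv I g x ((trivializationAt EB (TangentSpace I) p).symmL ℝ x v) =
      fderiv ℝ ĝ (extChartAt I p x) (mfderiv I 𝓘(ℝ, EB) (extChartAt I p) x
        ((trivializationAt EB (TangentSpace I) p).symmL ℝ x v)) := by
    rw [mvfderiv, h3]; rfl
  refine ⟨(h2.congr_of_eventuallyEq h1).mdifferentiableAt, ?_⟩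
  rw [h5, ← h4]
  exact congrArg _ ((trivializationAt EB (TangentSpace I) p).continuousLinearMapAt_symmL hx v)

/-- A section of `T_B ⊕ T_B^∨` in the preferred chart at `p`. -/
def sectionInChart (p : B) (s : ∀ x : B, GenTangent I x) (y : EB) : Gen EB :=
  coordGen (trivializationAt EB (TangentSpace I) p) ((extChartAt I p).symm y)
    (s ((extChartAt I p).symm y))

theorem sectionInChart_self (p : B) (s : ∀ x : B, GenTangent I x) :
    sectionInChart p s (extChartAt I p p) =
      coordGen (trivializationAt EB (TangentSpace I) p) p (s p) := by
  simp only [sectionInChart]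
  rw [extChartAt_to_inv]

/-- The bracket on the manifold is defined by pulling back along the inverse chart. The pulled-back
fields are the coordinate expressions, since the inverse of the differential of the inverse chart is
the tangent trivialization. -/
theorem continuousLinearMapAt_mlieBracket [CompleteSpace EB] (p : B)
    (X Y : ∀ x : B, TangentSpace I x) :
    (trivializationAt EB (TangentSpace I) p).continuousLinearMapAt ℝ p
      (VectorField.mlieBracket I X Y p) =
    VectorField.lieBracket ℝ
      (fun y => (trivializationAt EB (TangentSpace I) p).continuousLinearMapAt ℝ
        ((extChartAt I p).symm y) (X ((extChartAt I p).symm y)))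
      (fun y => (trivializationAt EB (TangentSpace I) p).continuousLinearMapAt ℝ
        ((extChartAt I p).symm y) (Y ((extChartAt I p).symm y)))
      (extChartAt I p p) := by
  have hp := mem_baseSet_trivializationAt EB (TangentSpace I) p
  have hX : ∀ X : ∀ x : B, TangentSpace I x,
      VectorField.mpullbackWithin 𝓘(ℝ, EB) I (extChartAt I p).symm X (Set.range I)
        =ᶠ[𝓝 (extChartAt I p p)] fun y =>
      (trivializationAt EB (TangentSpace I) p).continuousLinearMapAt ℝ
        ((extChartAt I p).symm y) (X ((extChartAt I p).symm y)) := by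
    intro X
    filter_upwards [extChartAt_target_mem_nhds (I := I) p] with y hy
    exact (congrArg (fun L : EB →L[ℝ] TangentSpace I ((extChartAt I p).symm y) =>
      L.inverse (X ((extChartAt I p).symm y))) (symmL_tangent hy).symm).trans
      (DFunLike.congr_fun (inverse_symmL _ (mem_tangent_baseSet hy)) _)
  have h4 := TangentBundle.continuousLinearMapAt_trivializationAt (I := I) (mem_chart_source HB p)
  have h5 : (mfderiv I 𝓘(ℝ, EB) (extChartAt I p) p).inverse =
      (trivializationAt EB (TangentSpace I) p).symmL ℝ p := by
    rw [← h4]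
    refine ContinuousLinearMap.inverse_eq ?_ ?_
    · ext v
      exact (trivializationAt EB (TangentSpace I) p).continuousLinearMapAt_symmL hp v
    · ext v
      exact (trivializationAt EB (TangentSpace I) p).symmL_continuousLinearMapAt hp v
  rw [VectorField.mlieBracket, VectorField.mlieBracketWithin_apply, h5]
  refine ((trivializationAt EB (TangentSpace I) p).continuousLinearMapAt_symmL hp _).trans ?_
  rw [Set.preimage_univ, Set.univ_inter, I.range_eq_univ]
  have h6 := hX X
  have h7 := hX Y
  rw [I.range_eq_univ] at h6 h7
  refine (congrFun VectorField.lieBracketWithin_univ (extChartAt I p p)).trans ?_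
  exact h6.lieBracket_vectorField_eq h7

theorem contractExtDeriv_symmL (p : B) (s : ∀ x : B, GenTangent I x)
    (hs : DifferentiableAt ℝ (sectionInChart p s) (extChartAt I p p))
    (u : TangentSpace I p) (v : EB) :
    contractExtDeriv I (fun x => (s x).2) p u
      ((trivializationAt EB (TangentSpace I) p).symmL ℝ p v) =
    (fderiv ℝ (sectionInChart p s) (extChartAt I p p)
      ((trivializationAt EB (TangentSpace I) p).continuousLinearMapAt ℝ p u)).2 v -
    (fderiv ℝ (sectionInChart p s) (extChartAt I p p) v).2
      ((trivializationAt EB (TangentSpace I) p).continuousLinearMapAt ℝ p u) := by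
  have hp := mem_baseSet_trivializationAt EB (TangentSpace I) p
  have h1 : oneFormInChart I (fun x => (s x).2) p =ᶠ[𝓝 (extChartAt I p p)]
      fun y => (sectionInChart p s y).2 := by
    filter_upwards [extChartAt_target_mem_nhds (I := I) p] with y hy
    rw [oneFormInChart, ← symmL_tangent hy]; rfl
  have h2 := h1.fderiv_eq (𝕜 := ℝ)
  rw [hs.hasFDerivAt.snd.fderiv] at h2
  have h4 := TangentBundle.continuousLinearMapAt_trivializationAt (I := I) (mem_chart_source HB p)
  have h5 : ∀ v, (trivializationAt EB (TangentSpace I) p).continuousLinearMapAt ℝ p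
      ((trivializationAt EB (TangentSpace I) p).symmL ℝ p v) = v :=
    (trivializationAt EB (TangentSpace I) p).continuousLinearMapAt_symmL hp
  rw [contractExtDeriv, I.range_eq_univ, fderivWithin_univ, h2, ← h4]
  change (fderiv ℝ (sectionInChart p s) (extChartAt I p p)
      ((trivializationAt EB (TangentSpace I) p).continuousLinearMapAt ℝ p u)).2
      ((trivializationAt EB (TangentSpace I) p).continuousLinearMapAt ℝ p
        ((trivializationAt EB (TangentSpace I) p).symmL ℝ p v)) -
    (fderiv ℝ (sectionInChart p s) (extChartAt I p p)
      ((trivializationAt EB (TangentSpace I) p).continuousLinearMapAt ℝ p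
        ((trivializationAt EB (TangentSpace I) p).symmL ℝ p v))).2
      ((trivializationAt EB (TangentSpace I) p).continuousLinearMapAt ℝ p u) = _
  rw [h5]

theorem mvfderiv_apply_symmL (p : B) {s t : ∀ x : B, GenTangent I x}
    (hs : DifferentiableAt ℝ (sectionInChart p s) (extChartAt I p p))
    (ht : DifferentiableAt ℝ (sectionInChart p t) (extChartAt I p p)) (v : EB) :
    mvfderiv I (fun x => (t x).2 (s x).1) p
      ((trivializationAt EB (TangentSpace I) p).symmL ℝ p v) =
    (fderiv ℝ (sectionInChart p t) (extChartAt I p p) v).2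
      (sectionInChart p s (extChartAt I p p)).1 +
    (sectionInChart p t (extChartAt I p p)).2
      (fderiv ℝ (sectionInChart p s) (extChartAt I p p) v).1 := by
  have hd := ht.hasFDerivAt.snd.clm_apply hs.hasFDerivAt.fst
  rw [(mvfderiv_symmL (mem_chart_source HB p)
    (ĝ := fun y => (sectionInChart p t y).2 (sectionInChart p s y).1) ?_
    hd.differentiableAt v).2, hd.fderiv]
  · simp [add_comm]
  · filter_upwards [extChartAt_target_mem_nhds (I := I) p] with y hy
    simp only [sectionInChart, coordGen_apply, ContinuousLinearMap.comp_apply]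
    rw [Trivialization.symmL_continuousLinearMapAt _ (mem_tangent_baseSet hy)]

theorem mvfderiv_sub_apply_symmL (p : B) {s t : ∀ x : B, GenTangent I x}
    (hs : DifferentiableAt ℝ (sectionInChart p s) (extChartAt I p p))
    (ht : DifferentiableAt ℝ (sectionInChart p t) (extChartAt I p p)) (v : EB) :
    mvfderiv I (fun x => (s x).2 (t x).1 - (t x).2 (s x).1) p
      ((trivializationAt EB (TangentSpace I) p).symmL ℝ p v) =
    mvfderiv I (fun x => (s x).2 (t x).1) p
      ((trivializationAt EB (TangentSpace I) p).symmL ℝ p v) -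
    mvfderiv I (fun x => (t x).2 (s x).1) p
      ((trivializationAt EB (TangentSpace I) p).symmL ℝ p v) := by
  have hst := ht.hasFDerivAt.snd.clm_apply hs.hasFDerivAt.fst
  have hts := hs.hasFDerivAt.snd.clm_apply ht.hasFDerivAt.fst
  rw [mvfderiv_apply_symmL p hs ht, mvfderiv_apply_symmL p ht hs,
    (mvfderiv_symmL (mem_chart_source HB p)
      (ĝ := fun y => (sectionInChart p s y).2 (sectionInChart p t y).1 -
      (sectionInChart p t y).2 (sectionInChart p s y).1) ?_ (hts.fun_sub hst).differentiableAt v).2,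
    (hts.fun_sub hst).fderiv]
  · simp [add_comm]
  · filter_upwards [extChartAt_target_mem_nhds (I := I) p] with y hy
    simp only [sectionInChart, coordGen_apply, ContinuousLinearMap.comp_apply]
    rw [Trivialization.symmL_continuousLinearMapAt _ (mem_tangent_baseSet hy),
      Trivialization.symmL_continuousLinearMapAt _ (mem_tangent_baseSet hy)]

/-- The vector part is the coordinate Lie bracket. In the covector part, Cartan's formula and the
exact term combine so that the derivatives in the free direction v occur with coefficient 1/2, that
is, as ⟨D_v t, s⟩ - ⟨D_v s, t⟩. -/
theorem coordGen_courant [CompleteSpace EB] (p : B) {s t : ∀ x : B, GenTangent I x}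
    (hs : DifferentiableAt ℝ (sectionInChart p s) (extChartAt I p p))
    (ht : DifferentiableAt ℝ (sectionInChart p t) (extChartAt I p p)) :
    coordGen (trivializationAt EB (TangentSpace I) p) p (courant I s t p) =
      courantJet (sectionInChart p s (extChartAt I p p))
        (fderiv ℝ (sectionInChart p s) (extChartAt I p p))
        (sectionInChart p t (extChartAt I p p))
        (fderiv ℝ (sectionInChart p t) (extChartAt I p p)) := by
  have hp := mem_baseSet_trivializationAt EB (TangentSpace I) p
  refine Prod.ext ?_ ?_
  · rw [coordGen_apply]
    refine (continuousLinearMapAt_mlieBracket p _ _).trans ?_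
    have h1 := hs.hasFDerivAt.fst.fderiv
    have h2 := ht.hasFDerivAt.fst.fderiv
    rw [VectorField.lieBracket]
    change fderiv ℝ (fun y => (sectionInChart p t y).1) (extChartAt I p p)
        (sectionInChart p s (extChartAt I p p)).1 -
      fderiv ℝ (fun y => (sectionInChart p s y).1) (extChartAt I p p)
        (sectionInChart p t (extChartAt I p p)).1 = _
    rw [h1, h2]
    simp [courantJet]
  · ext v
    have hst := mvfderiv_apply_symmL p hs ht v
    have hts := mvfderiv_apply_symmL p ht hs v
    have hs' := contractExtDeriv_symmL p s hs (t p).1 v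
    have ht' := contractExtDeriv_symmL p t ht (s p).1 v
    have hd := mvfderiv_sub_apply_symmL p hs ht v
    have hs1 : (trivializationAt EB (TangentSpace I) p).continuousLinearMapAt ℝ p (s p).1 =
        (sectionInChart p s (extChartAt I p p)).1 := by
      rw [sectionInChart_self]; rfl
    have ht1 : (trivializationAt EB (TangentSpace I) p).continuousLinearMapAt ℝ p (t p).1 =
        (sectionInChart p t (extChartAt I p p)).1 := by
      rw [sectionInChart_self]; rfl
    rw [ht1] at hs'
    rw [hs1] at ht'
    set ℓ := (trivializationAt EB (TangentSpace I) p).symmL ℝ p v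
    change contractExtDeriv I (fun x => (t x).2) p (s p).1 ℓ
        + mvfderiv I (fun x => (t x).2 (s x).1) p ℓ
      - (contractExtDeriv I (fun x => (s x).2) p (t p).1 ℓ
        + mvfderiv I (fun x => (s x).2 (t x).1) p ℓ)
      + (1 / 2 : ℝ) * mvfderiv I (fun x => (s x).2 (t x).1 - (t x).2 (s x).1) p ℓ = _
    rw [hd, hst, hts, hs', ht']
    simp only [courantJet, Prod.snd_add, Prod.snd_sub, add_apply, sub_apply,
      ContinuousLinearMap.comp_apply, pairingLeft_apply, pairing]
    ring

end CourantCoordinates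

/-! ### Integrability as vanishing of the Nijenhuis form. -/

section IntegrabilityCriterion

theorem courantJet_neg_left {W : Type*} [NormedAddCommGroup W] [NormedSpace ℝ W] (a : Gen W)
    (A : W →L[ℝ] Gen W) (b : Gen W) (B : W →L[ℝ] Gen W) :
    courantJet (-a) (-A) b B = -courantJet a A b B := by
  rw [← sub_eq_zero]
  refine pairing_nondegenerate fun c => ?_
  simp only [pairing_sub_left, pairing_neg_left, pairing_neg_right, pairing_courantJet,
    neg_apply, Prod.fst_neg, map_neg]
  ring

theorem courantJet_neg_right {W : Type*} [NormedAddCommGroup W] [NormedSpace ℝ W] (a : Gen W)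
    (A : W →L[ℝ] Gen W) (b : Gen W) (B : W →L[ℝ] Gen W) :
    courantJet a A (-b) (-B) = -courantJet a A b B := by
  rw [← sub_eq_zero]
  refine pairing_nondegenerate fun c => ?_
  simp only [pairing_sub_left, pairing_neg_left, pairing_neg_right, pairing_courantJet,
    neg_apply, Prod.fst_neg, map_neg]
  ring

variable {EB : Type*} [NormedAddCommGroup EB] [NormedSpace ℝ EB] [FiniteDimensional ℝ EB]
  {HB : Type*} [TopologicalSpace HB] {I : ModelWithCorners ℝ EB HB} [I.Boundaryless]
  {B : Type*} [TopologicalSpace B] [ChartedSpace HB B] [IsManifold I 1 B]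

theorem differentiableAt_sectionInChart {s : ∀ x : B, GenTangent I x} {U : Set B} (hU : IsOpen U)
    (hs : SmoothSectionOn I EB s U) {p : B} (hp : p ∈ U) :
    DifferentiableAt ℝ (sectionInChart p s) (extChartAt I p p) :=
  differentiableAt_comp_extChartAt_symm
    (((smoothSectionOn_iff I hU).1 hs p hp).mdifferentiableAt (by simp))

/-- An endomorphism of `T_B ⊕ T_B^∨` in the preferred chart at `p`. -/
def endInChart (J : ∀ x : B, GenTangent I x →ₗ[ℝ] GenTangent I x) (p : B) (y : EB) :
    Gen EB →L[ℝ] Gen EB :=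
  coordEnd (trivializationAt EB (TangentSpace I) p) J ((extChartAt I p).symm y)

variable {J : ∀ x : B, GenTangent I x →ₗ[ℝ] GenTangent I x}

theorem sectionInChart_end (p : B) (s : ∀ x : B, GenTangent I x) :
    sectionInChart p (fun x => J x (s x)) =ᶠ[𝓝 (extChartAt I p p)]
      fun y => endInChart J p y (sectionInChart p s y) := by
  filter_upwards [extChartAt_target_mem_nhds (I := I) p] with y hy
  exact (coordEnd_coordGen (mem_tangent_baseSet hy) _).symm

theorem endInChart_sq (hJ : IsGenAlmostComplex I EB J) (p : B) :
    ∀ᶠ y in 𝓝 (extChartAt I p p), ∀ a, endInChart J p y (endInChart J p y a) = -a := by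
  filter_upwards [extChartAt_target_mem_nhds (I := I) p] with y hy a
  exact coordEnd_sq hJ.sq (mem_tangent_baseSet hy) a

theorem endInChart_orth (hJ : IsGenAlmostComplex I EB J) (p : B) :
    ∀ᶠ y in 𝓝 (extChartAt I p p), ∀ a b,
      pairing (endInChart J p y a) (endInChart J p y b) = pairing a b := by
  filter_upwards [extChartAt_target_mem_nhds (I := I) p] with y hy a b
  exact coordEnd_orth hJ.orth (mem_tangent_baseSet hy) a b

theorem endInChart_skew (hJ : IsGenAlmostComplex I EB J) (p : B) :
    ∀ᶠ y in 𝓝 (extChartAt I p p), ∀ a b,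
      pairing (endInChart J p y a) b = -pairing a (endInChart J p y b) := by
  filter_upwards [endInChart_sq hJ p, endInChart_orth hJ p] with y h1 h2
  exact pairing_skew h1 h2

/-- Near p the sections are s - i J s and t - i J t with s, t their real parts, so membership of the
bracket is the vanishing of the Nijenhuis vector of s and t, which by tensoriality sees only their
values at p. -/
theorem courantC_mem_iff (hJ : IsGenAlmostComplex I EB J) {p : B}
    (hd : DifferentiableAt ℝ (endInChart J p) (extChartAt I p p))
    {s t : ∀ x : B, GenTangentC I x}
    (hs1 : DifferentiableAt ℝ (sectionInChart p fun x => (s x).1) (extChartAt I p p))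
    (ht1 : DifferentiableAt ℝ (sectionInChart p fun x => (t x).1) (extChartAt I p p))
    (hs2 : DifferentiableAt ℝ (sectionInChart p fun x => (s x).2) (extChartAt I p p))
    (ht2 : DifferentiableAt ℝ (sectionInChart p fun x => (t x).2) (extChartAt I p p))
    (hs : ∀ᶠ x in 𝓝 p, s x ∈ plusEigenspace I J x) (ht : ∀ᶠ x in 𝓝 p, t x ∈ plusEigenspace I J x) :
    courantC I s t p ∈ plusEigenspace I J p ↔
      ∀ c, nij (endInChart J p (extChartAt I p p)) (fderiv ℝ (endInChart J p) (extChartAt I p p))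
        (coordGen (trivializationAt EB (TangentSpace I) p) p (s p).1)
        (coordGen (trivializationAt EB (TangentSpace I) p) p (t p).1) c = 0 := by
  have hcomplete : CompleteSpace EB := FiniteDimensional.complete ℝ EB
  have hp := mem_baseSet_trivializationAt EB (TangentSpace I) p
  -- The one-jet of the imaginary part is minus the one-jet of J applied to the real part.
  have key : ∀ s : ∀ x : B, GenTangentC I x,
      DifferentiableAt ℝ (sectionInChart p fun x => (s x).1) (extChartAt I p p) →
      (∀ᶠ x in 𝓝 p, s x ∈ plusEigenspace I J x) →
      sectionInChart p (fun x => (s x).2) (extChartAt I p p) =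
        -endInChart J p (extChartAt I p p)
          (sectionInChart p (fun x => (s x).1) (extChartAt I p p)) ∧
      fderiv ℝ (sectionInChart p fun x => (s x).2) (extChartAt I p p) =
        -applyJet (endInChart J p (extChartAt I p p))
          (fderiv ℝ (endInChart J p) (extChartAt I p p))
          (sectionInChart p (fun x => (s x).1) (extChartAt I p p))
          (fderiv ℝ (sectionInChart p fun x => (s x).1) (extChartAt I p p)) := by
    intro s hs1 hs
    have h1 : sectionInChart p (fun x => (s x).2) =ᶠ[𝓝 (extChartAt I p p)]
        fun y => -(endInChart J p y (sectionInChart p (fun x => (s x).1) y)) := by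
      have hc : Filter.Tendsto (extChartAt I p).symm (𝓝 (extChartAt I p p)) (𝓝 p) := by
        have := continuousAt_extChartAt_symm (I := I) p
        rwa [ContinuousAt, extChartAt_to_inv] at this
      filter_upwards [hc.eventually hs, sectionInChart_end (J := J) p (fun x => (s x).1)]
        with y hy hy'
      rw [← hy', sectionInChart, sectionInChart, hy.1, map_neg, neg_neg]
    refine ⟨h1.eq_of_nhds, ?_⟩
    rw [h1.fderiv_eq]
    have h2 := (hd.hasFDerivAt.clm_apply hs1.hasFDerivAt).fun_neg.fderiv
    rw [h2, applyJet, add_comm]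
  obtain ⟨hs3, hs4⟩ := key s hs1 hs
  obtain ⟨ht3, ht4⟩ := key t ht1 ht
  have hsq := (endInChart_sq hJ p).self_of_nhds
  have horth := (endInChart_orth hJ p).self_of_nhds
  -- Of the two eigenspace equations, either implies the other because J² = -1.
  have h1 : courantC I s t p ∈ plusEigenspace I J p ↔
      J p (courantC I s t p).1 + (courantC I s t p).2 = 0 := by
    constructor
    · intro h
      rw [h.1, neg_add_cancel]
    · intro h
      have h' := eq_neg_of_add_eq_zero_left h
      refine ⟨h', ?_⟩
      rw [eq_neg_of_add_eq_zero_right h, map_neg, hJ.sq, neg_neg]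
  have hj : ∀ u, coordGen (trivializationAt EB (TangentSpace I) p) p (J p u) =
      endInChart J p (extChartAt I p p)
        (coordGen (trivializationAt EB (TangentSpace I) p) p u) := by
    intro u
    rw [endInChart, extChartAt_to_inv, coordEnd_coordGen hp]
  rw [h1, ← (coordGen_injective hp).eq_iff, map_zero, map_add, hj]
  simp only [courantC, map_sub, map_add, coordGen_courant p hs1 ht1, coordGen_courant p hs2 ht1,
    coordGen_courant p hs1 ht2, coordGen_courant p hs2 ht2, hs3, hs4, ht3, ht4,
    courantJet_neg_left, courantJet_neg_right, neg_neg]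
  rw [← sectionInChart_self p (fun x => (s x).1), ← sectionInChart_self p (fun x => (t x).1),
    ← nijenhuis_eq_zero_iff hsq horth
      (pairing_fderiv_skew hd.hasFDerivAt (endInChart_skew hJ p))
      (fderiv_anticomm hd.hasFDerivAt (endInChart_sq hJ p)) _
      (fderiv ℝ (sectionInChart p fun x => (s x).1) (extChartAt I p p)) _
      (fderiv ℝ (sectionInChart p fun x => (t x).1) (extChartAt I p p))]
  simp only [sub_eq_add_neg, add_assoc, map_add, map_neg]

variable [ContMDiffVectorBundle ∞ EB (TangentSpace I : B → Type _) I]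

theorem differentiableAt_endInChart (hJ : IsGenAlmostComplex I EB J) (p : B) :
    DifferentiableAt ℝ (endInChart J p) (extChartAt I p p) :=
  differentiableAt_comp_extChartAt_symm
    ((contMDiffAt_coordEnd hJ.smooth p).mdifferentiableAt (by simp))

/-- A generalized almost complex structure is integrable if and only if its Nijenhuis form vanishes
at the centre of each chart. -/
theorem integrable_iff (hJ : IsGenAlmostComplex I EB J) :
    Integrable I J ↔ ∀ p a b c,
      nij (endInChart J p (extChartAt I p p)) (fderiv ℝ (endInChart J p) (extChartAt I p p))
        a b c = 0 := by
  constructor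
  · intro h p a b
    set e := trivializationAt EB (TangentSpace I) p with he
    have hp : p ∈ e.baseSet := mem_baseSet_trivializationAt EB (TangentSpace I) p
    -- The test sections are a - i J a with a constant in the trivialization. The imaginary part is
    -- written J(-a) so that smoothness follows directly from that of J.
    have hneg : ∀ a : Gen EB, SmoothSectionOn I EB
        (fun x => J x (coordGenSymm e x (-a))) e.baseSet := fun a =>
      hJ.smooth _ e.open_baseSet _ (smoothSectionOn_coordGenSymm p (-a))
    have hmem : ∀ (a : Gen EB) x, (coordGenSymm e x a, J x (coordGenSymm e x (-a))) ∈
        plusEigenspace I J x := fun a x => by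
      simp only [plusEigenspace, Set.mem_ofPred_eq, map_neg, neg_neg, true_and]
      rw [hJ.sq, neg_neg]
    have hs := smoothSectionOn_coordGenSymm (I := I) (W := TangentSpace I) p a
    have ht := smoothSectionOn_coordGenSymm (I := I) (W := TangentSpace I) p b
    have h1 := h e.baseSet e.open_baseSet
      (fun x => (coordGenSymm e x a, J x (coordGenSymm e x (-a))))
      (fun x => (coordGenSymm e x b, J x (coordGenSymm e x (-b))))
      hs (hneg a) ht (hneg b) (fun x _ => hmem a x) (fun x _ => hmem b x) p hp
    rw [courantC_mem_iff hJ (differentiableAt_endInChart hJ p)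
      (differentiableAt_sectionInChart e.open_baseSet hs hp)
      (differentiableAt_sectionInChart e.open_baseSet ht hp)
      (differentiableAt_sectionInChart e.open_baseSet (hneg a) hp)
      (differentiableAt_sectionInChart e.open_baseSet (hneg b) hp)
      (Filter.Eventually.of_forall (hmem a)) (Filter.Eventually.of_forall (hmem b))] at h1
    simpa only [← he, coordGen_coordGenSymm hp] using h1
  · intro h U hU s t hs1 hs2 ht1 ht2 hs ht p hp
    rw [courantC_mem_iff hJ (differentiableAt_endInChart hJ p)
      (differentiableAt_sectionInChart hU hs1 hp) (differentiableAt_sectionInChart hU ht1 hp)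
      (differentiableAt_sectionInChart hU hs2 hp) (differentiableAt_sectionInChart hU ht2 hp)
      (Filter.eventually_of_mem (hU.mem_nhds hp) hs) (Filter.eventually_of_mem (hU.mem_nhds hp) ht)]
    exact h p _ _

end IntegrabilityCriterion

/-! ### The connection form and its smoothness. -/

section ConnectionForm

variable {E : Type*} [NormedAddCommGroup E] [NormedSpace ℝ E] [FiniteDimensional ℝ E]
  {F : Type*} [NormedAddCommGroup F] [NormedSpace ℝ F] [FiniteDimensional ℝ F]
  {M : Type*} [TopologicalSpace M] [ChartedSpace E M] [IsManifold 𝓘(ℝ, E) ∞ M]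
  {V : M → Type*} [TopologicalSpace (TotalSpace F V)]
  [∀ x, AddCommGroup (V x)] [∀ x, Module ℝ (V x)] [∀ x, TopologicalSpace (V x)]
  [∀ x, IsTopologicalAddGroup (V x)] [∀ x, ContinuousSMul ℝ (V x)]
  [FiberBundle F V] [VectorBundle ℝ F V] [ContMDiffVectorBundle ∞ F V 𝓘(ℝ, E)]

theorem mdifferentiableAt_section_iff_coord (e : Trivialization F (π F V))
    [MemTrivializationAtlas e] {x : M} (hx : x ∈ e.baseSet) (σ : ∀ x, V x) :
    MDifferentiableAt 𝓘(ℝ, E) (𝓘(ℝ, E).prod 𝓘(ℝ, F)) (fun y => TotalSpace.mk' F y (σ y)) x ↔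
      MDifferentiableAt 𝓘(ℝ, E) 𝓘(ℝ, F) (fun y => e.continuousLinearMapAt ℝ y (σ y)) x := by
  have : ContMDiffVectorBundle 1 F V 𝓘(ℝ, E) := ContMDiffVectorBundle.of_le (n := ∞) (by simp)
  rw [e.mdifferentiableAt_section_iff _ _ hx]
  refine Filter.EventuallyEq.mdifferentiableAt_iff ?_
  filter_upwards [e.open_baseSet.mem_nhds hx] with y hy
  rw [Trivialization.continuousLinearMapAt_apply, Trivialization.coe_linearMapAt_of_mem _ hy]

theorem mdifferentiableAt_symmL (e : Trivialization F (π F V))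
    [MemTrivializationAtlas e] {x : M} (hx : x ∈ e.baseSet) (ξ : F) :
    MDifferentiableAt 𝓘(ℝ, E) (𝓘(ℝ, E).prod 𝓘(ℝ, F))
      (fun y => TotalSpace.mk' F y (e.symmL ℝ y ξ)) x := by
  rw [mdifferentiableAt_section_iff_coord e hx]
  refine (mdifferentiableAt_const (c := ξ)).congr_of_eventuallyEq ?_
  filter_upwards [e.open_baseSet.mem_nhds hx] with y hy
  exact e.continuousLinearMapAt_symmL hy ξ

variable (cov : CovariantDerivative 𝓘(ℝ, E) F V)

theorem cov_symmL_add (e : Trivialization F (π F V)) [MemTrivializationAtlas e] {x : M}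
    (hx : x ∈ e.baseSet) (ξ η : F) :
    cov (fun y => e.symmL ℝ y ξ + e.symmL ℝ y η) x =
      cov (fun y => e.symmL ℝ y ξ) x + cov (fun y => e.symmL ℝ y η) x := by
  exact cov.isCovariantDerivativeOn.add (mdifferentiableAt_symmL e hx ξ)
    (mdifferentiableAt_symmL e hx η)

theorem cov_symmL_smul (e : Trivialization F (π F V)) [MemTrivializationAtlas e] {x : M}
    (hx : x ∈ e.baseSet) (c : ℝ) (ξ : F) :
    cov (fun y => c • e.symmL ℝ y ξ) x = c • cov (fun y => e.symmL ℝ y ξ) x := by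
  exact cov.isCovariantDerivativeOn.smul_const c (mdifferentiableAt_symmL e hx ξ)

/-- The expression d + A in a trivialization is itself a connection over the base set; it is then
compared with ∇ by means of the difference tensor. -/
theorem isCovariantDerivativeOn_trivialization (e : Trivialization F (π F V))
    [MemTrivializationAtlas e] :
    IsCovariantDerivativeOn (I := 𝓘(ℝ, E)) F (fun σ x =>
      (e.symmL ℝ x).comp (mvfderiv 𝓘(ℝ, E) (fun y => e.continuousLinearMapAt ℝ y (σ y)) x) +
        cov (fun y => e.symmL ℝ y (e.continuousLinearMapAt ℝ x (σ x))) x) e.baseSet where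
  add {σ τ x} hσ hτ hx := by
    have h1 := (mdifferentiableAt_section_iff_coord e hx σ).1 hσ
    have h2 := (mdifferentiableAt_section_iff_coord e hx τ).1 hτ
    simp only [Pi.add_apply, map_add]
    rw [cov_symmL_add cov e hx, mvfderiv_fun_add h1 h2, ContinuousLinearMap.comp_add]
    abel
  leibniz {σ g x} hσ hg hx := by
    have h1 := (mdifferentiableAt_section_iff_coord e hx σ).1 hσ
    simp only [Pi.smul_apply', map_smul]
    rw [cov_symmL_smul cov e hx, mvfderiv_fun_smul hg h1]
    ext w
    simp only [add_apply, ContinuousLinearMap.comp_apply, ContinuousLinearMap.smulRight_apply,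
      smul_apply, map_add, map_smul, smul_add]
    rw [e.symmL_continuousLinearMapAt hx]
    abel

/-- A connection is determined by its values on the sections that are constant in a
trivialization. -/
theorem cov_eq (e : Trivialization F (π F V)) [MemTrivializationAtlas e] {x : M}
    (hx : x ∈ e.baseSet) {σ : ∀ x, V x} (hσ : MDifferentiableAt 𝓘(ℝ, E) (𝓘(ℝ, E).prod 𝓘(ℝ, F))
      (fun y => TotalSpace.mk' F y (σ y)) x) :
    cov σ x =
      (e.symmL ℝ x).comp (mvfderiv 𝓘(ℝ, E) (fun y => e.continuousLinearMapAt ℝ y (σ y)) x) +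
        cov (fun y => e.symmL ℝ y (e.continuousLinearMapAt ℝ x (σ x))) x := by
  have : ContMDiffVectorBundle 1 F V 𝓘(ℝ, E) := ContMDiffVectorBundle.of_le (n := ∞) (by simp)
  have h1 := cov.isCovariantDerivativeOn (s := e.baseSet)
  have h2 := isCovariantDerivativeOn_trivialization cov e
  -- The difference of two connections at x depends only on σ x, so it may be computed on the
  -- section with constant coordinates and the same value. There the derivative term vanishes and
  -- the connections agree.
  have h3 := IsCovariantDerivativeOn.difference_apply h1 h2 hx hσ
  have h4 := IsCovariantDerivativeOn.difference_apply h1 h2 hx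
    (mdifferentiableAt_symmL e hx (e.continuousLinearMapAt ℝ x (σ x)))
  rw [e.symmL_continuousLinearMapAt hx, h3] at h4
  have h5 : mvfderiv 𝓘(ℝ, E) (fun y => e.continuousLinearMapAt ℝ y
      (e.symmL ℝ y (e.continuousLinearMapAt ℝ x (σ x)))) x = 0 := by
    have h6 : (fun y => e.continuousLinearMapAt ℝ y
      (e.symmL ℝ y (e.continuousLinearMapAt ℝ x (σ x)))) =ᶠ[𝓝 x]
        fun _ => e.continuousLinearMapAt ℝ x (σ x) := by
      filter_upwards [e.open_baseSet.mem_nhds hx] with y hy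
      exact e.continuousLinearMapAt_symmL hy _
    rw [mvfderiv, h6.mfderiv_eq]
    exact mvfderiv_const _
  rw [h5, ContinuousLinearMap.comp_zero, zero_add, sub_self] at h4
  exact sub_eq_zero.1 h4

theorem cov_symm_eq (e : Trivialization F (π F V)) [MemTrivializationAtlas e] {x : M}
    (hx : x ∈ e.baseSet) (ξ : F) :
    cov (fun y => e.symm y ξ) x = cov (fun y => e.symmL ℝ y ξ) x := by
  have h : ∀ᶠ y in 𝓝 x, e.symmL ℝ y ξ = e.symm y ξ := by
    filter_upwards [e.open_baseSet.mem_nhds hx] with y hy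
    exact e.symmL_apply hy ξ
  have h1 := mdifferentiableAt_symmL (E := E) e hx ξ
  refine (cov.isCovariantDerivativeOn.congr_of_eventuallyEq h1 (h1.congr_of_eventuallyEq ?_)
    Filter.univ_mem h).symm
  filter_upwards [h] with y hy
  rw [hy]

/-- The connection form of `∇` in the preferred trivializations at `x₀`. -/
def connForm (x₀ x : M) : E →L[ℝ] F →L[ℝ] F :=
  LinearMap.toContinuousLinearMap
    { toFun u := LinearMap.toContinuousLinearMap
        { toFun ξ := (trivializationAt F V x₀).continuousLinearMapAt ℝ x
            (cov (fun y => (trivializationAt F V x₀).symmL ℝ y ξ) x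
              ((trivializationAt E (TangentSpace 𝓘(ℝ, E)) x₀).symmL ℝ x u))
          map_add' ξ η := by
            by_cases hx : x ∈ (trivializationAt F V x₀).baseSet
            · simp only [map_add, cov_symmL_add cov _ hx, add_apply]
            -- Off the base set `continuousLinearMapAt` is zero by convention, which makes linearity
            -- automatic.
            · simp [Trivialization.continuousLinearMapAt_apply,
                Trivialization.linearMapAt_def_of_notMem _ hx]
          map_smul' c ξ := by
            by_cases hx : x ∈ (trivializationAt F V x₀).baseSet
            · simp only [map_smul, cov_symmL_smul cov _ hx, smul_apply, RingHom.id_apply]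
            · simp [Trivialization.continuousLinearMapAt_apply,
                Trivialization.linearMapAt_def_of_notMem _ hx] }
      map_add' u v := by ext; simp
      map_smul' c u := by ext; simp }

theorem connForm_apply (x₀ x : M) (u : E) (ξ : F) :
    connForm cov x₀ x u ξ = (trivializationAt F V x₀).continuousLinearMapAt ℝ x
      (cov (fun y => (trivializationAt F V x₀).symmL ℝ y ξ) x
        ((trivializationAt E (TangentSpace 𝓘(ℝ, E)) x₀).symmL ℝ x u)) := rfl

theorem continuousLinearMapAt_cov {x₀ x : M} (hx : x ∈ (trivializationAt F V x₀).baseSet)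
    (hx' : x ∈ (trivializationAt E (TangentSpace 𝓘(ℝ, E)) x₀).baseSet) {σ : ∀ x, V x}
    (hσ : MDifferentiableAt 𝓘(ℝ, E) (𝓘(ℝ, E).prod 𝓘(ℝ, F))
      (fun y => TotalSpace.mk' F y (σ y)) x) (w : TangentSpace 𝓘(ℝ, E) x) :
    (trivializationAt F V x₀).continuousLinearMapAt ℝ x (cov σ x w) =
      mvfderiv 𝓘(ℝ, E) (fun y => (trivializationAt F V x₀).continuousLinearMapAt ℝ y (σ y)) x w +
        connForm cov x₀ x
          ((trivializationAt E (TangentSpace 𝓘(ℝ, E)) x₀).continuousLinearMapAt ℝ x w)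
          ((trivializationAt F V x₀).continuousLinearMapAt ℝ x (σ x)) := by
  rw [connForm_apply, Trivialization.symmL_continuousLinearMapAt _ hx', cov_eq cov _ hx hσ,
    add_apply, map_add, ContinuousLinearMap.comp_apply,
    Trivialization.continuousLinearMapAt_symmL _ hx]

/-- Smoothness of ∇ is applied to globally smooth sections, so the constant local frame is first
multiplied by a bump function supported in the base set; its smoothness uses that M is Hausdorff.
Locality of ∇ removes the bump function near x₀. -/
theorem contMDiffAt_connForm [T2Space M]
    (hsmooth : CovariantDerivative.ContMDiffCovariantDerivative cov ∞) (x₀ : M) :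
    ContMDiffAt 𝓘(ℝ, E) 𝓘(ℝ, E →L[ℝ] F →L[ℝ] F) ∞ (connForm cov x₀) x₀ := by
  refine contMDiffAt_clm_of_apply fun u => contMDiffAt_clm_of_apply fun ξ => ?_
  set e := trivializationAt F V x₀ with he
  have hx : x₀ ∈ e.baseSet := mem_baseSet_trivializationAt F V x₀
  obtain ⟨ψ, -, hψ⟩ := (SmoothBumpFunction.nhds_basis_tsupport (I := 𝓘(ℝ, E)) x₀).mem_iff.1
    (e.open_baseSet.mem_nhds hx)
  have hc : ContMDiffOn 𝓘(ℝ, E) (𝓘(ℝ, E).prod 𝓘(ℝ, F)) ∞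
      (fun y => TotalSpace.mk' F y (e.symmL ℝ y ξ)) e.baseSet := by
    rw [e.contMDiffOn_section_baseSet_iff]
    refine contMDiffOn_const (c := ξ) |>.congr fun x hx => ?_
    have := e.continuousLinearMapAt_symmL (R := ℝ) hx ξ
    rwa [Trivialization.continuousLinearMapAt_apply, Trivialization.coe_linearMapAt_of_mem _ hx]
      at this
  have hg : ContMDiff 𝓘(ℝ, E) (𝓘(ℝ, E).prod 𝓘(ℝ, F)) ∞
      (fun y => TotalSpace.mk' F y (ψ y • e.symmL ℝ y ξ)) :=
    ContMDiffOn.smul_section_of_tsupport ψ.contMDiff.contMDiffOn e.open_baseSet hψ hc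
  have h1 := hsmooth.contMDiff.contMDiff (σ := fun y => ψ y • e.symmL ℝ y ξ)
    (by simpa using hg.contMDiffOn (s := Set.univ))
  have h2 := h1.contMDiffAt (Filter.univ_mem (f := 𝓝 x₀))
  rw [contMDiffAt_hom_bundle] at h2
  have h3 := h2.2.clm_apply (contMDiffAt_const (c := u))
  refine h3.congr_of_eventuallyEq ?_
  filter_upwards [ψ.eventuallyEq_one.eventually_nhds, e.open_baseSet.mem_nhds hx] with y hy hye
  -- The bump function equals 1 on a whole neighbourhood of y, not only at y, so the two sections
  -- have the same germ.
  have h4 : cov (fun y => ψ y • e.symmL ℝ y ξ) y = cov (fun y => e.symmL ℝ y ξ) y := by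
    refine cov.isCovariantDerivativeOn.congr_of_eventuallyEq
      (hg.mdifferentiableAt (by simp)) (mdifferentiableAt_symmL e hye ξ) Filter.univ_mem ?_
    filter_upwards [hy] with z hz
    rw [hz]
    simp
  rw [connForm_apply]
  simp only [ContinuousLinearMap.inCoordinates, ContinuousLinearMap.comp_apply]
  rw [← h4]

end ConnectionForm

/-! ### Curvature in coordinates. -/

section Curvature

variable {E : Type*} [NormedAddCommGroup E] [NormedSpace ℝ E] [FiniteDimensional ℝ E]
  {F : Type*} [NormedAddCommGroup F] [NormedSpace ℝ F] [FiniteDimensional ℝ F]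
  {M : Type*} [TopologicalSpace M] [ChartedSpace E M] [IsManifold 𝓘(ℝ, E) ∞ M]
  {V : M → Type*} [TopologicalSpace (TotalSpace F V)]
  [∀ x, AddCommGroup (V x)] [∀ x, Module ℝ (V x)] [∀ x, TopologicalSpace (V x)]
  [∀ x, IsTopologicalAddGroup (V x)] [∀ x, ContinuousSMul ℝ (V x)]
  [FiberBundle F V] [VectorBundle ℝ F V] [ContMDiffVectorBundle ∞ F V 𝓘(ℝ, E)]

theorem contDiffAt_comp_extChartAt_symm {Q : Type*} [NormedAddCommGroup Q] [NormedSpace ℝ Q]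
    {f : M → Q} {p : M} {n : WithTop ℕ∞} (hf : ContMDiffAt 𝓘(ℝ, E) 𝓘(ℝ, Q) n f p) :
    ContDiffAt ℝ n (fun y => f ((extChartAt 𝓘(ℝ, E) p).symm y)) (extChartAt 𝓘(ℝ, E) p p) := by
  have h := ((contMDiffAt_iff (f := f) (x := p)).1 hf).2
  rw [ModelWithCorners.range_eq_univ, contDiffWithinAt_univ] at h
  exact h

/-- A section of a vector bundle in the preferred trivialization and the preferred chart. -/
def sectionCoord (F : Type*) [NormedAddCommGroup F] [NormedSpace ℝ F]
    {V : M → Type*} [TopologicalSpace (TotalSpace F V)]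
    [∀ x, AddCommGroup (V x)] [∀ x, Module ℝ (V x)] [∀ x, TopologicalSpace (V x)]
    [FiberBundle F V] [VectorBundle ℝ F V] (x₀ : M) (σ : ∀ x, V x) (y : E) : F :=
  (trivializationAt F V x₀).continuousLinearMapAt ℝ ((extChartAt 𝓘(ℝ, E) x₀).symm y)
    (σ ((extChartAt 𝓘(ℝ, E) x₀).symm y))

theorem sectionCoord_self (x₀ : M) (σ : ∀ x, V x) :
    sectionCoord F x₀ σ (extChartAt 𝓘(ℝ, E) x₀ x₀) =
      (trivializationAt F V x₀).continuousLinearMapAt ℝ x₀ (σ x₀) := by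
  rw [sectionCoord, extChartAt_to_inv]

theorem contDiffAt_sectionCoord {U : Set M} (hU : IsOpen U) {σ : ∀ x, V x}
    (hσ : ContMDiffOn 𝓘(ℝ, E) (𝓘(ℝ, E).prod 𝓘(ℝ, F)) ∞ (fun x => TotalSpace.mk' F x (σ x)) U)
    {x₀ : M} (hx₀ : x₀ ∈ U) :
    ContDiffAt ℝ ∞ (sectionCoord F x₀ σ) (extChartAt 𝓘(ℝ, E) x₀ x₀) :=
  contDiffAt_comp_extChartAt_symm ((contMDiffAt_section_iff_coord 𝓘(ℝ, E) σ x₀).1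
    (hσ.contMDiffAt (hU.mem_nhds hx₀)))

/-- The connection form at `x₀` in the preferred chart at `x₀`. -/
def connChart (cov : CovariantDerivative 𝓘(ℝ, E) F V) (x₀ : M) (y : E) : E →L[ℝ] F →L[ℝ] F :=
  connForm cov x₀ ((extChartAt 𝓘(ℝ, E) x₀).symm y)

variable (cov : CovariantDerivative 𝓘(ℝ, E) F V)

theorem coord_cov {x₀ z : M} (hz : z ∈ (chartAt E x₀).source)
    (hze : z ∈ (trivializationAt F V x₀).baseSet) {σ : ∀ x, V x}
    (hσ : DifferentiableAt ℝ (sectionCoord F x₀ σ) (extChartAt 𝓘(ℝ, E) x₀ z))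
    (w : TangentSpace 𝓘(ℝ, E) z) :
    (trivializationAt F V x₀).continuousLinearMapAt ℝ z (cov σ z w) =
      fderiv ℝ (sectionCoord F x₀ σ) (extChartAt 𝓘(ℝ, E) x₀ z)
        ((trivializationAt E (TangentSpace 𝓘(ℝ, E)) x₀).continuousLinearMapAt ℝ z w) +
      connForm cov x₀ z
        ((trivializationAt E (TangentSpace 𝓘(ℝ, E)) x₀).continuousLinearMapAt ℝ z w)
        ((trivializationAt F V x₀).continuousLinearMapAt ℝ z (σ z)) := by
  obtain ⟨h1, h2⟩ := mvfderiv_symmL (I := 𝓘(ℝ, E)) hz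
    (g := fun y => (trivializationAt F V x₀).continuousLinearMapAt ℝ y (σ y))
    (ĝ := sectionCoord F x₀ σ) (Filter.Eventually.of_forall fun y => rfl) hσ
    ((trivializationAt E (TangentSpace 𝓘(ℝ, E)) x₀).continuousLinearMapAt ℝ z w)
  rw [Trivialization.symmL_continuousLinearMapAt _ hz] at h2
  rw [continuousLinearMapAt_cov cov hze hz
    ((mdifferentiableAt_section_iff_coord _ hze σ).2 h1) w, h2]

theorem coord_cov_self {x₀ : M} {σ : ∀ x, V x}
    (hσ : DifferentiableAt ℝ (sectionCoord F x₀ σ) (extChartAt 𝓘(ℝ, E) x₀ x₀))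
    (w : TangentSpace 𝓘(ℝ, E) x₀) :
    (trivializationAt F V x₀).continuousLinearMapAt ℝ x₀ (cov σ x₀ w) =
      fderiv ℝ (sectionCoord F x₀ σ) (extChartAt 𝓘(ℝ, E) x₀ x₀)
        ((trivializationAt E (TangentSpace 𝓘(ℝ, E)) x₀).continuousLinearMapAt ℝ x₀ w) +
      connChart cov x₀ (extChartAt 𝓘(ℝ, E) x₀ x₀)
        ((trivializationAt E (TangentSpace 𝓘(ℝ, E)) x₀).continuousLinearMapAt ℝ x₀ w)
        (sectionCoord F x₀ σ (extChartAt 𝓘(ℝ, E) x₀ x₀)) := by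
  rw [coord_cov cov (mem_chart_source E x₀) (mem_baseSet_trivializationAt F V x₀) hσ w,
    sectionCoord_self, connChart, extChartAt_to_inv]

theorem sectionCoord_cov {x₀ : M} {σ : ∀ x, V x} (Y : ∀ x : M, TangentSpace 𝓘(ℝ, E) x)
    (hσ : ∀ᶠ y in 𝓝 (extChartAt 𝓘(ℝ, E) x₀ x₀), DifferentiableAt ℝ (sectionCoord F x₀ σ) y) :
    sectionCoord F x₀ (fun y => cov σ y (Y y)) =ᶠ[𝓝 (extChartAt 𝓘(ℝ, E) x₀ x₀)] fun y =>
      fderiv ℝ (sectionCoord F x₀ σ) y (sectionCoord E x₀ Y y) +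
        connChart cov x₀ y (sectionCoord E x₀ Y y) (sectionCoord F x₀ σ y) := by
  have hb := (continuousAt_extChartAt_symm (I := 𝓘(ℝ, E)) x₀).preimage_mem_nhds
    ((trivializationAt F V x₀).open_baseSet.mem_nhds (by
      rw [extChartAt_to_inv]; exact mem_baseSet_trivializationAt F V x₀))
  filter_upwards [hσ, extChartAt_target_mem_nhds (I := 𝓘(ℝ, E)) x₀, hb] with y hy hyt hyb
  have hz := (extChartAt 𝓘(ℝ, E) x₀).map_target hyt
  rw [extChartAt_source] at hz
  have hr := (extChartAt 𝓘(ℝ, E) x₀).right_inv hyt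
  have h := coord_cov cov hz hyb (by rwa [hr]) (Y ((extChartAt 𝓘(ℝ, E) x₀).symm y))
  rw [hr] at h
  exact h

theorem coord_cov_cov {x₀ : M} {σ : ∀ x, V x} {X Y : ∀ x : M, TangentSpace 𝓘(ℝ, E) x}
    (hA : DifferentiableAt ℝ (connChart cov x₀) (extChartAt 𝓘(ℝ, E) x₀ x₀))
    (hσ : ContDiffAt ℝ 2 (sectionCoord F x₀ σ) (extChartAt 𝓘(ℝ, E) x₀ x₀))
    (hY : DifferentiableAt ℝ (sectionCoord E x₀ Y) (extChartAt 𝓘(ℝ, E) x₀ x₀))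
    {x1 : E} (hx1 : x1 = extChartAt 𝓘(ℝ, E) x₀ x₀)
    {s : F} (hs : s = sectionCoord F x₀ σ x1) {u v : E} (hu : u = sectionCoord E x₀ X x1)
    (hv : v = sectionCoord E x₀ Y x1) :
    (trivializationAt F V x₀).continuousLinearMapAt ℝ x₀
        (cov (fun y => cov σ y (Y y)) x₀ (X x₀)) =
      fderiv ℝ (sectionCoord F x₀ σ) x1 (fderiv ℝ (sectionCoord E x₀ Y) x1 u)
        + fderiv ℝ (fderiv ℝ (sectionCoord F x₀ σ)) x1 u v
        + connChart cov x₀ x1 v (fderiv ℝ (sectionCoord F x₀ σ) x1 u)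
        + connChart cov x₀ x1 (fderiv ℝ (sectionCoord E x₀ Y) x1 u) s
        + fderiv ℝ (connChart cov x₀) x1 u v s
        + connChart cov x₀ x1 u (fderiv ℝ (sectionCoord F x₀ σ) x1 v)
        + connChart cov x₀ x1 u (connChart cov x₀ x1 v s) := by
  have hσ1 : ∀ᶠ y in 𝓝 (extChartAt 𝓘(ℝ, E) x₀ x₀),
      DifferentiableAt ℝ (sectionCoord F x₀ σ) y :=
    (hσ.eventually (by simp)).mono fun y hy => hy.differentiableAt (by simp)
  have hσ2 : DifferentiableAt ℝ (fderiv ℝ (sectionCoord F x₀ σ)) (extChartAt 𝓘(ℝ, E) x₀ x₀) :=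
    (hσ.fderiv_right (m := 1) (by norm_num)).differentiableAt (by simp)
  have h1 := sectionCoord_cov cov Y hσ1
  have hd := (hσ2.hasFDerivAt.clm_apply hY.hasFDerivAt).fun_add
    ((hA.hasFDerivAt.clm_apply hY.hasFDerivAt).clm_apply hσ1.self_of_nhds.hasFDerivAt)
  have hd' := hd.congr_of_eventuallyEq h1
  rw [coord_cov_self cov hd'.differentiableAt, hd'.fderiv, h1.eq_of_nhds,
    ← sectionCoord_self (E := E) (F := E) x₀ X]
  subst hx1 hs hu hv
  simp only [add_apply, ContinuousLinearMap.comp_apply, ContinuousLinearMap.flip_apply, map_add]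
  abel

/-- The curvature in the preferred chart and trivialization at `x₀`. -/
theorem coord_curvature {U : Set M} (hU : IsOpen U) {σ : ∀ x, V x}
    {X Y : ∀ x : M, TangentSpace 𝓘(ℝ, E) x}
    (hX : ContMDiffOn 𝓘(ℝ, E) (𝓘(ℝ, E).prod 𝓘(ℝ, E)) ∞ (fun x => TotalSpace.mk' E x (X x)) U)
    (hY : ContMDiffOn 𝓘(ℝ, E) (𝓘(ℝ, E).prod 𝓘(ℝ, E)) ∞ (fun x => TotalSpace.mk' E x (Y x)) U)
    (hσ : ContMDiffOn 𝓘(ℝ, E) (𝓘(ℝ, E).prod 𝓘(ℝ, F)) ∞ (fun x => TotalSpace.mk' F x (σ x)) U)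
    {x₀ : M} (hx₀ : x₀ ∈ U)
    (hA : DifferentiableAt ℝ (connChart cov x₀) (extChartAt 𝓘(ℝ, E) x₀ x₀))
    {x1 : E} (hx1 : x1 = extChartAt 𝓘(ℝ, E) x₀ x₀)
    {s : F} (hs : s = sectionCoord F x₀ σ x1) {u v : E} (hu : u = sectionCoord E x₀ X x1)
    (hv : v = sectionCoord E x₀ Y x1) :
    (trivializationAt F V x₀).continuousLinearMapAt ℝ x₀
        (cov (fun y => cov σ y (Y y)) x₀ (X x₀) - cov (fun y => cov σ y (X y)) x₀ (Y x₀)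
          - cov σ x₀ (VectorField.mlieBracket 𝓘(ℝ, E) X Y x₀)) =
      fderiv ℝ (connChart cov x₀) x1 u v s - fderiv ℝ (connChart cov x₀) x1 v u s
        + connChart cov x₀ x1 u (connChart cov x₀ x1 v s)
        - connChart cov x₀ x1 v (connChart cov x₀ x1 u s) := by
  have hcomplete : CompleteSpace E := FiniteDimensional.complete ℝ E
  have hX' := (contDiffAt_sectionCoord hU hX hx₀).differentiableAt (by simp)
  have hY' := (contDiffAt_sectionCoord hU hY hx₀).differentiableAt (by simp)
  have hσ' : ContDiffAt ℝ 2 (sectionCoord F x₀ σ) (extChartAt 𝓘(ℝ, E) x₀ x₀) :=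
    (contDiffAt_sectionCoord hU hσ hx₀).of_le (WithTop.coe_le_coe.2 (le_top : (2 : ℕ∞) ≤ ⊤))
  -- The second derivatives of σ cancel by symmetry; the terms with derivatives of X and Y are
  -- exactly those of the Lie bracket, and the mixed terms A(X) dσ(Y) cancel in pairs.
  have hsymm := hσ'.isSymmSndFDerivAt (by simp)
  rw [map_sub, map_sub, coord_cov_cov cov hA hσ' hY' hx1 hs hu hv,
    coord_cov_cov cov hA hσ' hX' hx1 hs hv hu,
    coord_cov_self cov (hσ'.differentiableAt (by simp)),
    continuousLinearMapAt_mlieBracket]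
  change _ - (fderiv ℝ (sectionCoord F x₀ σ) _ (VectorField.lieBracket ℝ (sectionCoord E x₀ X)
    (sectionCoord E x₀ Y) _) + connChart cov x₀ _ (VectorField.lieBracket ℝ (sectionCoord E x₀ X)
    (sectionCoord E x₀ Y) _) _) = _
  rw [VectorField.lieBracket]
  subst hx1 hs hu hv
  rw [hsymm (sectionCoord E x₀ Y _) (sectionCoord E x₀ X _)]
  simp only [map_sub, sub_apply]
  abel

/-- The curvature form vanishes at the centre of each chart. -/
def HasZeroCurvature : Prop :=
  ∀ (x₀ : M) (u v : E) (ξ : F),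
    fderiv ℝ (connChart cov x₀) (extChartAt 𝓘(ℝ, E) x₀ x₀) u v ξ
      - fderiv ℝ (connChart cov x₀) (extChartAt 𝓘(ℝ, E) x₀ x₀) v u ξ
      + connChart cov x₀ (extChartAt 𝓘(ℝ, E) x₀ x₀) u
        (connChart cov x₀ (extChartAt 𝓘(ℝ, E) x₀ x₀) v ξ)
      - connChart cov x₀ (extChartAt 𝓘(ℝ, E) x₀ x₀) v
        (connChart cov x₀ (extChartAt 𝓘(ℝ, E) x₀ x₀) u ξ) = 0

theorem contMDiffOn_symmL (x₀ : M) (ξ : F) :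
    ContMDiffOn 𝓘(ℝ, E) (𝓘(ℝ, E).prod 𝓘(ℝ, F)) ∞
      (fun y => TotalSpace.mk' F y ((trivializationAt F V x₀).symmL ℝ y ξ))
      (trivializationAt F V x₀).baseSet := by
  rw [Trivialization.contMDiffOn_section_baseSet_iff]
  refine contMDiffOn_const (c := ξ) |>.congr fun x hx => ?_
  have := (trivializationAt F V x₀).continuousLinearMapAt_symmL (R := ℝ) hx ξ
  rwa [Trivialization.continuousLinearMapAt_apply, Trivialization.coe_linearMapAt_of_mem _ hx]
    at this

/-- The coordinate formula for the curvature contains only the values of X, Y and σ at the point.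
Fields and sections with constant coordinates realize all values, which gives the forward
implication. -/
theorem isFlat_iff
    (hA : ∀ x₀, DifferentiableAt ℝ (connChart cov x₀) (extChartAt 𝓘(ℝ, E) x₀ x₀)) :
    IsFlat cov ↔ HasZeroCurvature cov := by
  constructor
  · intro h x₀ u v ξ
    have h1 := mem_baseSet_trivializationAt F V x₀
    have h2 := mem_baseSet_trivializationAt E (TangentSpace 𝓘(ℝ, E)) x₀
    have hU := (trivializationAt F V x₀).open_baseSet.inter
      (trivializationAt E (TangentSpace 𝓘(ℝ, E)) x₀).open_baseSet
    have hX := fun u : E => (contMDiffOn_symmL (E := E) (V := TangentSpace 𝓘(ℝ, E)) x₀ u).mono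
      (Set.inter_subset_right (s := (trivializationAt F V x₀).baseSet))
    have hσ := (contMDiffOn_symmL (E := E) (V := V) x₀ ξ).mono
      (Set.inter_subset_left (t := (trivializationAt E (TangentSpace 𝓘(ℝ, E)) x₀).baseSet))
    have h3 := h _ hU _ _ _ (hX u) (hX v) hσ x₀ ⟨h1, h2⟩
    have h4 := coord_curvature cov hU (hX u) (hX v) hσ ⟨h1, h2⟩ (hA x₀) rfl rfl rfl rfl
    rw [h3, map_zero, sectionCoord_self, sectionCoord_self, sectionCoord_self] at h4
    rw [Trivialization.continuousLinearMapAt_symmL _ h1,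
      Trivialization.continuousLinearMapAt_symmL _ h2,
      Trivialization.continuousLinearMapAt_symmL _ h2] at h4
    exact h4.symm
  · intro h U hU X Y σ hX hY hσ x hx
    have h4 := coord_curvature cov hU hX hY hσ hx (hA x) rfl rfl rfl rfl
    rw [h] at h4
    have h5 := congrArg ((trivializationAt F V x).symmL ℝ x) h4
    rwa [Trivialization.symmL_continuousLinearMapAt _ (mem_baseSet_trivializationAt F V x),
      map_zero] at h5

end Curvature

theorem _root_.HasFDerivAt.clm_apply_const {P Q R : Type*} [NormedAddCommGroup P] [NormedSpace ℝ P]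
    [NormedAddCommGroup Q] [NormedSpace ℝ Q] [NormedAddCommGroup R] [NormedSpace ℝ R]
    {c : P → Q →L[ℝ] R} {c' : P →L[ℝ] Q →L[ℝ] R} {x : P} (h : HasFDerivAt c c' x) (v : Q) :
    HasFDerivAt (fun y => c y v) (c'.flip v) x :=
  (ContinuousLinearMap.apply ℝ R v).hasFDerivAt.comp x h

/-! ### The dual connection in coordinates. -/

section DualConnection

scoped instance {F : Type*} [NormedAddCommGroup F] [NormedSpace ℝ F] :
    NormedAddCommGroup ((F →L[ℝ] ℝ) →L[ℝ] F →L[ℝ] ℝ) :=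
  ContinuousLinearMap.toNormedAddCommGroup

scoped instance {F : Type*} [NormedAddCommGroup F] [NormedSpace ℝ F] :
    AddCommGroup ((F →L[ℝ] ℝ) →L[ℝ] F →L[ℝ] ℝ) := inferInstance

scoped instance {F : Type*} [NormedAddCommGroup F] [NormedSpace ℝ F] :
    NormedSpace ℝ ((F →L[ℝ] ℝ) →L[ℝ] F →L[ℝ] ℝ) :=
  ContinuousLinearMap.toNormedSpace

scoped instance {E F : Type*} [NormedAddCommGroup E] [NormedSpace ℝ E] [NormedAddCommGroup F]
    [NormedSpace ℝ F] : NormedAddCommGroup (E →L[ℝ] (F →L[ℝ] ℝ) →L[ℝ] F →L[ℝ] ℝ) :=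
  ContinuousLinearMap.toNormedAddCommGroup

scoped instance {E F : Type*} [NormedAddCommGroup E] [NormedSpace ℝ E] [NormedAddCommGroup F]
    [NormedSpace ℝ F] : AddCommGroup (E →L[ℝ] (F →L[ℝ] ℝ) →L[ℝ] F →L[ℝ] ℝ) := inferInstance

variable {E : Type*} [NormedAddCommGroup E] [NormedSpace ℝ E] [FiniteDimensional ℝ E]
  {F : Type*} [NormedAddCommGroup F] [NormedSpace ℝ F] [FiniteDimensional ℝ F]
  {M : Type*} [TopologicalSpace M] [ChartedSpace E M] [IsManifold 𝓘(ℝ, E) ∞ M]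
  {V : M → Type*} [TopologicalSpace (TotalSpace F V)]
  [∀ x, AddCommGroup (V x)] [∀ x, Module ℝ (V x)] [∀ x, TopologicalSpace (V x)]
  [∀ x, IsTopologicalAddGroup (V x)] [∀ x, ContinuousSMul ℝ (V x)]
  [FiberBundle F V] [VectorBundle ℝ F V] [ContMDiffVectorBundle ∞ F V 𝓘(ℝ, E)]
  (cov : CovariantDerivative 𝓘(ℝ, E) F V)

theorem dual_baseSet (x₀ : M) :
    (trivializationAt (F →L[ℝ] ℝ) (DualBundle V) x₀).baseSet =
      (trivializationAt F V x₀).baseSet := by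
  rw [hom_trivializationAt_baseSet]
  exact Set.inter_univ _

theorem dual_continuousLinearMapAt {x₀ x : M} (hx : x ∈ (trivializationAt F V x₀).baseSet)
    (f : DualBundle V x) :
    (trivializationAt (F →L[ℝ] ℝ) (DualBundle V) x₀).continuousLinearMapAt ℝ x f =
      f.comp ((trivializationAt F V x₀).symmL ℝ x) := by
  rw [Trivialization.continuousLinearMapAt_apply, Trivialization.coe_linearMapAt_of_mem _
    (by rwa [dual_baseSet])]
  change (trivializationAt (F →L[ℝ] ℝ) (fun x => V x →L[ℝ] ℝ) x₀ ⟨x, f⟩).2 = _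
  rw [hom_trivializationAt_apply]
  ext v
  simp [ContinuousLinearMap.inCoordinates]

theorem dual_symmL {x₀ x : M} (hx : x ∈ (trivializationAt F V x₀).baseSet) (f : F →L[ℝ] ℝ) :
    (trivializationAt (F →L[ℝ] ℝ) (DualBundle V) x₀).symmL ℝ x f =
      f.comp ((trivializationAt F V x₀).continuousLinearMapAt ℝ x) := by
  have h := dual_continuousLinearMapAt hx
    (f.comp ((trivializationAt F V x₀).continuousLinearMapAt ℝ x))
  have h1 : (f.comp ((trivializationAt F V x₀).continuousLinearMapAt ℝ x)).comp
      ((trivializationAt F V x₀).symmL ℝ x) = f := by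
    ext ξ
    simp only [ContinuousLinearMap.comp_apply]
    rw [Trivialization.continuousLinearMapAt_symmL _ hx]
  rw [h1] at h
  rw [← congrArg ((trivializationAt (F →L[ℝ] ℝ) (DualBundle V) x₀).symmL ℝ x) h,
    Trivialization.symmL_continuousLinearMapAt _ (by rwa [dual_baseSet])]

/-- Evaluate the defining rule of ∇^∨ on a section and a dual section with constant coordinates:
their pairing is locally constant, so only the term -f(∇σ) survives. -/
theorem connForm_dualConn {x₀ x : M} (hx : x ∈ (trivializationAt F V x₀).baseSet) (u : E)
    (f : F →L[ℝ] ℝ) (ξ : F) :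
    connForm (dualConn cov) x₀ x u f ξ = -f (connForm cov x₀ x u ξ) := by
  set e := trivializationAt F V x₀ with he
  have hd : x ∈ (trivializationAt (F →L[ℝ] ℝ) (DualBundle V) x₀).baseSet := by rwa [dual_baseSet]
  have h1 := dualConnFun_apply cov
    (mdifferentiableAt_symmL (E := E) (V := DualBundle V) _ hd f)
    (mdifferentiableAt_symmL (E := E) e hx ξ)
    ((trivializationAt E (TangentSpace 𝓘(ℝ, E)) x₀).symmL ℝ x u)
  have h2 : (fun y => (trivializationAt (F →L[ℝ] ℝ) (DualBundle V) x₀).symmL ℝ y f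
      (e.symmL ℝ y ξ)) =ᶠ[𝓝 x] fun _ => f ξ := by
    filter_upwards [e.open_baseSet.mem_nhds hx] with y hy
    rw [dual_symmL hy, ContinuousLinearMap.comp_apply, e.continuousLinearMapAt_symmL hy]
  have h3 : mvfderiv 𝓘(ℝ, E) (fun y => (trivializationAt (F →L[ℝ] ℝ) (DualBundle V) x₀).symmL ℝ y f
      (e.symmL ℝ y ξ)) x = 0 := by
    rw [mvfderiv, h2.mfderiv_eq]
    exact mvfderiv_const _
  rw [h3, dual_symmL hx, ContinuousLinearMap.comp_apply, zero_apply, zero_sub] at h1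
  rw [connForm_apply, connForm_apply, dual_continuousLinearMapAt hx]
  exact h1

theorem connForm_dualConn_eventuallyEq (x₀ : M) : ∀ᶠ x in 𝓝 x₀, ∀ u f ξ,
    connForm (dualConn cov) x₀ x u f ξ = -f (connForm cov x₀ x u ξ) := by
  filter_upwards [(trivializationAt F V x₀).open_baseSet.mem_nhds
    (mem_baseSet_trivializationAt F V x₀)] with x hx u f ξ
  exact connForm_dualConn cov hx u f ξ

/-- Minus the transpose of a smooth matrix is smooth. The argument uses the smoothness of ∇^∨ only
in this form. -/
theorem contMDiffAt_connForm_dualConn {x₀ : M}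
    (h : ContMDiffAt 𝓘(ℝ, E) 𝓘(ℝ, E →L[ℝ] F →L[ℝ] F) ∞ (connForm cov x₀) x₀) :
    ContMDiffAt 𝓘(ℝ, E) 𝓘(ℝ, E →L[ℝ] (F →L[ℝ] ℝ) →L[ℝ] F →L[ℝ] ℝ) ∞
      (connForm (dualConn cov) x₀) x₀ := by
  refine contMDiffAt_clm_of_apply fun u => contMDiffAt_clm_of_apply fun f =>
    contMDiffAt_clm_of_apply fun ξ => ?_
  have h1 := ((h.clm_apply (contMDiffAt_const (c := u))).clm_apply (contMDiffAt_const (c := ξ)))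
  have h2 := (f.contMDiff (n := ∞)).contMDiffAt.comp x₀ h1
  refine h2.neg.congr_of_eventuallyEq ?_
  filter_upwards [connForm_dualConn_eventuallyEq cov x₀] with x hx
  rw [hx]
  rfl

theorem connChart_dualConn_eventuallyEq (x₀ : M) :
    ∀ᶠ y in 𝓝 (extChartAt 𝓘(ℝ, E) x₀ x₀), ∀ u f ξ,
      connChart (dualConn cov) x₀ y u f ξ = -f (connChart cov x₀ y u ξ) := by
  have hc : Filter.Tendsto (extChartAt 𝓘(ℝ, E) x₀).symm (𝓝 (extChartAt 𝓘(ℝ, E) x₀ x₀))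
      (𝓝 x₀) := by
    have := continuousAt_extChartAt_symm (I := 𝓘(ℝ, E)) x₀
    rwa [ContinuousAt, extChartAt_to_inv] at this
  exact hc.eventually (connForm_dualConn_eventuallyEq cov x₀)

theorem differentiableAt_connChart {x₀ : M}
    (h : ContMDiffAt 𝓘(ℝ, E) 𝓘(ℝ, E →L[ℝ] F →L[ℝ] F) ∞ (connForm cov x₀) x₀) :
    DifferentiableAt ℝ (connChart cov x₀) (extChartAt 𝓘(ℝ, E) x₀ x₀) :=
  differentiableAt_comp_extChartAt_symm (h.mdifferentiableAt (by simp))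

theorem fderiv_connChart_dualConn {x₀ : M}
    (h : DifferentiableAt ℝ (connChart cov x₀) (extChartAt 𝓘(ℝ, E) x₀ x₀))
    (h' : DifferentiableAt ℝ (connChart (dualConn cov) x₀) (extChartAt 𝓘(ℝ, E) x₀ x₀))
    (u v : E) (f : F →L[ℝ] ℝ) (ξ : F) :
    fderiv ℝ (connChart (dualConn cov) x₀) (extChartAt 𝓘(ℝ, E) x₀ x₀) u v f ξ =
      -f (fderiv ℝ (connChart cov x₀) (extChartAt 𝓘(ℝ, E) x₀ x₀) u v ξ) := by
  have h1 := (((h'.hasFDerivAt.clm_apply_const v).clm_apply_const f).clm_apply_const ξ).fderiv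
  have h2 := (f.hasFDerivAt.comp _
    ((h.hasFDerivAt.clm_apply_const v).clm_apply_const ξ)).fun_neg.fderiv
  have h3 : (fun y => connChart (dualConn cov) x₀ y v f ξ) =ᶠ[𝓝 (extChartAt 𝓘(ℝ, E) x₀ x₀)]
      fun y => -f (connChart cov x₀ y v ξ) :=
    (connChart_dualConn_eventuallyEq cov x₀).mono fun y hy => hy v f ξ
  have h4 := DFunLike.congr_fun (h1.symm.trans ((h3.fderiv_eq (𝕜 := ℝ)).trans h2)) u
  exact h4

/-- The curvature of ∇^∨ is minus the transpose of the curvature of ∇: transposition reverses the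
order of the products A u A v, and the two minus signs in each product cancel. -/
theorem isFlat_dualConn
    (hA : ∀ x₀, ContMDiffAt 𝓘(ℝ, E) 𝓘(ℝ, E →L[ℝ] F →L[ℝ] F) ∞ (connForm cov x₀) x₀)
    (h : IsFlat cov) : IsFlat (dualConn cov) := by
  have h1 := fun x₀ => differentiableAt_connChart cov (hA x₀)
  have h2 := fun x₀ => differentiableAt_connChart (dualConn cov)
    (contMDiffAt_connForm_dualConn cov (hA x₀))
  rw [isFlat_iff _ h1] at h
  rw [isFlat_iff _ h2]
  intro x₀ u v f
  ext ξ
  have h3 := (connChart_dualConn_eventuallyEq cov x₀).self_of_nhds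
  have h4 := congrArg f (h x₀ u v ξ)
  rw [sub_apply, add_apply, sub_apply, zero_apply, fderiv_connChart_dualConn cov (h1 x₀) (h2 x₀),
    fderiv_connChart_dualConn cov (h1 x₀) (h2 x₀), h3, h3, h3, h3]
  rw [map_sub f, map_add f, map_sub f, map_zero f] at h4
  linarith

end DualConnection

/-! ### The vertical projection does not depend on the trivialization. -/

section VerticalProjection

theorem mvfderiv_clm_apply {E : Type*} [NormedAddCommGroup E] [NormedSpace ℝ E]
    {H : Type*} [TopologicalSpace H] {I : ModelWithCorners ℝ E H}
    {B : Type*} [TopologicalSpace B] [ChartedSpace H B]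
    {P Q : Type*} [NormedAddCommGroup P] [NormedSpace ℝ P] [NormedAddCommGroup Q] [NormedSpace ℝ Q]
    {c : B → P →L[ℝ] Q} {f : B → P} {x : B} (hc : MDifferentiableAt I 𝓘(ℝ, P →L[ℝ] Q) c x)
    (hf : MDifferentiableAt I 𝓘(ℝ, P) f x) (w : TangentSpace I x) :
    mvfderiv I (fun y => c y (f y)) x w = mvfderiv I c x w (f x) + c x (mvfderiv I f x w) := by
  have hc' := hc.hasMFDerivAt
  have hf' := hf.hasMFDerivAt
  let dc : E →L[ℝ] P →L[ℝ] Q := mvfderiv I c x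
  let df : E →L[ℝ] P := mvfderiv I f x
  have h1 : HasFDerivWithinAt (c ∘ (extChartAt I x).symm) dc (Set.range I)
      (extChartAt I x x) := hc'.2
  have h2 : HasFDerivWithinAt (f ∘ (extChartAt I x).symm) df (Set.range I)
      (extChartAt I x x) := hf'.2
  have h3 := h1.clm_apply h2
  simp only [Function.comp_apply, extChartAt_to_inv] at h3
  have h4 : HasMFDerivAt I 𝓘(ℝ, Q) (fun y => c y (f y)) x
      ((c x).comp df + dc.flip (f x)) :=
    ⟨hc'.1.clm_apply hf'.1, h3⟩
  exact (DFunLike.congr_fun h4.mfderiv w).trans (add_comm _ _)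

variable {E : Type*} [NormedAddCommGroup E] [NormedSpace ℝ E] [FiniteDimensional ℝ E]
  {F : Type*} [NormedAddCommGroup F] [NormedSpace ℝ F] [FiniteDimensional ℝ F]
  {M : Type*} [TopologicalSpace M] [ChartedSpace E M] [IsManifold 𝓘(ℝ, E) ∞ M]
  {V : M → Type*} [TopologicalSpace (TotalSpace F V)]
  [∀ x, AddCommGroup (V x)] [∀ x, Module ℝ (V x)] [∀ x, TopologicalSpace (V x)]
  [∀ x, IsTopologicalAddGroup (V x)] [∀ x, ContinuousSMul ℝ (V x)]
  [FiberBundle F V] [VectorBundle ℝ F V] [ContMDiffVectorBundle ∞ F V 𝓘(ℝ, E)]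
  (cov : CovariantDerivative 𝓘(ℝ, E) F V)

theorem mdifferentiableAt_proj (q : TotalSpace F V) :
    MDifferentiableAt (𝓘(ℝ, E).prod 𝓘(ℝ, F)) 𝓘(ℝ, E) (fun r : TotalSpace F V => r.proj) q :=
  (contMDiffAt_proj (n := ∞) (IB := 𝓘(ℝ, E)) V).mdifferentiableAt (by simp)

theorem mdifferentiableAt_fiberCoord (e : Trivialization F (π F V)) [MemTrivializationAtlas e]
    {q : TotalSpace F V} (hq : q.proj ∈ e.baseSet) :
    MDifferentiableAt (𝓘(ℝ, E).prod 𝓘(ℝ, F)) 𝓘(ℝ, F) (fun r : TotalSpace F V => (e r).2) q :=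
  (((Bundle.Trivialization.contMDiffOn (n := ∞) (IB := 𝓘(ℝ, E)) e).contMDiffAt
    (e.open_source.mem_nhds (e.mem_source.2 hq))).mdifferentiableAt (by simp)).snd

theorem fiberCoord_eq (e : Trivialization F (π F V)) [MemTrivializationAtlas e]
    {q : TotalSpace F V} (hq : q.proj ∈ e.baseSet) :
    (e q).2 = e.continuousLinearMapAt ℝ q.proj q.snd := by
  rw [Trivialization.continuousLinearMapAt_apply, Trivialization.coe_linearMapAt_of_mem _ hq]

/-- The vertical projection in an arbitrary trivialization. -/
theorem vertProj_eq (e : Trivialization F (π F V)) [MemTrivializationAtlas e]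
    {q : TotalSpace F V} (hq : q.proj ∈ e.baseSet)
    (w : TangentSpace (𝓘(ℝ, E).prod 𝓘(ℝ, F)) q) :
    vertProj cov q w =
      e.symmL ℝ q.proj (mvfderiv (𝓘(ℝ, E).prod 𝓘(ℝ, F)) (fun r : TotalSpace F V => (e r).2) q w) +
      cov (fun y => e.symmL ℝ y (e q).2) q.proj
        (mfderiv (𝓘(ℝ, E).prod 𝓘(ℝ, F)) 𝓘(ℝ, E) (fun r : TotalSpace F V => r.proj) q w) := by
  -- The definition uses the trivialization centred at the base point of q, which varies with q;
  -- coordinates near p require one fixed trivialization. Here g is the transition map.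
  set e' := trivializationAt F V q.proj with he'
  have hq' : q.proj ∈ e'.baseSet := mem_baseSet_trivializationAt F V q.proj
  let g : M → F →L[ℝ] F := fun y => (e.coordChangeL ℝ e' y : F →L[ℝ] F)
  have hg : MDifferentiableAt 𝓘(ℝ, E) 𝓘(ℝ, F →L[ℝ] F) g q.proj :=
    (contMDiffAt_coordChangeL (n := ∞) (IB := 𝓘(ℝ, E)) hq hq').mdifferentiableAt (by simp)
  have hgy : ∀ y, y ∈ e.baseSet → y ∈ e'.baseSet → ∀ η,
      e'.continuousLinearMapAt ℝ y (e.symmL ℝ y η) = g y η := by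
    intro y hy hy' η
    rw [Trivialization.continuousLinearMapAt_apply, Trivialization.coe_linearMapAt_of_mem _ hy',
      e.symmL_apply hy]
    exact (e.coordChangeL_apply (R := ℝ) e' ⟨hy, hy'⟩ η).symm
  have hπ := mdifferentiableAt_proj (E := E) q
  have hξ := mdifferentiableAt_fiberCoord (E := E) e hq
  have h1 : (fun r : TotalSpace F V => (e' r).2) =ᶠ[𝓝 q]
      fun r => (g ∘ fun r : TotalSpace F V => r.proj) r (e r).2 := by
    filter_upwards [e.open_source.mem_nhds (e.mem_source.2 hq),
      e'.open_source.mem_nhds (e'.mem_source.2 hq')] with r hr hr'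
    rw [e.mem_source] at hr
    rw [e'.mem_source] at hr'
    rw [Function.comp_apply, ← hgy _ hr hr', fiberCoord_eq e hr, fiberCoord_eq e' hr',
      e.symmL_continuousLinearMapAt hr]
  have h2 : mvfderiv (𝓘(ℝ, E).prod 𝓘(ℝ, F)) (fun r : TotalSpace F V => (e' r).2) q w =
      mvfderiv 𝓘(ℝ, E) g q.proj
        (mfderiv (𝓘(ℝ, E).prod 𝓘(ℝ, F)) 𝓘(ℝ, E) (fun r : TotalSpace F V => r.proj) q w) (e q).2 +
      g q.proj (mvfderiv (𝓘(ℝ, E).prod 𝓘(ℝ, F)) (fun r : TotalSpace F V => (e r).2) q w) := by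
    have h3 : mvfderiv (𝓘(ℝ, E).prod 𝓘(ℝ, F)) (fun r : TotalSpace F V => (e' r).2) q =
        mvfderiv (𝓘(ℝ, E).prod 𝓘(ℝ, F))
          (fun r => (g ∘ fun r : TotalSpace F V => r.proj) r (e r).2) q := by
      simp only [mvfderiv, h1.mfderiv_eq]
      rfl
    have h4 : mvfderiv (𝓘(ℝ, E).prod 𝓘(ℝ, F)) (g ∘ fun r : TotalSpace F V => r.proj) q w =
        mvfderiv 𝓘(ℝ, E) g q.proj
          (mfderiv (𝓘(ℝ, E).prod 𝓘(ℝ, F)) 𝓘(ℝ, E) (fun r : TotalSpace F V => r.proj) q w) :=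
      mfderiv_comp_apply q hg hπ w
    rw [h3, mvfderiv_clm_apply (hg.comp q hπ) hξ, h4]
    rfl
  -- The derivative of g occurs on both sides: in dξ' = (dg) ξ + g dξ, and in ∇ of the section that
  -- is constant in e but not in e'. This is the compatibility needed.
  have h4 := cov_eq cov e' hq' (mdifferentiableAt_symmL (E := E) e hq (e q).2)
  have h5 : mvfderiv 𝓘(ℝ, E) (fun y => e'.continuousLinearMapAt ℝ y (e.symmL ℝ y (e q).2)) q.proj =
      mvfderiv 𝓘(ℝ, E) (fun y => g y (e q).2) q.proj := by
    have h6 : (fun y => e'.continuousLinearMapAt ℝ y (e.symmL ℝ y (e q).2)) =ᶠ[𝓝 q.proj]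
        fun y => g y (e q).2 := by
      filter_upwards [e.open_baseSet.mem_nhds hq, e'.open_baseSet.mem_nhds hq'] with y hy hy'
      exact hgy y hy hy' _
    simp only [mvfderiv, h6.mfderiv_eq]
    rfl
  have h6 : (e' q).2 = g q.proj (e q).2 := h1.eq_of_nhds
  change e'.symmL ℝ q.proj
      (mvfderiv (𝓘(ℝ, E).prod 𝓘(ℝ, F)) (fun r : TotalSpace F V => (e' r).2) q w) +
    cov (fun y => e'.symm y (e' q).2) q.proj
      (mfderiv (𝓘(ℝ, E).prod 𝓘(ℝ, F)) 𝓘(ℝ, E) (fun r : TotalSpace F V => r.proj) q w) = _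
  rw [h2, h4, add_apply, ContinuousLinearMap.comp_apply, h5,
    mvfderiv_clm_apply hg mdifferentiableAt_const, hgy _ hq hq', cov_symm_eq cov e' hq', h6,
    mvfderiv_const, zero_apply, map_zero, add_zero, map_add, ← hgy _ hq hq',
    e'.symmL_continuousLinearMapAt hq']
  abel

end VerticalProjection

/-! ### The lift in coordinates is conjugation by a shear. -/

section LiftCoordinates

theorem coordGen_genMap {B₁ B₂ : Type*} [TopologicalSpace B₁] [TopologicalSpace B₂]
    {G₁ : Type*} [NormedAddCommGroup G₁] [NormedSpace ℝ G₁]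
    {W₁ : B₁ → Type*} [TopologicalSpace (TotalSpace G₁ W₁)]
    [∀ x, AddCommGroup (W₁ x)] [∀ x, Module ℝ (W₁ x)] [∀ x, TopologicalSpace (W₁ x)]
    [∀ x, IsTopologicalAddGroup (W₁ x)] [∀ x, ContinuousSMul ℝ (W₁ x)]
    [FiberBundle G₁ W₁] [VectorBundle ℝ G₁ W₁]
    {G₂ : Type*} [NormedAddCommGroup G₂] [NormedSpace ℝ G₂]
    {W₂ : B₂ → Type*} [TopologicalSpace (TotalSpace G₂ W₂)]
    [∀ x, AddCommGroup (W₂ x)] [∀ x, Module ℝ (W₂ x)] [∀ x, TopologicalSpace (W₂ x)]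
    [∀ x, IsTopologicalAddGroup (W₂ x)] [∀ x, ContinuousSMul ℝ (W₂ x)]
    [FiberBundle G₂ W₂] [VectorBundle ℝ G₂ W₂]
    {e₁ : Trivialization G₁ (π G₁ W₁)} [e₁.IsLinear ℝ]
    {e₂ : Trivialization G₂ (π G₂ W₂)} [e₂.IsLinear ℝ] {x₁ : B₁} {x₂ : B₂}
    (h₁ : x₁ ∈ e₁.baseSet) (h₂ : x₂ ∈ e₂.baseSet) {S : W₁ x₁ ≃L[ℝ] W₂ x₂} {L : G₁ ≃L[ℝ] G₂}
    (h : ∀ w, e₂.continuousLinearMapAt ℝ x₂ (S w) = L (e₁.continuousLinearMapAt ℝ x₁ w))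
    (a : Gen (W₁ x₁)) :
    coordGen e₂ x₂ (genMap S a) = genMap L (coordGen e₁ x₁ a) := by
  refine Prod.ext (h a.1) ?_
  ext z
  have h3 : S.symm (e₂.symmL ℝ x₂ z) = e₁.symmL ℝ x₁ (L.symm z) := by
    rw [ContinuousLinearEquiv.symm_apply_eq]
    have h4 := h (e₁.symmL ℝ x₁ (L.symm z))
    rw [e₁.continuousLinearMapAt_symmL h₁, L.apply_symm_apply] at h4
    rw [← e₂.symmL_continuousLinearMapAt (R := ℝ) h₂ (S (e₁.symmL ℝ x₁ (L.symm z))), h4]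
  exact congrArg a.2 h3

variable {E : Type*} [NormedAddCommGroup E] [NormedSpace ℝ E] [FiniteDimensional ℝ E]
  {F : Type*} [NormedAddCommGroup F] [NormedSpace ℝ F] [FiniteDimensional ℝ F]
  {M : Type*} [TopologicalSpace M] [ChartedSpace E M] [IsManifold 𝓘(ℝ, E) ∞ M]
  {V : M → Type*} [TopologicalSpace (TotalSpace F V)]
  [∀ x, AddCommGroup (V x)] [∀ x, Module ℝ (V x)] [∀ x, TopologicalSpace (V x)]
  [∀ x, IsTopologicalAddGroup (V x)] [∀ x, ContinuousSMul ℝ (V x)]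
  [FiberBundle F V] [VectorBundle ℝ F V]

/-- The preferred trivialization of `V ⊕ T_M` at `x₀`. -/
abbrev trivProd (F : Type*) [NormedAddCommGroup F] [NormedSpace ℝ F]
    (V : M → Type*) [TopologicalSpace (TotalSpace F V)]
    [∀ x, AddCommGroup (V x)] [∀ x, Module ℝ (V x)] [∀ x, TopologicalSpace (V x)]
    [FiberBundle F V] [VectorBundle ℝ F V] (x₀ : M) :
    Trivialization (F × E) (π (F × E) (V ×ᵇ (TangentSpace 𝓘(ℝ, E) : M → Type _))) :=
  trivializationAt (F × E) (V ×ᵇ (TangentSpace 𝓘(ℝ, E) : M → Type _)) x₀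

theorem trivProd_baseSet (x₀ : M) :
    (trivProd (E := E) F V x₀).baseSet =
      (trivializationAt F V x₀).baseSet ∩ (chartAt E x₀).source := rfl

theorem trivProd_continuousLinearMapAt {x₀ x : M}
    (hx : x ∈ (trivProd (E := E) F V x₀).baseSet) (z : V x × TangentSpace 𝓘(ℝ, E) x) :
    (trivProd (E := E) F V x₀).continuousLinearMapAt ℝ x z =
      ((trivializationAt F V x₀).continuousLinearMapAt ℝ x z.1,
        (trivializationAt E (TangentSpace 𝓘(ℝ, E)) x₀).continuousLinearMapAt ℝ x z.2) := by
  rw [Trivialization.continuousLinearMapAt_apply, Trivialization.coe_linearMapAt_of_mem _ hx,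
    Trivialization.continuousLinearMapAt_apply, Trivialization.coe_linearMapAt_of_mem _ hx.1,
    Trivialization.continuousLinearMapAt_apply, Trivialization.coe_linearMapAt_of_mem _ hx.2]
  rfl

variable [ContMDiffVectorBundle ∞ F V 𝓘(ℝ, E)]

theorem mem_chartAt_total_source {p q : TotalSpace F V} :
    q ∈ (chartAt (ModelProd E F) p).source ↔ q.proj ∈ (trivProd (E := E) F V p.proj).baseSet := by
  rw [FiberBundle.chartedSpace_chartAt, trivProd_baseSet]
  simp only [mfld_simps]
  rw [Trivialization.mem_source]
  exact and_congr_right fun h => by rw [Trivialization.coe_fst' _ h]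

theorem mem_total_baseSet {p q : TotalSpace F V} :
    q ∈ (trivializationAt (E × F) (TangentSpace (𝓘(ℝ, E).prod 𝓘(ℝ, F))) p).baseSet ↔
      q.proj ∈ (trivProd (E := E) F V p.proj).baseSet :=
  mem_chartAt_total_source

theorem extChartAt_total {p q : TotalSpace F V}
    (hq : q.proj ∈ (trivializationAt F V p.proj).baseSet) :
    extChartAt (𝓘(ℝ, E).prod 𝓘(ℝ, F)) p q =
      (extChartAt 𝓘(ℝ, E) p.proj q.proj, (trivializationAt F V p.proj q).2) := by
  rw [FiberBundle.extChartAt]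
  refine Prod.ext ?_ rfl
  change extChartAt 𝓘(ℝ, E) p.proj (trivializationAt F V p.proj q).1 = _
  rw [Trivialization.coe_fst' _ hq]

theorem mvfderiv_prodMk {E : Type*} [NormedAddCommGroup E] [NormedSpace ℝ E]
    {H : Type*} [TopologicalSpace H] {I : ModelWithCorners ℝ E H}
    {B : Type*} [TopologicalSpace B] [ChartedSpace H B]
    {P Q : Type*} [NormedAddCommGroup P] [NormedSpace ℝ P] [NormedAddCommGroup Q] [NormedSpace ℝ Q]
    {f : B → P} {g : B → Q} {x : B} (hf : MDifferentiableAt I 𝓘(ℝ, P) f x)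
    (hg : MDifferentiableAt I 𝓘(ℝ, Q) g x) (w : TangentSpace I x) :
    mfderiv I 𝓘(ℝ, P × Q) (fun y => (f y, g y)) x w = (mvfderiv I f x w, mvfderiv I g x w) := by
  have hf' := hf.hasMFDerivAt
  have hg' := hg.hasMFDerivAt
  let df : E →L[ℝ] P := mvfderiv I f x
  let dg : E →L[ℝ] Q := mvfderiv I g x
  have h1 : HasFDerivWithinAt (f ∘ (extChartAt I x).symm) df (Set.range I)
      (extChartAt I x x) := hf'.2
  have h2 : HasFDerivWithinAt (g ∘ (extChartAt I x).symm) dg (Set.range I)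
      (extChartAt I x x) := hg'.2
  have h4 : HasMFDerivAt I 𝓘(ℝ, P × Q) (fun y => (f y, g y)) x (df.prod dg) :=
    ⟨hf'.1.prodMk hg'.1, h1.prodMk h2⟩
  exact DFunLike.congr_fun h4.mfderiv w

/-- The preferred chart of the total space is the pair of the base chart after π and the fibre
coordinate, so its differential splits accordingly. -/
theorem continuousLinearMapAt_total {p q : TotalSpace F V}
    (hq : q.proj ∈ (trivProd (E := E) F V p.proj).baseSet)
    (w : TangentSpace (𝓘(ℝ, E).prod 𝓘(ℝ, F)) q) :
    (trivializationAt (E × F) (TangentSpace (𝓘(ℝ, E).prod 𝓘(ℝ, F))) p).continuousLinearMapAt ℝ q w =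
      ((trivializationAt E (TangentSpace 𝓘(ℝ, E)) p.proj).continuousLinearMapAt ℝ q.proj
        (mfderiv (𝓘(ℝ, E).prod 𝓘(ℝ, F)) 𝓘(ℝ, E) (fun r : TotalSpace F V => r.proj) q w),
        mvfderiv (𝓘(ℝ, E).prod 𝓘(ℝ, F))
          (fun r : TotalSpace F V => (trivializationAt F V p.proj r).2) q w) := by
  have hφ : MDifferentiableAt 𝓘(ℝ, E) 𝓘(ℝ, E) (extChartAt 𝓘(ℝ, E) p.proj) q.proj :=
    mdifferentiableAt_extChartAt hq.2
  have hπ := mdifferentiableAt_proj (E := E) q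
  have hξ := mdifferentiableAt_fiberCoord (E := E) (trivializationAt F V p.proj) hq.1
  have h1 : extChartAt (𝓘(ℝ, E).prod 𝓘(ℝ, F)) p =ᶠ[𝓝 q] fun r =>
      ((extChartAt 𝓘(ℝ, E) p.proj ∘ fun r : TotalSpace F V => r.proj) r,
        (trivializationAt F V p.proj r).2) := by
    filter_upwards [(trivializationAt F V p.proj).open_source.mem_nhds
      ((trivializationAt F V p.proj).mem_source.2 hq.1)] with r hr
    exact extChartAt_total ((trivializationAt F V p.proj).mem_source.1 hr)
  rw [TangentBundle.continuousLinearMapAt_trivializationAt (mem_chartAt_total_source.2 hq),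
    TangentBundle.continuousLinearMapAt_trivializationAt hq.2]
  have h2 := mvfderiv_prodMk (hφ.comp q hπ) hξ w
  have h3 : mvfderiv (𝓘(ℝ, E).prod 𝓘(ℝ, F))
      (extChartAt 𝓘(ℝ, E) p.proj ∘ fun r : TotalSpace F V => r.proj) q w =
      mfderiv 𝓘(ℝ, E) 𝓘(ℝ, E) (extChartAt 𝓘(ℝ, E) p.proj) q.proj
        (mfderiv (𝓘(ℝ, E).prod 𝓘(ℝ, F)) 𝓘(ℝ, E) (fun r : TotalSpace F V => r.proj) q w) :=
    mfderiv_comp_apply q hφ hπ w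
  rw [h3] at h2
  exact (DFunLike.congr_fun (h1.mfderiv_eq) w).trans h2

variable (cov : CovariantDerivative 𝓘(ℝ, E) F V)

theorem splitEquiv_apply (q : TotalSpace F V) (w : TangentSpace (𝓘(ℝ, E).prod 𝓘(ℝ, F)) q) :
    splitEquiv cov q w = (vertProj cov q w,
      mfderiv (𝓘(ℝ, E).prod 𝓘(ℝ, F)) 𝓘(ℝ, E) (fun r : TotalSpace F V => r.proj) q w) := rfl

/-- In the fixed trivialization D is dξ + A(dπ) ξ, and this is the first component of the shear. -/
theorem continuousLinearMapAt_splitEquiv {p q : TotalSpace F V}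
    (hq : q.proj ∈ (trivProd (E := E) F V p.proj).baseSet)
    (w : TangentSpace (𝓘(ℝ, E).prod 𝓘(ℝ, F)) q) :
    (trivProd (E := E) F V p.proj).continuousLinearMapAt ℝ q.proj (splitEquiv cov q w) =
      shear (connForm cov p.proj q.proj) (trivializationAt F V p.proj q).2
        ((trivializationAt (E × F) (TangentSpace (𝓘(ℝ, E).prod 𝓘(ℝ, F))) p).continuousLinearMapAt
          ℝ q w) := by
  rw [continuousLinearMapAt_total hq, trivProd_continuousLinearMapAt hq, splitEquiv_apply,
    shear_apply, vertProj_eq cov (trivializationAt F V p.proj) hq.1, map_add,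
    Trivialization.continuousLinearMapAt_symmL _ hq.1, connForm_apply,
    Trivialization.symmL_continuousLinearMapAt _ hq.2]

variable {K : ∀ x : M, Gen (V x × TangentSpace 𝓘(ℝ, E) x) →ₗ[ℝ] Gen (V x × TangentSpace 𝓘(ℝ, E) x)}

/-- The lift in coordinates. -/
theorem coordEnd_lift {p q : TotalSpace F V}
    (hq : q.proj ∈ (trivProd (E := E) F V p.proj).baseSet) (b : Gen (E × F)) :
    coordEnd (trivializationAt (E × F) (TangentSpace (𝓘(ℝ, E).prod 𝓘(ℝ, F))) p) (lift cov K) q b =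
      shearConj (connForm cov p.proj q.proj) (trivializationAt F V p.proj q).2
        (coordEnd (trivProd (E := E) F V p.proj) K q.proj).toLinearMap b := by
  set e₁ := trivializationAt (E × F) (TangentSpace (𝓘(ℝ, E).prod 𝓘(ℝ, F))) p
  set e₂ := trivProd (E := E) F V p.proj
  have h₁ : q ∈ e₁.baseSet := mem_total_baseSet.2 hq
  have h : ∀ a, coordGen e₂ q.proj (genMap (splitEquiv cov q) a) =
      genMap (shear (connForm cov p.proj q.proj) (trivializationAt F V p.proj q).2)
        (coordGen e₁ q a) :=
    coordGen_genMap h₁ hq (continuousLinearMapAt_splitEquiv cov hq)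
  obtain ⟨a, rfl⟩ : ∃ a, coordGen e₁ q a = b := ⟨coordGenSymm e₁ q b, coordGen_coordGenSymm h₁ b⟩
  rw [coordEnd_coordGen h₁]
  simp only [shearConj, LinearMap.comp_apply, LinearEquiv.coe_coe]
  rw [LinearEquiv.eq_symm_apply, ← h, ← h]
  simp only [lift, LinearMap.comp_apply, LinearEquiv.coe_coe, LinearEquiv.apply_symm_apply]
  exact (coordEnd_coordGen hq _).symm

end LiftCoordinates

/-! ### Smoothness and integrability of lifts. -/

section LiftSmooth

theorem genMap_shear_symm {E F : Type*} [NormedAddCommGroup E] [NormedSpace ℝ E]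
    [NormedAddCommGroup F] [NormedSpace ℝ F] (A : E →L[ℝ] F →L[ℝ] F) (ξ : F) (z : Gen (F × E)) :
    (genMap (shear A ξ)).symm z = ((z.1.2, z.1.1 - A z.1.2 ξ), z.2.comp
      (((ContinuousLinearMap.snd ℝ E F) + (A.flip ξ).comp (ContinuousLinearMap.fst ℝ E F)).prod
        (ContinuousLinearMap.fst ℝ E F))) := by
  refine Prod.ext rfl ?_
  ext v <;> simp [genMap]

/-- The inverse of S is explicit, so the conjugate is obtained from A, ξ and k by sums, evaluations
and compositions. -/
theorem contMDiffAt_shearConj {EB : Type*} [NormedAddCommGroup EB] [NormedSpace ℝ EB]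
    {HB : Type*} [TopologicalSpace HB] {I : ModelWithCorners ℝ EB HB}
    {B : Type*} [TopologicalSpace B] [ChartedSpace HB B]
    {E F : Type*} [NormedAddCommGroup E] [NormedSpace ℝ E] [FiniteDimensional ℝ E]
    [NormedAddCommGroup F] [NormedSpace ℝ F] [FiniteDimensional ℝ F]
    {A : B → E →L[ℝ] F →L[ℝ] F} {ξ : B → F} {k : B → Gen (F × E) →L[ℝ] Gen (F × E)} {x : B}
    (hA : ContMDiffAt I 𝓘(ℝ, E →L[ℝ] F →L[ℝ] F) ∞ A x) (hξ : ContMDiffAt I 𝓘(ℝ, F) ∞ ξ x)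
    (hk : ContMDiffAt I 𝓘(ℝ, Gen (F × E) →L[ℝ] Gen (F × E)) ∞ k x) (b : Gen (E × F)) :
    ContMDiffAt I 𝓘(ℝ, Gen (E × F)) ∞
      (fun y => shearConj (A y) (ξ y) (k y).toLinearMap b) x := by
  have hC : ContMDiffAt I 𝓘(ℝ, E →L[ℝ] F) ∞ (fun y => (A y).flip (ξ y)) x :=
    contMDiffAt_clm_of_apply fun u => (hA.clm_apply contMDiffAt_const).clm_apply hξ
  have h1 : ContMDiffAt I 𝓘(ℝ, Gen (F × E)) ∞ (fun y => genMap (shear (A y) (ξ y)) b) x := by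
    simp only [genMap_shear]
    exact ((shearLin b).contMDiff.contMDiffAt.comp x hC).add contMDiffAt_const
  have h2 : ContMDiffAt I 𝓘(ℝ, Gen (F × E)) ∞
      (fun y => k y (genMap (shear (A y) (ξ y)) b)) x := hk.clm_apply h1
  set z := fun y => k y (genMap (shear (A y) (ξ y)) b) with hz
  have h3 : (fun y => shearConj (A y) (ξ y) (k y).toLinearMap b) = fun y =>
      (((z y).1.2, (z y).1.1 - A y (z y).1.2 (ξ y)), (z y).2.comp
      (((ContinuousLinearMap.snd ℝ E F) + ((A y).flip (ξ y)).comp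
        (ContinuousLinearMap.fst ℝ E F)).prod (ContinuousLinearMap.fst ℝ E F))) := by
    ext1 y
    rw [← genMap_shear_symm]
    rfl
  rw [h3]
  have h4 : ContMDiffAt I 𝓘(ℝ, F × E) ∞ (fun y => (z y).1) x :=
    contDiff_fst.contMDiff.contMDiffAt.comp x h2
  have h5 : ContMDiffAt I 𝓘(ℝ, (F × E) →L[ℝ] ℝ) ∞ (fun y => (z y).2) x :=
    contDiff_snd.contMDiff.contMDiffAt.comp x h2
  have h6 : ContMDiffAt I 𝓘(ℝ, F) ∞ (fun y => (z y).1.1) x :=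
    contDiff_fst.contMDiff.contMDiffAt.comp x h4
  have h7 : ContMDiffAt I 𝓘(ℝ, E) ∞ (fun y => (z y).1.2) x :=
    contDiff_snd.contMDiff.contMDiffAt.comp x h4
  refine (h7.prodMk_space (h6.sub ((hA.clm_apply h7).clm_apply hξ))).prodMk_space
    (contMDiffAt_clm_of_apply fun v => h5.clm_apply ?_)
  exact (contMDiffAt_const.add (hC.clm_apply contMDiffAt_const)).prodMk_space contMDiffAt_const

variable {E : Type*} [NormedAddCommGroup E] [NormedSpace ℝ E] [FiniteDimensional ℝ E]
  {F : Type*} [NormedAddCommGroup F] [NormedSpace ℝ F] [FiniteDimensional ℝ F]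
  {M : Type*} [TopologicalSpace M] [ChartedSpace E M] [IsManifold 𝓘(ℝ, E) ∞ M]
  {V : M → Type*} [TopologicalSpace (TotalSpace F V)]
  [∀ x, AddCommGroup (V x)] [∀ x, Module ℝ (V x)] [∀ x, TopologicalSpace (V x)]
  [∀ x, IsTopologicalAddGroup (V x)] [∀ x, ContinuousSMul ℝ (V x)]
  [FiberBundle F V] [VectorBundle ℝ F V] [ContMDiffVectorBundle ∞ F V 𝓘(ℝ, E)]
  (cov : CovariantDerivative 𝓘(ℝ, E) F V)
  {K : ∀ x : M, Gen (V x × TangentSpace 𝓘(ℝ, E) x) →ₗ[ℝ] Gen (V x × TangentSpace 𝓘(ℝ, E) x)}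

/-- The algebraic conditions pass through the isometry F; smoothness is the coordinate formula
together with the smoothness of the connection form. -/
theorem lift_isGenAlmostComplex
    (hA : ∀ x₀, ContMDiffAt 𝓘(ℝ, E) 𝓘(ℝ, E →L[ℝ] F →L[ℝ] F) ∞ (connForm cov x₀) x₀)
    (hK : IsGenAlmostComplex (W := V ×ᵇ (TangentSpace 𝓘(ℝ, E) : M → Type _)) 𝓘(ℝ, E) (F × E) K) :
    IsGenAlmostComplex (𝓘(ℝ, E).prod 𝓘(ℝ, F)) (E × F) (lift cov K) where
  sq p u := by
    simp only [lift, LinearMap.comp_apply, LinearEquiv.coe_coe, LinearEquiv.apply_symm_apply]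
    rw [hK.sq, map_neg, LinearEquiv.symm_apply_apply]
  orth p u v := by
    rw [← pairing_genMap (splitEquiv cov p)]
    simp only [lift, LinearMap.comp_apply, LinearEquiv.coe_coe, LinearEquiv.apply_symm_apply]
    rw [hK.orth, pairing_genMap]
  smooth := by
    refine smooth_of_contMDiffAt_coordEnd fun p => contMDiffAt_clm_of_apply fun b => ?_
    have hp : p.proj ∈ (trivProd (E := E) F V p.proj).baseSet :=
      mem_baseSet_trivializationAt (F × E) (V ×ᵇ (TangentSpace 𝓘(ℝ, E) : M → Type _)) p.proj
    have hπ : ContMDiffAt (𝓘(ℝ, E).prod 𝓘(ℝ, F)) 𝓘(ℝ, E) ∞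
        (fun q : TotalSpace F V => q.proj) p := contMDiffAt_proj V
    have hξ : ContMDiffAt (𝓘(ℝ, E).prod 𝓘(ℝ, F)) 𝓘(ℝ, F) ∞
        (fun q : TotalSpace F V => (trivializationAt F V p.proj q).2) p :=
      ((Bundle.Trivialization.contMDiffOn (n := ∞) (IB := 𝓘(ℝ, E))
        (trivializationAt F V p.proj)).contMDiffAt
        ((trivializationAt F V p.proj).open_source.mem_nhds
          ((trivializationAt F V p.proj).mem_source.2 hp.1))).snd
    have hk := contMDiffAt_coordEnd hK.smooth p.proj
    refine (contMDiffAt_shearConj ((hA p.proj).comp p hπ) hξ (hk.comp p hπ) b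
      ).congr_of_eventuallyEq ?_
    filter_upwards [hπ.continuousAt.preimage_mem_nhds
      ((trivProd (E := E) F V p.proj).open_baseSet.mem_nhds hp)] with q hq
    exact coordEnd_lift cov hq b

/-- An endomorphism of `V ⊕ T_M ⊕ V^∨ ⊕ T_M^∨` in the preferred chart and trivialization. -/
def baseEndInChart (F : Type*) [NormedAddCommGroup F] [NormedSpace ℝ F] [FiniteDimensional ℝ F]
    {V : M → Type*} [TopologicalSpace (TotalSpace F V)]
    [∀ x, AddCommGroup (V x)] [∀ x, Module ℝ (V x)] [∀ x, TopologicalSpace (V x)]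
    [∀ x, IsTopologicalAddGroup (V x)] [∀ x, ContinuousSMul ℝ (V x)]
    [FiberBundle F V] [VectorBundle ℝ F V]
    (K : ∀ x : M, Gen (V x × TangentSpace 𝓘(ℝ, E) x) →ₗ[ℝ] Gen (V x × TangentSpace 𝓘(ℝ, E) x))
    (x₀ : M) (y : E) : Gen (F × E) →L[ℝ] Gen (F × E) :=
  coordEnd (trivProd (E := E) F V x₀) K ((extChartAt 𝓘(ℝ, E) x₀).symm y)

theorem differentiableAt_baseEndInChart
    (hK : IsGenAlmostComplex (W := V ×ᵇ (TangentSpace 𝓘(ℝ, E) : M → Type _)) 𝓘(ℝ, E) (F × E) K)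
    (x₀ : M) : DifferentiableAt ℝ (baseEndInChart F K x₀) (extChartAt 𝓘(ℝ, E) x₀ x₀) :=
  differentiableAt_comp_extChartAt_symm
    ((contMDiffAt_coordEnd hK.smooth x₀).mdifferentiableAt (by simp))

theorem extChartAt_total_symm_proj {p : TotalSpace F V} {y : E × F}
    (hy : y ∈ (extChartAt (𝓘(ℝ, E).prod 𝓘(ℝ, F)) p).target) :
    ((extChartAt (𝓘(ℝ, E).prod 𝓘(ℝ, F)) p).symm y).proj = (extChartAt 𝓘(ℝ, E) p.proj).symm y.1 ∧
    (trivializationAt F V p.proj ((extChartAt (𝓘(ℝ, E).prod 𝓘(ℝ, F)) p).symm y)).2 = y.2 ∧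
    ((extChartAt (𝓘(ℝ, E).prod 𝓘(ℝ, F)) p).symm y).proj ∈
      (trivProd (E := E) F V p.proj).baseSet := by
  have h1 := (extChartAt (𝓘(ℝ, E).prod 𝓘(ℝ, F)) p).map_target hy
  rw [extChartAt_source, mem_chartAt_total_source] at h1
  have h2 := extChartAt_total (E := E) h1.1
  rw [(extChartAt (𝓘(ℝ, E).prod 𝓘(ℝ, F)) p).right_inv hy] at h2
  have h3 : ((extChartAt (𝓘(ℝ, E).prod 𝓘(ℝ, F)) p).symm y).proj ∈
    (extChartAt 𝓘(ℝ, E) p.proj).source := by rw [extChartAt_source]; exact h1.2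
  refine ⟨?_, (congrArg Prod.snd h2).symm, h1⟩
  conv_rhs => rw [h2]
  exact ((extChartAt 𝓘(ℝ, E) p.proj).left_inv h3).symm

theorem endInChart_lift (p : TotalSpace F V) :
    ∀ᶠ y in 𝓝 (extChartAt (𝓘(ℝ, E).prod 𝓘(ℝ, F)) p p), ∀ b,
      endInChart (lift cov K) p y b = shearConj (connChart cov p.proj y.1) y.2
        (baseEndInChart F K p.proj y.1).toLinearMap b := by
  filter_upwards [extChartAt_target_mem_nhds (I := 𝓘(ℝ, E).prod 𝓘(ℝ, F)) p] with y hy b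
  obtain ⟨h1, h2, h3⟩ := extChartAt_total_symm_proj hy
  rw [endInChart, coordEnd_lift cov h3, h2, h1]
  rfl

theorem extChartAt_total_self (p : TotalSpace F V) :
    extChartAt (𝓘(ℝ, E).prod 𝓘(ℝ, F)) p p =
      (extChartAt 𝓘(ℝ, E) p.proj p.proj, (trivializationAt F V p.proj p).2) :=
  extChartAt_total (mem_baseSet_trivializationAt F V p.proj)

/-- The lift of `K` is integrable if and only if the form `nijBase` of `K` vanishes. -/
theorem integrable_lift_iff
    (hA : ∀ x₀, ContMDiffAt 𝓘(ℝ, E) 𝓘(ℝ, E →L[ℝ] F →L[ℝ] F) ∞ (connForm cov x₀) x₀)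
    (hflat : IsFlat cov)
    (hK : IsGenAlmostComplex (W := V ×ᵇ (TangentSpace 𝓘(ℝ, E) : M → Type _)) 𝓘(ℝ, E) (F × E) K) :
    Integrable (𝓘(ℝ, E).prod 𝓘(ℝ, F)) (lift cov K) ↔ ∀ x₀ a b c,
      nijBase (baseEndInChart F K x₀ (extChartAt 𝓘(ℝ, E) x₀ x₀))
        (fderiv ℝ (baseEndInChart F K x₀) (extChartAt 𝓘(ℝ, E) x₀ x₀))
        (connChart cov x₀ (extChartAt 𝓘(ℝ, E) x₀ x₀)) a b c = 0 := by
  have hJ := lift_isGenAlmostComplex cov hA hK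
  rw [isFlat_iff cov fun x₀ => differentiableAt_connChart cov (hA x₀)] at hflat
  -- The Nijenhuis form at p is the base form at π(p) in sheared arguments. The shear is invertible,
  -- so vanishing at p depends only on π(p).
  have key : ∀ (p : TotalSpace F V) a b c,
      nij (endInChart (lift cov K) p (extChartAt (𝓘(ℝ, E).prod 𝓘(ℝ, F)) p p))
        (fderiv ℝ (endInChart (lift cov K) p) (extChartAt (𝓘(ℝ, E).prod 𝓘(ℝ, F)) p p)) a b c =
      nijBase (baseEndInChart F K p.proj (extChartAt 𝓘(ℝ, E) p.proj p.proj))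
        (fderiv ℝ (baseEndInChart F K p.proj) (extChartAt 𝓘(ℝ, E) p.proj p.proj))
        (connChart cov p.proj (extChartAt 𝓘(ℝ, E) p.proj p.proj))
        (genMap (shear (connChart cov p.proj (extChartAt 𝓘(ℝ, E) p.proj p.proj))
          (trivializationAt F V p.proj p).2) a)
        (genMap (shear (connChart cov p.proj (extChartAt 𝓘(ℝ, E) p.proj p.proj))
          (trivializationAt F V p.proj p).2) b)
        (genMap (shear (connChart cov p.proj (extChartAt 𝓘(ℝ, E) p.proj p.proj))
          (trivializationAt F V p.proj p).2) c) := by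
    intro p a b c
    have h1 := (differentiableAt_connChart cov (hA p.proj)).hasFDerivAt
    have h2 := (differentiableAt_baseEndInChart hK p.proj).hasFDerivAt
    have h3 := (differentiableAt_endInChart hJ p).hasFDerivAt
    have h4 := endInChart_lift (K := K) cov p
    have hp := mem_baseSet_trivializationAt (F × E)
      (V ×ᵇ (TangentSpace 𝓘(ℝ, E) : M → Type _)) p.proj
    have h5 : ∀ u, baseEndInChart F K p.proj (extChartAt 𝓘(ℝ, E) p.proj p.proj)
        (baseEndInChart F K p.proj (extChartAt 𝓘(ℝ, E) p.proj p.proj) u) = -u := by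
      rw [baseEndInChart, extChartAt_to_inv]
      exact coordEnd_sq hK.sq hp
    have h6 : ∀ u v, pairing (baseEndInChart F K p.proj (extChartAt 𝓘(ℝ, E) p.proj p.proj) u)
        (baseEndInChart F K p.proj (extChartAt 𝓘(ℝ, E) p.proj p.proj) v) = pairing u v := by
      rw [baseEndInChart, extChartAt_to_inv]
      exact coordEnd_orth hK.orth hp
    rw [extChartAt_total_self] at h3 h4 ⊢
    exact nij_shearConj h1 h2 h3 h4 h5 h6 (hflat p.proj) a b c
  rw [integrable_iff hJ]
  constructor
  · intro h x₀ a b c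
    -- The zero section reaches every point of the base.
    have h1 := key ⟨x₀, 0⟩
    simp only [h] at h1
    let S := genMap (shear (connChart cov x₀ (extChartAt 𝓘(ℝ, E) x₀ x₀))
      (trivializationAt F V x₀ ⟨x₀, 0⟩).2)
    have h2 := h1 (S.symm a) (S.symm b) (S.symm c)
    simp only [S, LinearEquiv.apply_symm_apply] at h2
    exact h2.symm
  · intro h p a b c
    rw [key, h]

end LiftSmooth

/-! ### Transposition and the subspaces v ⊕ v^∨ and t ⊕ t^∨. -/

section TransposeParts

variable {v : Type*} [AddCommGroup v] [Module ℝ v] [TopologicalSpace v]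
  [IsTopologicalAddGroup v] [ContinuousSMul ℝ v]
  {t : Type*} [AddCommGroup t] [Module ℝ t] [TopologicalSpace t]
  [IsTopologicalAddGroup t] [ContinuousSMul ℝ t]

theorem transposeMap_neg (u : Gen (v × t)) : transposeMap (-u) = -transposeMap u := by
  refine Prod.ext (Prod.ext rfl rfl) ?_
  ext x <;> simp [transposeMap, evalDual]

theorem transposeMap_mem_leftPart [T2Space v] [FiniteDimensional ℝ v] (u : Gen (v × t)) :
    transposeMap u ∈ (leftPart : Submodule ℝ (Gen ((v →L[ℝ] ℝ) × t))) ↔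
      u ∈ (leftPart : Submodule ℝ (Gen (v × t))) := by
  have h : (transposeMap u).2.comp (ContinuousLinearMap.inr ℝ (v →L[ℝ] ℝ) t) =
      u.2.comp (ContinuousLinearMap.inr ℝ v t) := by
    ext x; simp [transposeMap]
  exact and_congr_right fun _ => by rw [h]

theorem transposeMap_mem_rightPart [T2Space v] [FiniteDimensional ℝ v] (u : Gen (v × t)) :
    transposeMap u ∈ (rightPart : Submodule ℝ (Gen ((v →L[ℝ] ℝ) × t))) ↔
      u ∈ (rightPart : Submodule ℝ (Gen (v × t))) := by
  have h : (transposeMap u).2.comp (ContinuousLinearMap.inl ℝ (v →L[ℝ] ℝ) t) =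
      evalDual u.1.1 := by
    ext x; simp [transposeMap]
  -- Injectivity of v → v^∨^∨. The two conditions defining the subspace t ⊕ t^∨ are exchanged by the
  -- transposition.
  have h1 : evalDual u.1.1 = 0 ↔ u.1.1 = 0 := by
    constructor
    · intro h0
      rw [← Module.forall_dual_apply_eq_zero_iff ℝ]
      exact fun f => DFunLike.congr_fun h0 (LinearMap.toContinuousLinearMap f)
    · intro h0
      rw [h0]
      ext f
      exact map_zero f
  change (_ = 0 ∧ (transposeMap u).2.comp _ = 0) ↔ (u.1.1 = 0 ∧ _ = 0)
  rw [h, h1, and_comm]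
  rfl

/-- Conjugation by the transposition preserves the condition `K (v ⊕ v^∨) = t ⊕ t^∨`. -/
theorem map_leftPart_iff_of_transposeMap [T2Space v] [FiniteDimensional ℝ v]
    {k : Gen (v × t) →ₗ[ℝ] Gen (v × t)}
    {k' : Gen ((v →L[ℝ] ℝ) × t) →ₗ[ℝ] Gen ((v →L[ℝ] ℝ) × t)}
    (h : ∀ z, k' (transposeMap z) = transposeMap (k z)) :
    Submodule.map k' leftPart = rightPart ↔ Submodule.map k leftPart = rightPart := by
  obtain ⟨hinj, hsurj⟩ := transposeMap_bijective (v := v) (t := t)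
  have h1 : ∀ z, transposeMap z ∈ Submodule.map k' leftPart ↔ z ∈ Submodule.map k leftPart := by
    intro z
    simp only [Submodule.mem_map]
    constructor
    · rintro ⟨y, hy, hz⟩
      obtain ⟨y, rfl⟩ := hsurj y
      rw [h] at hz
      exact ⟨y, (transposeMap_mem_leftPart y).1 hy, hinj hz⟩
    · rintro ⟨y, hy, rfl⟩
      exact ⟨transposeMap y, (transposeMap_mem_leftPart y).2 hy, h y⟩
  rw [SetLike.ext_iff, SetLike.ext_iff, hsurj.forall]
  simp only [h1, transposeMap_mem_rightPart]

end TransposeParts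

/-! ### Transposition in trivializations, and adapted structures. -/

section TransposeCoordinates

section Instances

variable (E F : Type*) [NormedAddCommGroup E] [NormedSpace ℝ E]
  [NormedAddCommGroup F] [NormedSpace ℝ F]

scoped instance : NormedAddCommGroup (Gen ((F →L[ℝ] ℝ) × E)) :=
  @Prod.normedAddCommGroup ((F →L[ℝ] ℝ) × E) (((F →L[ℝ] ℝ) × E) →L[ℝ] ℝ)
    Prod.normedAddCommGroup ContinuousLinearMap.toNormedAddCommGroup

scoped instance : AddCommGroup (Gen ((F →L[ℝ] ℝ) × E)) := NormedAddCommGroup.toAddCommGroup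

scoped instance : NormedSpace ℝ (Gen ((F →L[ℝ] ℝ) × E)) :=
  @Prod.normedSpace ℝ ((F →L[ℝ] ℝ) × E) (((F →L[ℝ] ℝ) × E) →L[ℝ] ℝ) _ _ _
    Prod.normedSpace ContinuousLinearMap.toNormedSpace

end Instances

variable {E : Type*} [NormedAddCommGroup E] [NormedSpace ℝ E] [FiniteDimensional ℝ E]
  {F : Type*} [NormedAddCommGroup F] [NormedSpace ℝ F] [FiniteDimensional ℝ F]
  {M : Type*} [TopologicalSpace M] [ChartedSpace E M] [IsManifold 𝓘(ℝ, E) ∞ M]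
  {V : M → Type*} [TopologicalSpace (TotalSpace F V)]
  [∀ x, AddCommGroup (V x)] [∀ x, Module ℝ (V x)] [∀ x, TopologicalSpace (V x)]
  [∀ x, IsTopologicalAddGroup (V x)] [∀ x, ContinuousSMul ℝ (V x)]
  [FiberBundle F V] [VectorBundle ℝ F V]

theorem trivProd_symmL {x₀ x : M} (hx : x ∈ (trivProd (E := E) F V x₀).baseSet) (z : F × E) :
    (trivProd (E := E) F V x₀).symmL ℝ x z =
      ((trivializationAt F V x₀).symmL ℝ x z.1,
        (trivializationAt E (TangentSpace 𝓘(ℝ, E)) x₀).symmL ℝ x z.2) := by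
  have h := trivProd_continuousLinearMapAt hx ((trivializationAt F V x₀).symmL ℝ x z.1,
        (trivializationAt E (TangentSpace 𝓘(ℝ, E)) x₀).symmL ℝ x z.2)
  rw [Trivialization.continuousLinearMapAt_symmL _ hx.1,
    Trivialization.continuousLinearMapAt_symmL _ hx.2] at h
  rw [← Trivialization.symmL_continuousLinearMapAt (R := ℝ) (trivProd (E := E) F V x₀) hx
    ((trivializationAt F V x₀).symmL ℝ x z.1,
        (trivializationAt E (TangentSpace 𝓘(ℝ, E)) x₀).symmL ℝ x z.2), h]

theorem trivProd_dual_baseSet (x₀ : M) :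
    (trivProd (E := E) (F →L[ℝ] ℝ) (DualBundle V) x₀).baseSet =
      (trivProd (E := E) F V x₀).baseSet := by
  rw [trivProd_baseSet, trivProd_baseSet, dual_baseSet]

variable [ContMDiffVectorBundle ∞ F V 𝓘(ℝ, E)]

/-- The trivialization of V^∨ is dual to that of V, so in coordinates the transposition has constant
coefficients: it is the transposition of the model fibre. -/
theorem coordGen_transposeMap {x₀ x : M} (hx : x ∈ (trivProd (E := E) F V x₀).baseSet)
    (u : Gen (V x × TangentSpace 𝓘(ℝ, E) x)) :
    coordGen (trivProd (E := E) (F →L[ℝ] ℝ) (DualBundle V) x₀) x (transposeMap u) =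
      transposeMap (coordGen (trivProd (E := E) F V x₀) x u) := by
  have hx' : x ∈ (trivProd (E := E) (F →L[ℝ] ℝ) (DualBundle V) x₀).baseSet := by
    rwa [trivProd_dual_baseSet]
  refine Prod.ext ?_ ?_
  · refine (trivProd_continuousLinearMapAt hx' _).trans (Prod.ext ?_ ?_)
    · refine (dual_continuousLinearMapAt hx.1 _).trans ?_
      ext ξ
      have h := congrArg u.2 (trivProd_symmL hx (ξ, 0))
      rw [map_zero] at h
      exact h.symm
    · exact (congrArg Prod.snd (trivProd_continuousLinearMapAt hx u.1)).symm
  · refine ContinuousLinearMap.ext fun z => ?_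
    have h0 : ∀ (w : Gen (V x × TangentSpace 𝓘(ℝ, E) x)) (f : DualBundle V x) b,
        (transposeMap w).2 (f, b) = f w.1.1 + w.2 (0, b) := fun _ _ _ => rfl
    have h1 : ((trivProd (E := E) (F →L[ℝ] ℝ) (DualBundle V) x₀).symmL ℝ x z) = _ :=
      trivProd_symmL hx' z
    rw [dual_symmL hx.1] at h1
    have h2 := trivProd_symmL hx (0, z.2)
    rw [map_zero] at h2
    have h3 := congrArg Prod.fst (trivProd_continuousLinearMapAt hx u.1)
    exact ((congrArg (transposeMap u).2 h1).trans (h0 _ _ _)).trans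
      (congrArg₂ (· + ·) (congrArg z.1 h3).symm (congrArg u.2 h2).symm)

variable {K : ∀ x : M, Gen (V x × TangentSpace 𝓘(ℝ, E) x) →ₗ[ℝ] Gen (V x × TangentSpace 𝓘(ℝ, E) x)}
  {K' : ∀ x : M, Gen (DualBundle V x × TangentSpace 𝓘(ℝ, E) x) →ₗ[ℝ]
    Gen (DualBundle V x × TangentSpace 𝓘(ℝ, E) x)}

theorem coordEnd_transposeMap (h : ∀ x z, K' x (transposeMap z) = transposeMap (K x z))
    {x₀ x : M} (hx : x ∈ (trivProd (E := E) F V x₀).baseSet) (b : Gen (F × E)) :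
    coordEnd (trivProd (E := E) (F →L[ℝ] ℝ) (DualBundle V) x₀) K' x (transposeMap b) =
      transposeMap (coordEnd (trivProd (E := E) F V x₀) K x b) := by
  obtain ⟨a, rfl⟩ : ∃ a, coordGen (trivProd (E := E) F V x₀) x a = b :=
    ⟨coordGenSymm (trivProd (E := E) F V x₀) x b, coordGen_coordGenSymm hx b⟩
  have hx' : x ∈ (trivProd (E := E) (F →L[ℝ] ℝ) (DualBundle V) x₀).baseSet := by
    rwa [trivProd_dual_baseSet]
  rw [← coordGen_transposeMap hx, coordEnd_coordGen hx', h, coordEnd_coordGen hx,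
    coordGen_transposeMap hx]

/-- The transposition on the model fibre, as a continuous linear isomorphism. -/
def transposeModel (E F : Type*) [NormedAddCommGroup E] [NormedSpace ℝ E] [FiniteDimensional ℝ E]
    [NormedAddCommGroup F] [NormedSpace ℝ F] [FiniteDimensional ℝ F] :
    Gen (F × E) ≃L[ℝ] Gen ((F →L[ℝ] ℝ) × E) :=
  LinearEquiv.toContinuousLinearEquiv transpose

/-- The two matrices are conjugate by a fixed isomorphism of the model fibres. -/
theorem contMDiffAt_coordEnd_transpose_iff
    (h : ∀ x z, K' x (transposeMap z) = transposeMap (K x z)) (x₀ : M) :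
    ContMDiffAt 𝓘(ℝ, E) 𝓘(ℝ, Gen ((F →L[ℝ] ℝ) × E) →L[ℝ] Gen ((F →L[ℝ] ℝ) × E)) ∞
        (coordEnd (trivProd (E := E) (F →L[ℝ] ℝ) (DualBundle V) x₀) K') x₀ ↔
      ContMDiffAt 𝓘(ℝ, E) 𝓘(ℝ, Gen (F × E) →L[ℝ] Gen (F × E)) ∞
        (coordEnd (trivProd (E := E) F V x₀) K) x₀ := by
  have hev : ∀ᶠ x in 𝓝 x₀, x ∈ (trivProd (E := E) F V x₀).baseSet :=
    (trivProd (E := E) F V x₀).open_baseSet.mem_nhds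
      (mem_baseSet_trivializationAt (F × E) (V ×ᵇ (TangentSpace 𝓘(ℝ, E) : M → Type _)) x₀)
  constructor
  · refine fun hK => contMDiffAt_clm_of_apply fun b => ?_
    refine (((transposeModel E F).symm.contDiff.contMDiff.contMDiffAt).comp x₀
      (hK.clm_apply (contMDiffAt_const (c := transposeMap b)))).congr_of_eventuallyEq ?_
    filter_upwards [hev] with x hx
    refine ((ContinuousLinearEquiv.symm_apply_eq _).2 ?_).symm
    exact coordEnd_transposeMap h hx b
  · refine fun hK => contMDiffAt_clm_of_apply fun b => ?_
    obtain ⟨b, rfl⟩ := (transposeModel E F).surjective b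
    refine (((transposeModel E F).contDiff.contMDiff.contMDiffAt).comp x₀
      (hK.clm_apply (contMDiffAt_const (c := b)))).congr_of_eventuallyEq ?_
    filter_upwards [hev] with x hx
    exact coordEnd_transposeMap h hx b

variable [∀ x, T2Space (V x)] [∀ x, FiniteDimensional ℝ (V x)]

/-- K and K' are intertwined by a bijective isometry in each fibre. Stating this as a relation lets
one argument serve both directions without inverting the transposition. -/
theorem isGenAlmostComplex_iff_of_transposeMap
    (h : ∀ x z, K' x (transposeMap z) = transposeMap (K x z)) :
    IsGenAlmostComplex (W := DualBundle V ×ᵇ (TangentSpace 𝓘(ℝ, E) : M → Type _)) 𝓘(ℝ, E)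
        ((F →L[ℝ] ℝ) × E) K' ↔
      IsGenAlmostComplex (W := V ×ᵇ (TangentSpace 𝓘(ℝ, E) : M → Type _)) 𝓘(ℝ, E) (F × E) K := by
  have hb : ∀ x, Function.Bijective
      (transposeMap : Gen (V x × TangentSpace 𝓘(ℝ, E) x) →ₗ[ℝ] _) :=
    fun x => transposeMap_bijective
  constructor
  · refine fun hK => ⟨fun x u => (hb x).1 ?_, fun x u v => ?_, ?_⟩
    · rw [← h, ← h]
      exact (hK.sq x _).trans (transposeMap_neg u).symm
    · rw [← pairing_transposeMap, ← h, ← h]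
      exact (hK.orth x _ _).trans (pairing_transposeMap _ _)
    · exact smooth_of_contMDiffAt_coordEnd fun x₀ =>
        (contMDiffAt_coordEnd_transpose_iff h x₀).1 (contMDiffAt_coordEnd hK.smooth x₀)
  · refine fun hK => ⟨fun x => (hb x).2.forall.2 fun u => ?_,
      fun x => (hb x).2.forall.2 fun u => (hb x).2.forall.2 fun v => ?_, ?_⟩
    · refine (congrArg (K' x) (h x u)).trans ((h x _).trans ?_)
      exact (congrArg transposeMap (hK.sq x u)).trans (transposeMap_neg u)
    · refine (congrArg₂ pairing (h x u) (h x v)).trans ((pairing_transposeMap _ _).trans ?_)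
      exact (hK.orth x u v).trans (pairing_transposeMap _ _).symm
    · exact smooth_of_contMDiffAt_coordEnd fun x₀ =>
        (contMDiffAt_coordEnd_transpose_iff h x₀).2 (contMDiffAt_coordEnd hK.smooth x₀)

theorem isAdapted_iff_of_transposeMap
    (h : ∀ x z, K' x (transposeMap z) = transposeMap (K x z)) :
    IsAdapted (F →L[ℝ] ℝ) K' ↔ IsAdapted F K := by
  have h1 := isGenAlmostComplex_iff_of_transposeMap (F := F) h
  have h2 := fun x => map_leftPart_iff_of_transposeMap (h x)
  exact ⟨fun hK => ⟨h1.1 hK.1, fun x => (h2 x).1 (hK.2 x)⟩,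
    fun hK => ⟨h1.2 hK.1, fun x => (h2 x).2 (hK.2 x)⟩⟩

end TransposeCoordinates

/-! ### Comparing a lift with its dual. -/

section Mirror

variable {E : Type*} [NormedAddCommGroup E] [NormedSpace ℝ E] [FiniteDimensional ℝ E]
  {F : Type*} [NormedAddCommGroup F] [NormedSpace ℝ F] [FiniteDimensional ℝ F]
  {M : Type*} [TopologicalSpace M] [ChartedSpace E M] [IsManifold 𝓘(ℝ, E) ∞ M]
  {V : M → Type*} [TopologicalSpace (TotalSpace F V)]
  [∀ x, AddCommGroup (V x)] [∀ x, Module ℝ (V x)] [∀ x, TopologicalSpace (V x)]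
  [∀ x, IsTopologicalAddGroup (V x)] [∀ x, ContinuousSMul ℝ (V x)]
  [FiberBundle F V] [VectorBundle ℝ F V] [ContMDiffVectorBundle ∞ F V 𝓘(ℝ, E)]
  (cov : CovariantDerivative 𝓘(ℝ, E) F V)
  {K K₁ : ∀ x : M, Gen (V x × TangentSpace 𝓘(ℝ, E) x) →ₗ[ℝ] Gen (V x × TangentSpace 𝓘(ℝ, E) x)}
  {K' K₁' : ∀ x : M, Gen (DualBundle V x × TangentSpace 𝓘(ℝ, E) x) →ₗ[ℝ]
    Gen (DualBundle V x × TangentSpace 𝓘(ℝ, E) x)}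

theorem lift_apply (p : TotalSpace F V) (u : GenTangent (𝓘(ℝ, E).prod 𝓘(ℝ, F)) p) :
    genMap (splitEquiv cov p) (lift cov K p u) = K p.proj (genMap (splitEquiv cov p) u) :=
  (genMap (splitEquiv cov p)).apply_symm_apply _

/-- F is invertible and every base point carries a point of the total space, for instance zero; this
is why the lift has a well-defined dual. -/
theorem lift_injective (h : lift cov K = lift cov K₁) : K = K₁ := by
  funext x
  let p : TotalSpace F V := ⟨x, 0⟩
  refine LinearMap.ext fun z => ?_
  obtain ⟨u, rfl⟩ := (genMap (splitEquiv cov p)).surjective z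
  exact (lift_apply cov p u).symm.trans ((congrArg (fun J : ∀ p : TotalSpace F V,
    GenTangent (𝓘(ℝ, E).prod 𝓘(ℝ, F)) p →ₗ[ℝ] GenTangent (𝓘(ℝ, E).prod 𝓘(ℝ, F)) p =>
      genMap (splitEquiv cov p) (J p u)) h).trans (lift_apply cov p u))

theorem commutes_lift_iff :
    Commutes (𝓘(ℝ, E).prod 𝓘(ℝ, F)) (lift cov K) (lift cov K₁) ↔
      ∀ x z, K x (K₁ x z) = K₁ x (K x z) := by
  constructor
  · intro h x z
    let p : TotalSpace F V := ⟨x, 0⟩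
    obtain ⟨u, rfl⟩ := (genMap (splitEquiv cov p)).surjective z
    have h1 := congrArg (genMap (splitEquiv cov p)) (h p u)
    rwa [lift_apply, lift_apply, lift_apply, lift_apply] at h1
  · intro h p u
    apply (genMap (splitEquiv cov p)).injective
    rw [lift_apply, lift_apply, lift_apply, lift_apply, h]

theorem positiveProduct_lift_iff (σ : ℤˣ) :
    PositiveProduct (𝓘(ℝ, E).prod 𝓘(ℝ, F)) σ (lift cov K) (lift cov K₁) ↔
      ∀ x z, z ≠ 0 → 0 < ((σ : ℤ) : ℝ) * pairing (-(K x (K₁ x z))) z := by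
  have key : ∀ (p : TotalSpace F V) u, pairing (-(lift cov K p (lift cov K₁ p u))) u =
      pairing (-(K p.proj (K₁ p.proj (genMap (splitEquiv cov p) u))))
        (genMap (splitEquiv cov p) u) := by
    intro p u
    rw [← pairing_genMap (splitEquiv cov p), map_neg, lift_apply, lift_apply]
  constructor
  · intro h x z hz
    let p : TotalSpace F V := ⟨x, 0⟩
    obtain ⟨u, rfl⟩ := (genMap (splitEquiv cov p)).surjective z
    have h1 := h p u (fun h0 => hz (by rw [h0]; exact map_zero (genMap (splitEquiv cov p))))
    rwa [key] at h1
  · intro h p u hu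
    rw [key]
    exact h _ _ fun h0 => hu ((genMap (splitEquiv cov p)).injective
      (h0.trans (map_zero (genMap (splitEquiv cov p))).symm))

variable [∀ x, T2Space (V x)] [∀ x, FiniteDimensional ℝ (V x)]

theorem commutes_lift_iff_of_transposeMap
    (h : ∀ x z, K' x (transposeMap z) = transposeMap (K x z))
    (h₁ : ∀ x z, K₁' x (transposeMap z) = transposeMap (K₁ x z)) :
    Commutes (𝓘(ℝ, E).prod 𝓘(ℝ, F)) (lift cov K) (lift cov K₁) ↔
      Commutes (𝓘(ℝ, E).prod 𝓘(ℝ, F →L[ℝ] ℝ)) (lift (dualConn cov) K')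
        (lift (dualConn cov) K₁') := by
  rw [commutes_lift_iff, commutes_lift_iff]
  refine forall_congr' fun x => ?_
  obtain ⟨hinj, hsurj⟩ := transposeMap_bijective (v := V x) (t := TangentSpace 𝓘(ℝ, E) x)
  rw [hsurj.forall]
  refine forall_congr' fun z => ?_
  rw [h, h₁, h, h₁]
  exact hinj.eq_iff.symm

theorem positiveProduct_lift_iff_of_transposeMap (σ : ℤˣ)
    (h : ∀ x z, K' x (transposeMap z) = transposeMap (K x z))
    (h₁ : ∀ x z, K₁' x (transposeMap z) = transposeMap (K₁ x z)) :
    PositiveProduct (𝓘(ℝ, E).prod 𝓘(ℝ, F)) σ (lift cov K) (lift cov K₁) ↔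
      PositiveProduct (𝓘(ℝ, E).prod 𝓘(ℝ, F →L[ℝ] ℝ)) σ (lift (dualConn cov) K')
        (lift (dualConn cov) K₁') := by
  rw [positiveProduct_lift_iff, positiveProduct_lift_iff]
  refine forall_congr' fun x => ?_
  obtain ⟨hinj, hsurj⟩ := transposeMap_bijective (v := V x) (t := TangentSpace 𝓘(ℝ, E) x)
  rw [hsurj.forall]
  refine forall_congr' fun z => ?_
  have h0 : (transposeMap z : Gen (DualBundle V x × TangentSpace 𝓘(ℝ, E) x)) ≠ 0 ↔ z ≠ 0 :=
    not_congr ⟨fun h2 => hinj (h2.trans (map_zero transposeMap).symm),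
      fun h2 => by rw [h2]; exact map_zero transposeMap⟩
  have h2 : pairing (-(K' x (K₁' x (transposeMap z)))) (transposeMap z) =
      pairing (-(K x (K₁ x z))) z := by
    rw [h₁, h]
    exact (congrArg (fun w => pairing w _) (transposeMap_neg _).symm).trans
      (pairing_transposeMap _ _)
  rw [h0, h2]

/-- The intertwining relation holds near the centre of the chart with the constant map
`transposeModel`, so it may be differentiated. -/
theorem fderiv_baseEndInChart_transposeMap
    (h : ∀ x z, K' x (transposeMap z) = transposeMap (K x z))
    {x₀ : M} (hd : DifferentiableAt ℝ (baseEndInChart F K x₀) (extChartAt 𝓘(ℝ, E) x₀ x₀))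
    (hd' : DifferentiableAt ℝ (baseEndInChart (F →L[ℝ] ℝ) K' x₀) (extChartAt 𝓘(ℝ, E) x₀ x₀))
    (u : E) (z : Gen (F × E)) :
    fderiv ℝ (baseEndInChart (F →L[ℝ] ℝ) K' x₀) (extChartAt 𝓘(ℝ, E) x₀ x₀) u (transposeMap z) =
      transposeMap (fderiv ℝ (baseEndInChart F K x₀) (extChartAt 𝓘(ℝ, E) x₀ x₀) u z) := by
  have hc : Filter.Tendsto (extChartAt 𝓘(ℝ, E) x₀).symm (𝓝 (extChartAt 𝓘(ℝ, E) x₀ x₀))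
      (𝓝 x₀) := by
    have := continuousAt_extChartAt_symm (I := 𝓘(ℝ, E)) x₀
    rwa [ContinuousAt, extChartAt_to_inv] at this
  have h1 := (hd'.hasFDerivAt.clm_apply_const (transposeMap z)).fderiv
  have h2 := ((transposeModel E F).toContinuousLinearMap.hasFDerivAt.comp _
    (hd.hasFDerivAt.clm_apply_const z)).fderiv
  have h3 : (fun y => baseEndInChart (F →L[ℝ] ℝ) K' x₀ y (transposeMap z))
      =ᶠ[𝓝 (extChartAt 𝓘(ℝ, E) x₀ x₀)]
      (transposeModel E F).toContinuousLinearMap ∘ fun y => baseEndInChart F K x₀ y z := by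
    filter_upwards [hc.eventually ((trivProd (E := E) F V x₀).open_baseSet.mem_nhds
      (mem_baseSet_trivializationAt (F × E) (V ×ᵇ (TangentSpace 𝓘(ℝ, E) : M → Type _)) x₀))]
      with y hy
    exact coordEnd_transposeMap h hy z
  exact DFunLike.congr_fun (h1.symm.trans ((h3.fderiv_eq (𝕜 := ℝ)).trans h2)) u

/-- Both integrability conditions are the vanishing of a base form at each point of M, and the
transposition of the model fibre, being surjective and compatible with all the data, carries one
form to the other. -/
theorem integrable_lift_iff_of_transposeMap
    (hA : ∀ x₀, ContMDiffAt 𝓘(ℝ, E) 𝓘(ℝ, E →L[ℝ] F →L[ℝ] F) ∞ (connForm cov x₀) x₀)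
    (hflat : IsFlat cov) (h : ∀ x z, K' x (transposeMap z) = transposeMap (K x z))
    (hK : IsGenAlmostComplex (W := V ×ᵇ (TangentSpace 𝓘(ℝ, E) : M → Type _)) 𝓘(ℝ, E) (F × E) K) :
    Integrable (𝓘(ℝ, E).prod 𝓘(ℝ, F)) (lift cov K) ↔
      Integrable (𝓘(ℝ, E).prod 𝓘(ℝ, F →L[ℝ] ℝ)) (lift (dualConn cov) K') := by
  have hK' := (isGenAlmostComplex_iff_of_transposeMap (F := F) h).2 hK
  rw [integrable_lift_iff cov hA hflat hK, integrable_lift_iff (dualConn cov)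
    (fun x₀ => contMDiffAt_connForm_dualConn cov (hA x₀)) (isFlat_dualConn cov hA hflat) hK']
  refine forall_congr' fun x₀ => ?_
  have hsurj := (transposeMap_bijective (v := F) (t := E)).2
  have h1 := (connChart_dualConn_eventuallyEq cov x₀).self_of_nhds
  have h2 : ∀ z, baseEndInChart (F →L[ℝ] ℝ) K' x₀ (extChartAt 𝓘(ℝ, E) x₀ x₀) (transposeMap z) =
      transposeMap (baseEndInChart F K x₀ (extChartAt 𝓘(ℝ, E) x₀ x₀) z) := by
    rw [baseEndInChart, baseEndInChart, extChartAt_to_inv]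
    exact coordEnd_transposeMap h
      (mem_baseSet_trivializationAt (F × E) (V ×ᵇ (TangentSpace 𝓘(ℝ, E) : M → Type _)) x₀)
  have h3 := fderiv_baseEndInChart_transposeMap h (differentiableAt_baseEndInChart hK x₀)
    (differentiableAt_baseEndInChart hK' x₀)
  rw [hsurj.forall]
  refine forall_congr' fun a => ?_
  rw [hsurj.forall]
  refine forall_congr' fun b => ?_
  rw [hsurj.forall]
  refine forall_congr' fun c => ?_
  rw [nijBase_map pairing_transposeMap (fun _ => rfl) (connPair_transposeMap h1) h2 h3]

end Mirror

/-! ### The bijection of semi-flat structures. -/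

section Correspondence

variable {E : Type*} [NormedAddCommGroup E] [NormedSpace ℝ E] [FiniteDimensional ℝ E]
  {F : Type*} [NormedAddCommGroup F] [NormedSpace ℝ F] [FiniteDimensional ℝ F]
  {M : Type*} [TopologicalSpace M] [ChartedSpace E M] [IsManifold 𝓘(ℝ, E) ∞ M]
  {V : M → Type*} [TopologicalSpace (TotalSpace F V)]
  [∀ x, AddCommGroup (V x)] [∀ x, Module ℝ (V x)] [∀ x, TopologicalSpace (V x)]
  [∀ x, IsTopologicalAddGroup (V x)] [∀ x, ContinuousSMul ℝ (V x)]
  [FiberBundle F V] [VectorBundle ℝ F V] [ContMDiffVectorBundle ∞ F V 𝓘(ℝ, E)]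

theorem mirror_transposeMap
    (K : ∀ x : M, Gen (V x × TangentSpace 𝓘(ℝ, E) x) →ₗ[ℝ] Gen (V x × TangentSpace 𝓘(ℝ, E) x))
    (x : M) (z : Gen (V x × TangentSpace 𝓘(ℝ, E) x)) :
    mirror F K x (transposeMap z) = transposeMap (K x z) := by
  have : T2Space (V x) := FiberBundle.t2Space F V x
  have : FiniteDimensional ℝ (V x) := VectorBundle.finiteDimensional ℝ F V x
  exact congrArg (fun w => transposeMap (K x w)) (transpose.symm_apply_apply z)

theorem mirror_injective : Function.Injective (mirror F (V := V) (E := E) (M := M)) := by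
  intro K K₁ h
  have : ∀ x, T2Space (V x) := FiberBundle.t2Space F V
  have : ∀ x, FiniteDimensional ℝ (V x) := fun x =>
    VectorBundle.finiteDimensional ℝ F V x
  funext x
  refine LinearMap.ext fun z => transposeMap_bijective.1 ?_
  rw [← mirror_transposeMap (F := F), ← mirror_transposeMap (F := F), h]

theorem mirror_surjective : Function.Surjective (mirror F (V := V) (E := E) (M := M)) := by
  intro K'
  have : ∀ x, T2Space (V x) := FiberBundle.t2Space F V
  have : ∀ x, FiniteDimensional ℝ (V x) := fun x =>
    VectorBundle.finiteDimensional ℝ F V x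
  refine ⟨fun x => transpose.symm.toLinearMap ∘ₗ K' x ∘ₗ transpose.toLinearMap, ?_⟩
  funext x
  refine LinearMap.ext ?_
  rw [(transposeMap_bijective (v := V x) (t := TangentSpace 𝓘(ℝ, E) x)).2.forall]
  intro z
  rw [mirror_transposeMap]
  exact transpose.apply_symm_apply _

theorem isAdapted_mirror_iff
    {K : ∀ x : M, Gen (V x × TangentSpace 𝓘(ℝ, E) x) →ₗ[ℝ] Gen (V x × TangentSpace 𝓘(ℝ, E) x)} :
    IsAdapted (F →L[ℝ] ℝ) (mirror F K) ↔ IsAdapted F K := by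
  have : ∀ x, T2Space (V x) := FiberBundle.t2Space F V
  have : ∀ x, FiniteDimensional ℝ (V x) := fun x =>
    VectorBundle.finiteDimensional ℝ F V x
  exact isAdapted_iff_of_transposeMap (mirror_transposeMap K)

/-- For a flat connection with smooth connection form, the lift of an adapted structure is
automatically a generalized almost complex structure. -/
theorem isSemiFlat_iff {cov : CovariantDerivative 𝓘(ℝ, E) F V}
    (hA : ∀ x₀, ContMDiffAt 𝓘(ℝ, E) 𝓘(ℝ, E →L[ℝ] F →L[ℝ] F) ∞ (connForm cov x₀) x₀)
    (hflat : IsFlat cov)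
    {J : ∀ p : TotalSpace F V,
      GenTangent (𝓘(ℝ, E).prod 𝓘(ℝ, F)) p →ₗ[ℝ] GenTangent (𝓘(ℝ, E).prod 𝓘(ℝ, F)) p} :
    IsSemiFlat cov J ↔ ∃ K, IsAdapted F K ∧ J = lift cov K := by
  refine ⟨fun h => h.exists_lift, fun h => ⟨hflat, ?_, h⟩⟩
  obtain ⟨K, hK, rfl⟩ := h
  exact lift_isGenAlmostComplex cov hA hK.isGenAlmostComplex

/-- The semi-flat structures are the lifts of the adapted structures. -/
def semiFlatEquiv (cov : CovariantDerivative 𝓘(ℝ, E) F V)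
    (hA : ∀ x₀, ContMDiffAt 𝓘(ℝ, E) 𝓘(ℝ, E →L[ℝ] F →L[ℝ] F) ∞ (connForm cov x₀) x₀)
    (hflat : IsFlat cov) :
    {K : ∀ x : M, Gen (V x × TangentSpace 𝓘(ℝ, E) x) →ₗ[ℝ] Gen (V x × TangentSpace 𝓘(ℝ, E) x) //
      IsAdapted F K} ≃ SemiFlat cov :=
  Equiv.ofBijective
    (fun K => ⟨lift cov K.1, (isSemiFlat_iff hA hflat).2 ⟨K.1, K.2, rfl⟩⟩)
    ⟨fun _ _ h => Subtype.ext (lift_injective cov (congrArg Subtype.val h)), fun J => by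
      obtain ⟨K, hK, hJ⟩ := J.2.exists_lift
      exact ⟨⟨K, hK⟩, Subtype.ext hJ.symm⟩⟩

/-- The fibrewise dual, as a bijection between adapted structures. -/
def mirrorEquiv :
    {K : ∀ x : M, Gen (V x × TangentSpace 𝓘(ℝ, E) x) →ₗ[ℝ] Gen (V x × TangentSpace 𝓘(ℝ, E) x) //
      IsAdapted F K} ≃
    {K : ∀ x : M, Gen (DualBundle V x × TangentSpace 𝓘(ℝ, E) x) →ₗ[ℝ]
      Gen (DualBundle V x × TangentSpace 𝓘(ℝ, E) x) // IsAdapted (F →L[ℝ] ℝ) K} :=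
  (Equiv.ofBijective (mirror F) ⟨mirror_injective, mirror_surjective⟩).subtypeEquiv
    fun _ => isAdapted_mirror_iff.symm

end Correspondence

end GenGeom

end

/-! ### The mirror correspondence. -/

theorem mainTheorem5
    {E : Type*} [NormedAddCommGroup E] [NormedSpace ℝ E] [FiniteDimensional ℝ E]
    {F : Type*} [NormedAddCommGroup F] [NormedSpace ℝ F] [FiniteDimensional ℝ F]
    {M : Type*} [TopologicalSpace M] [T2Space M] [ChartedSpace E M] [IsManifold 𝓘(ℝ, E) ∞ M]
    {V : M → Type*} [TopologicalSpace (TotalSpace F V)]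
    [∀ x, AddCommGroup (V x)] [∀ x, Module ℝ (V x)] [∀ x, TopologicalSpace (V x)]
    [∀ x, IsTopologicalAddGroup (V x)] [∀ x, ContinuousSMul ℝ (V x)]
    [FiberBundle F V] [VectorBundle ℝ F V] [ContMDiffVectorBundle ∞ F V 𝓘(ℝ, E)]
    (hrank : Module.finrank ℝ F = Module.finrank ℝ E)
    (cov : CovariantDerivative 𝓘(ℝ, E) F V)
    (hsmooth : CovariantDerivative.ContMDiffCovariantDerivative cov ∞)
    (hflat : GenGeom.IsFlat cov) :
    ∃ Φ : GenGeom.SemiFlat cov ≃ GenGeom.SemiFlat (GenGeom.dualConn cov),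
      -- the lift of `K` is sent to the lift of the fibrewise dual of `K`
      (∀ K, GenGeom.IsAdapted F K → GenGeom.IsAdapted (F →L[ℝ] ℝ) (GenGeom.mirror F K) ∧
        ∀ J : GenGeom.SemiFlat cov, J.1 = GenGeom.lift cov K →
          (Φ J).1 = GenGeom.lift (GenGeom.dualConn cov) (GenGeom.mirror F K)) ∧
      (∀ J : GenGeom.SemiFlat cov,
        GenGeom.Integrable (𝓘(ℝ, E).prod 𝓘(ℝ, F)) J.1 ↔
          GenGeom.Integrable (𝓘(ℝ, E).prod 𝓘(ℝ, F →L[ℝ] ℝ)) (Φ J).1) ∧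
      (∀ J J' : GenGeom.SemiFlat cov,
        GenGeom.Commutes (𝓘(ℝ, E).prod 𝓘(ℝ, F)) J.1 J'.1 ↔
          GenGeom.Commutes (𝓘(ℝ, E).prod 𝓘(ℝ, F →L[ℝ] ℝ)) (Φ J).1 (Φ J').1) ∧
      ∀ σ : ℤˣ,
        (∀ J J' : GenGeom.SemiFlat cov,
          GenGeom.PositiveProduct (𝓘(ℝ, E).prod 𝓘(ℝ, F)) σ J.1 J'.1 ↔
            GenGeom.PositiveProduct (𝓘(ℝ, E).prod 𝓘(ℝ, F →L[ℝ] ℝ)) σ (Φ J).1 (Φ J').1) ∧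
        ∃ Ψ : GenGeom.SemiFlatKahler σ cov ≃ GenGeom.SemiFlatKahler σ (GenGeom.dualConn cov),
          ∀ P, (Ψ P).1 = (Φ P.1.1, Φ P.1.2) := by
  have hA := GenGeom.contMDiffAt_connForm cov hsmooth
  have hA' := fun x₀ => GenGeom.contMDiffAt_connForm_dualConn cov (hA x₀)
  have hT : ∀ x, T2Space (V x) := FiberBundle.t2Space F V
  have hV : ∀ x, FiniteDimensional ℝ (V x) := fun x =>
    VectorBundle.finiteDimensional ℝ F V x
  let ε := GenGeom.semiFlatEquiv cov hA hflat
  let ε' := GenGeom.semiFlatEquiv (GenGeom.dualConn cov) hA'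
    (GenGeom.isFlat_dualConn cov hA hflat)
  -- Descend to the adapted structure on the base, transpose, and lift along ∇^∨. The equivalences
  -- below are checked on lifts, which exhaust the semi-flat structures.
  let Φ := ε.symm.trans (GenGeom.mirrorEquiv.trans ε')
  have hΦ : ∀ K, (Φ (ε K)).1 = GenGeom.lift (GenGeom.dualConn cov) (GenGeom.mirror F K.1) := by
    intro K
    change (ε' (GenGeom.mirrorEquiv (ε.symm (ε K)))).1 = _
    rw [ε.symm_apply_apply]
    rfl
  have hint : ∀ J : GenGeom.SemiFlat cov,
      GenGeom.Integrable (𝓘(ℝ, E).prod 𝓘(ℝ, F)) J.1 ↔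
        GenGeom.Integrable (𝓘(ℝ, E).prod 𝓘(ℝ, F →L[ℝ] ℝ)) (Φ J).1 := by
    rw [ε.surjective.forall]
    intro K
    rw [hΦ]
    exact GenGeom.integrable_lift_iff_of_transposeMap cov hA hflat
      (GenGeom.mirror_transposeMap K.1) K.2.isGenAlmostComplex
  have hcomm : ∀ J J' : GenGeom.SemiFlat cov,
      GenGeom.Commutes (𝓘(ℝ, E).prod 𝓘(ℝ, F)) J.1 J'.1 ↔
        GenGeom.Commutes (𝓘(ℝ, E).prod 𝓘(ℝ, F →L[ℝ] ℝ)) (Φ J).1 (Φ J').1 := by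
    rw [ε.surjective.forall₂]
    intro K K'
    rw [hΦ, hΦ]
    exact GenGeom.commutes_lift_iff_of_transposeMap cov (GenGeom.mirror_transposeMap K.1)
      (GenGeom.mirror_transposeMap K'.1)
  have hpos : ∀ (σ : ℤˣ) (J J' : GenGeom.SemiFlat cov),
      GenGeom.PositiveProduct (𝓘(ℝ, E).prod 𝓘(ℝ, F)) σ J.1 J'.1 ↔
        GenGeom.PositiveProduct (𝓘(ℝ, E).prod 𝓘(ℝ, F →L[ℝ] ℝ)) σ (Φ J).1 (Φ J').1 := by
    intro σ
    rw [ε.surjective.forall₂]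
    intro K K'
    rw [hΦ, hΦ]
    exact GenGeom.positiveProduct_lift_iff_of_transposeMap cov σ
      (GenGeom.mirror_transposeMap K.1) (GenGeom.mirror_transposeMap K'.1)
  refine ⟨Φ, fun K hK => ⟨GenGeom.isAdapted_mirror_iff.2 hK, fun J hJ => ?_⟩, hint, hcomm,
    -- The bijection of Kähler pairs is Φ × Φ restricted to pairs; each defining condition is
    -- preserved in both directions.
    fun σ => ⟨hpos σ, (Equiv.prodCongr Φ Φ).subtypeEquiv fun P => ?_, fun P => rfl⟩⟩
  · obtain rfl : ε ⟨K, hK⟩ = J := Subtype.ext hJ.symm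
    exact hΦ ⟨K, hK⟩
  · constructor
    · exact fun h => ⟨(Φ P.1).2.isGenAlmostComplex, (Φ P.2).2.isGenAlmostComplex,
        (hcomm _ _).1 h.commutes, (hpos σ _ _).1 h.positive, (hint _).1 h.integrable_left,
        (hint _).1 h.integrable_right⟩
    · exact fun h => ⟨P.1.2.isGenAlmostComplex, P.2.2.isGenAlmostComplex,
        (hcomm _ _).2 h.commutes, (hpos σ _ _).2 h.positive, (hint _).2 h.integrable_left,
        (hint _).2 h.integrable_right⟩
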